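/- Let $\mathbb F$ be an algebraically closed field of characteristic $0$, let $n\ge 1$ and $d\ge 2$. For a morphism $f=[f_0:\cdots:f_n]:\mathbb P^n\to\mathbb P^n$ of algebraic degree $d$ over $\mathbb F$ (the $f_i$ are homogeneous polynomials of degree $d$ without a common zero in $\mathbb P^n$), let $\mathcal C_f=\{\det(\partial f_i/\partial x_j)=0\}\subset\mathbb P^n$ be its critical locus and $\mathcal B_f=f(\mathcal C_f)$, with its reduced structure, its branch locus. For a point $q\in\mathbb P^n$ let $f^*(q)=\sum_{f(x)=q} m_x\,x$, where $m_x$ is the multiplicity of $x$ in the scheme-theoretic fibre $f^{-1}(q)$, i.e. the $\mathbb F$-dimension of the local ring of this fibre at $x$. Consider the condition $$f^*(q)=2p+p_1+p_2+\cdots+p_{d^n-2},\qquad p_1,\dots,p_{d^n-2}\ \text{distinct points different from } p.\tag{$*$}$$ (a) There exist a morphism $f:\mathbb P^n\to\mathbb P^n$ of degree $d$, each of whose coordinates $f_i$ is a product of $d$ linear forms, and points $q\in\mathcal B_f$ and $p,p_1,\dots,p_{d^n-2}\in\mathbb P^n$ that satisfy $(*)$. (b) Let $f:\mathbb P^n\to\mathbb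 P^n$ be any morphism of degree $d$ (its coordinates need not be products of linear forms) and let $q,p,p_1,\dots,p_{d^n-2}$ be points that satisfy $(*)$. Then: (1) $q$ is a smooth point of $\mathcal B_f$, and it lies on exactly one irreducible component $B$ of $\mathcal B_f$. (2) There is exactly one irreducible component $C$ of $\mathcal C_f$ with $f(C)=B$. (3) The map $f|_C:C\to B$ is generically $1$-to-$1$: there is a nonempty Zariski open subset of $B$ each of whose points has exactly one preimage in $C$. (4) The map $f$ has multiplicity $2$ along $C$: if $s$ and $t$ are homogeneous polynomials generating the homogeneous ideals of the hypersurfaces $C$ and $B$ (with their reduced structures), then $t(f_0,\dots,f_n)=u\,s^2$ with a polynomial $u$ that does not vanish identically on $C$. -/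

import Mathlib

open MvPolynomial
open scoped LinearAlgebra.Projectivization

/-- Projective `n`-space over `F`, as the set of its `F`-points (lines in `F ^ (n + 1)`). -/
abbrev ProjSpace (F : Type*) [Field F] (n : ℕ) : Type _ := ℙ F (Fin (n + 1) → F)

/-- A morphism `ℙⁿ → ℙⁿ` of algebraic degree `d`: `n + 1` homogeneous polynomials of degree `d`
without a common zero other than the origin. -/
structure ProjMorphism (F : Type*) [Field F] (n d : ℕ) where
  coords : Fin (n + 1) → MvPolynomial (Fin (n + 1)) F
  isHomogeneous : ∀ i, (coords i).IsHomogeneous d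
  eq_zero_of_common_zero : ∀ v : Fin (n + 1) → F, (∀ i, eval v (coords i) = 0) → v = 0

section ProjectiveGeometry

variable {F : Type*} [Field F] {n : ℕ}

/-- The set of points of `ℙⁿ` at which every element of `S` vanishes. It is used only for sets of
homogeneous polynomials, for which it does not depend on the chosen representatives. -/
def projZeroLocus (S : Set (MvPolynomial (Fin (n + 1)) F)) : Set (ProjSpace F n) :=
  {x | ∀ g ∈ S, eval x.rep g = 0}

/-- Zariski closed subsets of `ℙⁿ`: the common zeros of a set of homogeneous polynomials. -/
def IsAlgebraicSet (Z : Set (ProjSpace F n)) : Prop :=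
  ∃ S : Set (MvPolynomial (Fin (n + 1)) F),
    (∀ g ∈ S, ∃ m : ℕ, g.IsHomogeneous m) ∧ Z = projZeroLocus S

theorem isAlgebraicSet_empty : IsAlgebraicSet (∅ : Set (ProjSpace F n)) := by
  refine ⟨{1}, ?_, ?_⟩
  · rintro g rfl
    exact ⟨0, isHomogeneous_one _ _⟩
  · ext x
    simp [projZeroLocus]

theorem isAlgebraicSet_sInter (A : Set (Set (ProjSpace F n)))
    (hA : A ⊆ {Z | IsAlgebraicSet Z}) : IsAlgebraicSet (⋂₀ A) := by
  refine ⟨{g | (∃ m : ℕ, g.IsHomogeneous m) ∧ ∃ Z ∈ A, ∀ x ∈ Z, eval x.rep g = 0},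
    fun g hg => hg.1, ?_⟩
  ext x
  constructor
  · rintro hx g ⟨-, Z, hZ, hg⟩
    exact hg x (hx Z hZ)
  · intro hx Z hZ
    obtain ⟨S, hS, rfl⟩ := hA hZ
    exact fun g hg => hx g ⟨hS g hg, _, hZ, fun y hy => hy g hg⟩

theorem isAlgebraicSet_union (Y : Set (ProjSpace F n)) (hY : IsAlgebraicSet Y)
    (Z : Set (ProjSpace F n)) (hZ : IsAlgebraicSet Z) : IsAlgebraicSet (Y ∪ Z) := by
  obtain ⟨S, hS, rfl⟩ := hY
  obtain ⟨T, hT, rfl⟩ := hZ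
  refine ⟨{g | ∃ s ∈ S, ∃ t ∈ T, g = s * t}, ?_, ?_⟩
  · rintro g ⟨s, hs, t, ht, rfl⟩
    obtain ⟨a, ha⟩ := hS s hs
    obtain ⟨b, hb⟩ := hT t ht
    exact ⟨a + b, ha.mul hb⟩
  · ext x
    constructor
    · rintro (hx | hx) g ⟨s, hs, t, ht, rfl⟩
      · rw [map_mul, hx s hs, zero_mul]
      · rw [map_mul, hx t ht, mul_zero]
    · intro hx
      by_contra hcon
      simp only [Set.mem_union, projZeroLocus, Set.mem_ofPred_eq, not_or, not_forall] at hcon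
      obtain ⟨⟨s, hs, hs'⟩, t, ht, ht'⟩ := hcon
      have := hx (s * t) ⟨s, hs, t, ht, rfl⟩
      rw [map_mul] at this
      exact (mul_ne_zero hs' ht') this

/-- The Zariski topology on `ℙⁿ`. -/
instance zariskiTopology : TopologicalSpace (ProjSpace F n) :=
  TopologicalSpace.ofClosed {Z | IsAlgebraicSet Z} isAlgebraicSet_empty isAlgebraicSet_sInter
    isAlgebraicSet_union

/-- The irreducible components of a subset `X` of `ℙⁿ`: its maximal irreducible subsets. -/
def componentsOf (X : Set (ProjSpace F n)) : Set (Set (ProjSpace F n)) :=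
  {Z | Maximal (fun Y => IsIrreducible Y ∧ Y ⊆ X) Z}

/-- The punctured affine cone over a subset of `ℙⁿ`. -/
def affineCone (Z : Set (ProjSpace F n)) : Set (Fin (n + 1) → F) :=
  {v | ∃ hv : v ≠ 0, Projectivization.mk F v hv ∈ Z}

/-- The homogeneous ideal of a subset of `ℙⁿ` (over an infinite field). -/
noncomputable def projIdeal (Z : Set (ProjSpace F n)) : Ideal (MvPolynomial (Fin (n + 1)) F) :=
  vanishingIdeal F (affineCone Z)

/-- The index of a nonzero coordinate of the point `x`. -/
noncomputable def chartIndex (x : ProjSpace F n) : Fin (n + 1) :=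
  Classical.choose (Function.ne_iff.mp x.rep_nonzero)

theorem rep_chartIndex_ne_zero (x : ProjSpace F n) : x.rep (chartIndex x) ≠ 0 :=
  Classical.choose_spec (Function.ne_iff.mp x.rep_nonzero)

/-- The local ring at `x` of the closed subscheme of `ℙⁿ` cut out by the homogeneous ideal `I`
(the zero ring when `x` does not lie on that subscheme). Write `v` for a representative of `x` and
let `v k ≠ 0`. The chart `X k ≠ 0` of `ℙⁿ` is identified with the affine hyperplane `X k = v k`, in
which `x` is the point `v`, and the subscheme with the one cut out by `I` and `X k - v k`; its
coordinate ring is localized at `v`. -/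
abbrev ProjLocalRing (I : Ideal (MvPolynomial (Fin (n + 1)) F)) (x : ProjSpace F n) : Type _ :=
  Localization.AtPrime (vanishingIdeal F {x.rep}) ⧸
    Ideal.map (algebraMap (MvPolynomial (Fin (n + 1)) F)
        (Localization.AtPrime (vanishingIdeal F {x.rep})))
      (I ⊔ Ideal.span {X (chartIndex x) - C (x.rep (chartIndex x))})

/-- `x` is a smooth point of the closed set `Z`, with its reduced structure: it lies on `Z` and the
local ring there is regular (which is smoothness, over an algebraically closed field). -/
def IsSmoothPointOf (Z : Set (ProjSpace F n)) (x : ProjSpace F n) : Prop :=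
  x ∈ Z ∧ IsRegularLocalRing (ProjLocalRing (projIdeal Z) x)

end ProjectiveGeometry

namespace ProjMorphism

variable {F : Type*} [Field F] {n d : ℕ} (f : ProjMorphism F n d)

theorem eval_rep_ne_zero (x : ProjSpace F n) : (fun i => eval x.rep (f.coords i)) ≠ 0 :=
  fun h => x.rep_nonzero (f.eq_zero_of_common_zero _ fun i => congrFun h i)

/-- The map on points: `x ↦ [f₀(x) : ⋯ : fₙ(x)]`. -/
noncomputable def toFun (x : ProjSpace F n) : ProjSpace F n :=
  Projectivization.mk F (fun i => eval x.rep (f.coords i)) (f.eval_rep_ne_zero x)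

/-- The Jacobian determinant `det (∂fᵢ/∂xⱼ)`. -/
noncomputable def jacobianDet : MvPolynomial (Fin (n + 1)) F :=
  Matrix.det (Matrix.of fun i j => pderiv j (f.coords i))

/-- The critical locus of `f`. -/
def critLocus : Set (ProjSpace F n) := projZeroLocus {f.jacobianDet}

/-- The branch locus of `f`: the image of the critical locus. -/
def branchLocus : Set (ProjSpace F n) := f.toFun '' f.critLocus

/-- The homogeneous ideal of the scheme-theoretic fibre `f⁻¹(q)`: the condition
`[f₀ : ⋯ : fₙ] = q`, expressed by the `2 × 2` minors. -/
noncomputable def fibreIdeal (q : ProjSpace F n) : Ideal (MvPolynomial (Fin (n + 1)) F) :=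
  Ideal.span {g | ∃ i j, g = C (q.rep i) * f.coords j - C (q.rep j) * f.coords i}

/-- The multiplicity of the point `x` in the scheme-theoretic fibre `f⁻¹(q)`: the `F`-dimension of
its local ring there. It is `0` off the fibre. -/
noncomputable def fibreMult (q x : ProjSpace F n) : ℕ :=
  Module.finrank F (ProjLocalRing (f.fibreIdeal q) x)

/-- `f^*(q) = 2 p + p₁ + ⋯ + p_{dⁿ - 2}`, where the `pᵢ` are distinct points, different
from `p`. -/
def IsMinimallyBranchedAt (q p : ProjSpace F n) (ps : Fin (d ^ n - 2) → ProjSpace F n) : Prop :=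
  Function.Injective ps ∧ (∀ i, ps i ≠ p) ∧
    {x | f.toFun x = q} = insert p (Set.range ps) ∧
    f.fibreMult q p = 2 ∧ ∀ i, f.fibreMult q (ps i) = 1

/-- `f` has multiplicity `k` along the irreducible hypersurface `C'`, which it maps to the
irreducible hypersurface `B'`: if `s` and `t` are equations of `C'` and `B'` (generators of their
homogeneous ideals), the pull-back of `t` is `u * s ^ k`, where `u` does not vanish identically on
`C'`, and so is a unit in the local ring at the general point of `C'`. -/
def HasMultiplicityAlong (C' B' : Set (ProjSpace F n)) (k : ℕ) : Prop :=
  ∃ s t u : MvPolynomial (Fin (n + 1)) F,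
    projIdeal C' = Ideal.span {s} ∧ projIdeal B' = Ideal.span {t} ∧
      bind₁ f.coords t = u * s ^ k ∧ u ∉ projIdeal C'

/-- The restriction `f|_{C'} : C' → B'` is generically 1-to-1: over a nonempty Zariski open subset
of `B'`, every point has exactly one preimage in `C'`. -/
def IsGenericallyOneToOne (C' B' : Set (ProjSpace F n)) : Prop :=
  ∃ U : Set (ProjSpace F n), IsOpen U ∧ (U ∩ B').Nonempty ∧
    ∀ y ∈ U ∩ B', ∃! x, x ∈ C' ∧ f.toFun x = y

end ProjMorphism

/-! The work is done on the affine cone, with the polynomial map of `F ^ (n + 1)` to itself given by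
the coordinates of `f`. Write `J` for the Jacobian determinant. Euler's formula `Df(v) v = d f(v)`
keeps the radial direction out of the kernel of the differential.

Condition (*) is used only through `IsIsolatedFold`: `p` is the only critical point of its fibre,
and `dJ` is nonzero on nonzero kernel vectors of `Df`. This is extracted from the multiplicities by
arcs: a kernel vector gives a tangent direction of the fibre, hence multiplicity at least 2. A
kernel vector killed by `dJ` gives either an arc along which `f` is constant to third order or a
second tangent direction, hence multiplicity at least 3 (`isFoldAt_of_fibreMult_eq_two`).

The centre is `exists_smooth_hypersurface`. Over `w = f(v)` the critical cone consists of the points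
`ζ v` with `ζ ^ d = 1`, and the fold condition makes this fibre reduced. After averaging over the
roots of unity, Nakayama's lemma for the finite map `f` shows that invariant functions on the
critical cone come from the target near `w`. A linear form that kills the image of `Df(v)` pulls
back to second order, which yields an equation `t` of the image with nonzero differential at `w`.

The remaining claims follow. Images of hypersurfaces are hypersurfaces, by a norm argument
(`exists_forall_dvd_pow_iff`). The equation of the branch locus divides `t`, so it has nonzero
differential at `w`: the point is smooth and lies on one component. Similarly only one factor of `J`
passes through `p`. Forms of degree `d` descend to the target, so `C → B` is injective over an open
set. The chain rule multiplied by the adjugate of the Jacobian matrix gives multiplicity exactly 2.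
For the existence part, `FoldExample.morphism` is a product of linear forms in which just two of the
`d ^ n` solutions of the fibre equations coincide. -/

namespace MvPolynomial

/-! ### Tangent spaces and unramified ideals of polynomials -/

variable {F : Type*} [Field F] {σ : Type*} [Fintype σ]

/-- The derivative of `g` at the point `v` in the direction `k`. -/
noncomputable def dirDeriv (v k : σ → F) (g : MvPolynomial σ F) : F :=
  ∑ j, k j * eval v (pderiv j g)

theorem dirDeriv_add (v k : σ → F) (g h : MvPolynomial σ F) :
    dirDeriv v k (g + h) = dirDeriv v k g + dirDeriv v k h := by
  simp [dirDeriv, mul_add, Finset.sum_add_distrib]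

theorem dirDeriv_sub (v k : σ → F) (g h : MvPolynomial σ F) :
    dirDeriv v k (g - h) = dirDeriv v k g - dirDeriv v k h := by
  simp [dirDeriv, mul_sub, Finset.sum_sub_distrib]

theorem dirDeriv_mul (v k : σ → F) (g h : MvPolynomial σ F) :
    dirDeriv v k (g * h) = eval v g * dirDeriv v k h + eval v h * dirDeriv v k g := by
  simp only [dirDeriv, Derivation.leibniz, smul_eq_mul, map_add, map_mul, mul_add,
    Finset.sum_add_distrib, Finset.mul_sum]
  congr 1 <;> exact Finset.sum_congr rfl fun j _ => by ring

@[simp]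
theorem dirDeriv_C (v k : σ → F) (c : F) : dirDeriv v k (C c) = 0 := by
  simp [dirDeriv]

@[simp]
theorem dirDeriv_X (v k : σ → F) (i : σ) : dirDeriv v k (X i) = k i := by
  classical
  simp [dirDeriv, pderiv_X, Pi.single_apply]

theorem dirDeriv_C_mul (v k : σ → F) (c : F) (g : MvPolynomial σ F) :
    dirDeriv v k (C c * g) = c * dirDeriv v k g := by
  rw [dirDeriv_mul]; simp

theorem dirDeriv_sum {ι : Type*} (s : Finset ι) (v k : σ → F) (g : ι → MvPolynomial σ F) :
    dirDeriv v k (∑ i ∈ s, g i) = ∑ i ∈ s, dirDeriv v k (g i) := by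
  simp only [dirDeriv, map_sum, Finset.mul_sum]
  rw [Finset.sum_comm]

theorem dirDeriv_add_dir (v k l : σ → F) (g : MvPolynomial σ F) :
    dirDeriv v (k + l) g = dirDeriv v k g + dirDeriv v l g := by
  simp [dirDeriv, add_mul, Finset.sum_add_distrib]

theorem dirDeriv_smul_dir (v k : σ → F) (c : F) (g : MvPolynomial σ F) :
    dirDeriv v (c • k) g = c * dirDeriv v k g := by
  simp [dirDeriv, Finset.mul_sum, mul_assoc]

theorem dirDeriv_single [DecidableEq σ] (v : σ → F) (j : σ) (g : MvPolynomial σ F) :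
    dirDeriv v (Pi.single j 1) g = eval v (pderiv j g) := by
  simp [dirDeriv, Pi.single_apply]

theorem mem_vanishingIdeal_singleton {v : σ → F} {g : MvPolynomial σ F} :
    g ∈ vanishingIdeal F {v} ↔ eval v g = 0 := by
  rw [mem_vanishingIdeal_singleton_iff, aeval_eq_eval]

/-- First-order Taylor expansion at `v`. -/
theorem sub_taylor_mem_sq (v : σ → F) (g : MvPolynomial σ F) :
    g - C (eval v g) - ∑ j, C (eval v (pderiv j g)) * (X j - C (v j)) ∈
      vanishingIdeal F {v} ^ 2 := by
  classical
  have hX : ∀ j, (X j - C (v j) : MvPolynomial σ F) ∈ vanishingIdeal F {v} := fun j => by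
    simp
  induction g using MvPolynomial.induction_on with
  | C a => simp
  | add p q hp hq =>
    convert add_mem hp hq using 1
    simp only [map_add, add_mul, Finset.sum_add_distrib]
    ring
  | mul_X p i hp =>
    have h1 : (∑ j, C (eval v (pderiv j p)) * (X j - C (v j))) * (X i - C (v i)) ∈
        vanishingIdeal F {v} ^ 2 := by
      rw [pow_two]
      exact Ideal.mul_mem_mul (sum_mem fun j _ => Ideal.mul_mem_left _ _ (hX j)) (hX i)
    convert add_mem (Ideal.mul_mem_right (X i) _ hp) h1 using 1
    have : ∑ j, C (eval v (pderiv j (p * X i))) * (X j - C (v j)) =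
        C (v i) * ∑ j, C (eval v (pderiv j p)) * (X j - C (v j)) +
          C (eval v p) * (X i - C (v i)) := by
      simp only [Derivation.leibniz, pderiv_X, smul_eq_mul, map_add, map_mul, add_mul,
        Finset.sum_add_distrib, eval_X]
      rw [add_comm, Finset.mul_sum]
      congr 1
      · exact Finset.sum_congr rfl fun j _ => by ring
      · rw [Finset.sum_eq_single i] <;> simp +contextual
    rw [this]
    simp only [map_mul, eval_X]
    ring

theorem mem_sq_of_dirDeriv_eq_zero {v : σ → F} {g : MvPolynomial σ F} (h0 : eval v g = 0)
    (h1 : ∀ k, dirDeriv v k g = 0) : g ∈ vanishingIdeal F {v} ^ 2 := by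
  classical
  have := sub_taylor_mem_sq v g
  have h2 : ∀ j, eval v (pderiv j g) = 0 := fun j => by rw [← dirDeriv_single]; exact h1 _
  simpa [h0, h2] using this

/-- Nakayama's lemma for a point: an ideal whose Zariski tangent space at `v` is zero agrees with
the maximal ideal of `v` near `v`. -/
theorem exists_mul_mem_of_tangent_eq_bot {v : σ → F} {I : Ideal (MvPolynomial σ F)}
    (hI : ∀ k : σ → F, (∀ g ∈ I, dirDeriv v k g = 0) → k = 0) (hIv : I ≤ vanishingIdeal F {v}) :
    ∃ e : MvPolynomial σ F, eval v e ≠ 0 ∧ ∀ g ∈ vanishingIdeal F {v}, e * g ∈ I := by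
  classical
  let grad : MvPolynomial σ F →ₗ[F] (σ → F) :=
    LinearMap.pi fun j => (aeval v).toLinearMap ∘ₗ (pderiv j).toLinearMap
  have hgrad : ∀ g j, grad g j = eval v (pderiv j g) := fun g j => by
    simp [grad, aeval_eq_eval]
  -- A functional that kills all gradients of elements of `I` is a tangent vector of `I` at `v`,
  -- hence zero.
  have htop : (I.restrictScalars F).map grad = ⊤ := by
    by_contra hne
    obtain ⟨ψ, hψ, hle⟩ := Submodule.exists_le_ker_of_lt_top _ (lt_top_iff_ne_top.mpr hne)
    apply hψ
    have hk : (fun j => ψ (Pi.single j 1)) = 0 := by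
      apply hI
      intro g hg
      have h := hle (Submodule.mem_map_of_mem (f := grad) (show g ∈ I.restrictScalars F from hg))
      rw [LinearMap.mem_ker, LinearMap.pi_apply_eq_sum_univ] at h
      simp only [dirDeriv]
      rw [← h]
      refine Finset.sum_congr rfl fun j _ => ?_
      rw [smul_eq_mul, mul_comm, hgrad]
      congr 2
      ext l
      simp [Pi.single_apply, eq_comm]
    refine LinearMap.pi_ext' fun j => ?_
    ext
    simpa using congrFun hk j
  -- Some element of `I` has the same gradient as `g`; the difference is of second order.
  have hsup : vanishingIdeal F {v} ≤ I ⊔ vanishingIdeal F {v} • vanishingIdeal F {v} := by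
    intro g hg
    obtain ⟨i, hi, hig⟩ : grad g ∈ (I.restrictScalars F).map grad := htop ▸ Submodule.mem_top
    have h1 : g - i ∈ vanishingIdeal F {v} ^ 2 := by
      apply mem_sq_of_dirDeriv_eq_zero
      · rw [map_sub, mem_vanishingIdeal_singleton.mp hg, mem_vanishingIdeal_singleton.mp (hIv hi),
          sub_zero]
      · intro k
        simp only [dirDeriv, map_sub, ← hgrad, hig]
        simp
    rw [pow_two] at h1
    have := Submodule.add_mem_sup (show i ∈ I from hi) h1
    rwa [add_sub_cancel] at this
  obtain ⟨r, hr, hrI⟩ := Submodule.exists_sub_one_mem_and_smul_le_of_fg_of_le_sup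
    (IsNoetherian.noetherian (vanishingIdeal F {v})) le_rfl hsup
  refine ⟨r, ?_, fun g hg => hrI (Submodule.smul_mem_pointwise_smul _ _ _ hg)⟩
  rw [mem_vanishingIdeal_singleton, map_sub, map_one, sub_eq_zero] at hr
  rw [hr]
  exact one_ne_zero

section Unramified

variable [IsAlgClosed F]

/-- By the Nullstellensatz a proper colon ideal `I : g` lies in the maximal ideal of a point `v`, a
zero of `I`; but it contains `e`, which does not vanish at `v`. -/
theorem mem_of_forall_exists_mul_mem {I : Ideal (MvPolynomial σ F)} {g : MvPolynomial σ F}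
    (h : ∀ v, (∀ p ∈ I, eval v p = 0) → ∃ e, eval v e ≠ 0 ∧ e * g ∈ I) : g ∈ I := by
  by_contra hg
  let K : Ideal (MvPolynomial σ F) := I.colon {g}
  have hK : K ≠ ⊤ := by
    intro hK
    have : (1 : MvPolynomial σ F) ∈ K := hK ▸ Submodule.mem_top
    rw [Submodule.mem_colon_singleton, one_smul] at this
    exact hg this
  obtain ⟨M, hM, hKM⟩ := Ideal.exists_le_maximal K hK
  obtain ⟨v, rfl⟩ := isMaximal_iff_eq_vanishingIdeal_singleton.mp hM
  obtain ⟨e, he, heg⟩ := h v fun p hp => mem_vanishingIdeal_singleton.mp (hKM (by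
    rw [Submodule.mem_colon_singleton]; exact I.mul_mem_right _ hp))
  exact he (mem_vanishingIdeal_singleton.mp (hKM (by
    rw [Submodule.mem_colon_singleton]; exact heg)))

/-- An ideal that is unramified at each of its zeros is radical. -/
theorem mem_of_unramified {I : Ideal (MvPolynomial σ F)}
    (hI : ∀ v, (∀ p ∈ I, eval v p = 0) → ∀ k, (∀ g ∈ I, dirDeriv v k g = 0) → k = 0)
    {g : MvPolynomial σ F} (hg : ∀ v, (∀ p ∈ I, eval v p = 0) → eval v g = 0) : g ∈ I := by
  refine mem_of_forall_exists_mul_mem fun v hv => ?_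
  obtain ⟨e, he, heI⟩ := exists_mul_mem_of_tangent_eq_bot (hI v hv)
    (fun p hp => mem_vanishingIdeal_singleton.mpr (hv p hp))
  exact ⟨e, he, heI g (mem_vanishingIdeal_singleton.mpr (hg v hv))⟩

/-- If `e` carries the maximal ideal of `v` into `I`, then `e * e` carries its square into `I ^ 2`,
and membership is local. -/
theorem mem_sq_of_unramified {I : Ideal (MvPolynomial σ F)}
    (hI : ∀ v, (∀ p ∈ I, eval v p = 0) → ∀ k, (∀ g ∈ I, dirDeriv v k g = 0) → k = 0)
    {g : MvPolynomial σ F}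
    (hg : ∀ v, (∀ p ∈ I, eval v p = 0) → g ∈ vanishingIdeal F {v} ^ 2) : g ∈ I ^ 2 := by
  refine mem_of_forall_exists_mul_mem fun v hv => ?_
  have hv' : ∀ p ∈ I, eval v p = 0 := fun p hp => by
    simpa using hv (p ^ 2) (Ideal.pow_mem_pow hp 2)
  obtain ⟨e, he, heI⟩ := exists_mul_mem_of_tangent_eq_bot (hI v hv')
    (fun p hp => mem_vanishingIdeal_singleton.mpr (hv' p hp))
  refine ⟨e * e, by simpa using he, ?_⟩
  have h := hg v hv'
  rw [pow_two] at h
  refine Submodule.mul_induction_on h (fun a ha b hb => ?_) fun a b ha hb => ?_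
  · have := Ideal.mul_mem_mul (heI a ha) (heI b hb)
    rw [pow_two]
    convert this using 1
    ring
  · rw [mul_add]
    exact add_mem ha hb

end Unramified

/-! ### Chain rules -/

theorem eval_bind₁ {τ : Type*} (f : τ → MvPolynomial σ F) (g : MvPolynomial τ F) (v : σ → F) :
    eval v (bind₁ f g) = eval (fun i => eval v (f i)) g := by
  induction g using MvPolynomial.induction_on with
  | C a => simp
  | add p q hp hq => rw [map_add, map_add, hp, hq, map_add]
  | mul_X p i hp => rw [map_mul, map_mul, hp, bind₁_X_right, map_mul, eval_X]

theorem pderiv_bind₁ {τ : Type*} [Fintype τ] (f : τ → MvPolynomial σ F) (g : MvPolynomial τ F)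
    (j : σ) : pderiv j (bind₁ f g) = ∑ i, bind₁ f (pderiv i g) * pderiv j (f i) := by
  classical
  induction g using MvPolynomial.induction_on with
  | C a => simp
  | add p q hp hq => simp [hp, hq, add_mul, Finset.sum_add_distrib]
  | mul_X p i hp =>
    simp only [map_mul, bind₁_X_right, Derivation.leibniz, hp, smul_eq_mul, map_add, add_mul,
      Finset.sum_add_distrib, pderiv_X]
    congr 1
    · rw [Finset.sum_eq_single i] <;> simp +contextual
    · rw [Finset.mul_sum]
      exact Finset.sum_congr rfl fun j _ => by ring

theorem constantCoeff_aeval_powerSeries (γ : σ → PowerSeries F) (g : MvPolynomial σ F) :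
    PowerSeries.constantCoeff (aeval γ g) = eval (fun i => PowerSeries.constantCoeff (γ i)) g := by
  induction g using MvPolynomial.induction_on with
  | C a => simp
  | add p q hp hq => simp [hp, hq]
  | mul_X p i hp => simp [hp]

theorem derivative_aeval_powerSeries (γ : σ → PowerSeries F) (g : MvPolynomial σ F) :
    PowerSeries.derivative F (aeval γ g) =
      ∑ j, aeval γ (pderiv j g) * PowerSeries.derivative F (γ j) := by
  classical
  induction g using MvPolynomial.induction_on with
  | C a => simp
  | add p q hp hq => simp [hp, hq, add_mul, Finset.sum_add_distrib]
  | mul_X p i hp =>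
    simp only [map_mul, aeval_X, Derivation.leibniz, hp, smul_eq_mul, map_add, add_mul,
      Finset.sum_add_distrib, pderiv_X]
    congr 1
    · rw [Finset.sum_eq_single i] <;> simp +contextual
    · rw [Finset.mul_sum]
      exact Finset.sum_congr rfl fun j _ => by ring

theorem _root_.PowerSeries.constantCoeff_derivative (φ : PowerSeries F) :
    PowerSeries.constantCoeff (PowerSeries.derivative F φ) = PowerSeries.coeff 1 φ := by
  rw [← PowerSeries.coeff_zero_eq_constantCoeff_apply, PowerSeries.coeff_derivative]
  simp

theorem coeff_one_aeval_powerSeries (γ : σ → PowerSeries F) (g : MvPolynomial σ F) :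
    PowerSeries.coeff 1 (aeval γ g) = dirDeriv (fun i => PowerSeries.constantCoeff (γ i))
      (fun i => PowerSeries.coeff 1 (γ i)) g := by
  have h := congrArg PowerSeries.constantCoeff (derivative_aeval_powerSeries γ g)
  simpa [PowerSeries.constantCoeff_derivative, constantCoeff_aeval_powerSeries, dirDeriv, mul_comm]
    using h

/-- This is the linear coefficient of the derivative of `g` along `γ`; the last sum is the second
derivative of `g` in the direction of the velocity. It decides when `f` is constant along an arc to
third order. -/
theorem two_mul_coeff_two_aeval_powerSeries (γ : σ → PowerSeries F) (g : MvPolynomial σ F) :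
    2 * PowerSeries.coeff 2 (aeval γ g) =
      2 * dirDeriv (fun i => PowerSeries.constantCoeff (γ i))
        (fun i => PowerSeries.coeff 2 (γ i)) g +
      ∑ j, PowerSeries.coeff 1 (γ j) * dirDeriv (fun i => PowerSeries.constantCoeff (γ i))
        (fun i => PowerSeries.coeff 1 (γ i)) (pderiv j g) := by
  have h := congrArg (PowerSeries.coeff 1) (derivative_aeval_powerSeries γ g)
  have e2 : (1 + 1 : F) = 2 := by norm_num
  simp only [PowerSeries.coeff_derivative, map_sum, PowerSeries.coeff_mul,
    Finset.Nat.antidiagonal_succ, Finset.Nat.antidiagonal_zero] at h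
  simp [coeff_one_aeval_powerSeries, e2, Finset.sum_add_distrib] at h
  rw [mul_comm, h]
  simp only [dirDeriv, Finset.mul_sum]
  congr 1
  · exact Finset.sum_congr rfl fun j _ => by ring
  · refine Finset.sum_congr rfl fun j _ => ?_
    rw [Finset.sum_mul]
    exact Finset.sum_congr rfl fun j _ => by ring

end MvPolynomial

/-! ### Matrices of corank one -/

namespace Matrix

variable {F : Type*} [Field F] {σ : Type*} [Fintype σ] [DecidableEq σ]

/-- The adjugate of a singular matrix of corank one is nonzero. -/
theorem adjugate_ne_zero_of_ker_le_span {M : Matrix σ σ F} {k : σ → F} (hk : k ≠ 0)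
    (hMk : M.mulVec k = 0) (hker : ∀ x, M.mulVec x = 0 → ∃ c : F, x = c • k) :
    M.adjugate ≠ 0 := by
  intro hadj
  obtain ⟨j, hj⟩ := Function.ne_iff.mp hk
  -- If the adjugate is zero, `M` with row `i` replaced by the `j`-th unit row is singular. A kernel
  -- vector `x` has `x j = 0`, so it is no nonzero multiple of `k`, and `M x` is a nonzero multiple
  -- of the `i`-th unit vector. Then `M` is surjective although it kills `k`.
  have hsurj : ∀ i, ∃ y, M.mulVec y = Pi.single i 1 := by
    intro i
    have hdet : (M.updateRow i (Pi.single j 1)).det = 0 := by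
      rw [← adjugate_apply, hadj]; rfl
    obtain ⟨x, hx0, hx⟩ := exists_mulVec_eq_zero_iff.mpr hdet
    have hxj : x j = 0 := by
      have := congrFun hx i
      simpa [mulVec, updateRow_self] using this
    have hrow : ∀ l, l ≠ i → M.mulVec x l = 0 := by
      intro l hl
      have := congrFun hx l
      simpa [mulVec, updateRow_ne hl] using this
    have hi : M.mulVec x i ≠ 0 := by
      intro hi
      obtain ⟨c, rfl⟩ := hker x (funext fun l => by
        by_cases hl : l = i
        · rw [hl, hi]; rfl
        · exact hrow l hl)
      have hc : c = 0 := by simpa [show k j ≠ 0 from hj] using hxj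
      exact hx0 (by rw [hc, zero_smul])
    refine ⟨(M.mulVec x i)⁻¹ • x, ?_⟩
    rw [mulVec_smul]
    ext l
    by_cases hl : l = i
    · subst hl; simp [hi]
    · simp [hrow l hl, hl]
  choose y hy using hsurj
  have hMY : M * (of fun l i => y i l) = 1 := by
    ext l i
    have := congrFun (hy i) l
    simp only [mulVec, dotProduct] at this
    simp only [mul_apply, of_apply, this, one_apply, Pi.single_apply]
  have hdet : M.det ≠ 0 := by
    intro h
    have := congrArg det hMY
    rw [det_mul, h, zero_mul, det_one] at this
    exact zero_ne_one this
  exact hdet (exists_mulVec_eq_zero_iff.mp ⟨k, hk, hMk⟩)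

/-- If the determinant of the family `M₀ + X M₁ + ⋯` vanishes to second order and `M₀` has
corank one with kernel spanned by `k`, then `M₁ k` lies in the range of `M₀`. -/
theorem exists_mulVec_add_eq_zero {M : Matrix σ σ (PowerSeries F)} {k : σ → F} (hk : k ≠ 0)
    (hMk : (M.map PowerSeries.constantCoeff).mulVec k = 0)
    (hker : ∀ x, (M.map PowerSeries.constantCoeff).mulVec x = 0 → ∃ c : F, x = c • k)
    (hdet : PowerSeries.coeff 1 M.det = 0) :
    ∃ k', (M.map PowerSeries.constantCoeff).mulVec k' +
      (M.map (PowerSeries.coeff 1)).mulVec k = 0 := by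
  set M₀ := M.map PowerSeries.constantCoeff with hM₀
  set M₁ := M.map (PowerSeries.coeff 1) with hM₁
  have hdet₀ : M₀.det = 0 := exists_mulVec_eq_zero_iff.mp ⟨k, hk, hMk⟩
  have hA : M.adjugate.map PowerSeries.constantCoeff = M₀.adjugate := by
    simpa only [RingHom.mapMatrix_apply] using
      RingHom.map_adjugate (PowerSeries.constantCoeff (R := F)) M
  -- The coefficient of `X` in `adj(M) M = det(M)`; applied to `k` it leaves `adj(M₀) M₁ k = 0`.
  have hone : M₀.adjugate * M₁ + M.adjugate.map (PowerSeries.coeff 1) * M₀ = 0 := by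
    ext i j
    have h := congrArg (PowerSeries.coeff 1) (congrFun (congrFun (adjugate_mul M) i) j)
    simp only [mul_apply, map_sum, PowerSeries.coeff_mul, Finset.Nat.antidiagonal_succ,
      Finset.Nat.antidiagonal_zero, smul_apply, smul_eq_mul] at h
    have hr : PowerSeries.coeff 1 (M.det * (1 : Matrix σ σ (PowerSeries F)) i j) = 0 := by
      rw [one_apply]; split_ifs <;> simp [hdet]
    rw [PowerSeries.coeff_mul] at hr
    simp only [Finset.Nat.antidiagonal_succ, Finset.Nat.antidiagonal_zero] at hr
    rw [hr] at h
    simp only [add_apply, mul_apply, zero_apply, ← Finset.sum_add_distrib]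
    rw [← h]
    refine Finset.sum_congr rfl fun l _ => ?_
    rw [← hA]
    simp [hM₀, hM₁]
  have hz : M₀.adjugate.mulVec (M₁.mulVec k) = 0 := by
    have h := congrArg (fun N => N.mulVec k) hone
    simpa [add_mulVec, ← mulVec_mulVec, hMk] using h
  obtain ⟨i, hi⟩ := Function.ne_iff.mp (adjugate_ne_zero_of_ker_le_span hk hMk hker)
  -- A nonzero row of `adj(M₀)` kills the range of `M₀`. Both its kernel and that range have
  -- codimension one, so they coincide.
  let ℓ : (σ → F) →ₗ[F] F := LinearMap.proj i ∘ₗ M₀.adjugate.mulVecLin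
  have hℓ : ℓ ≠ 0 := by
    obtain ⟨j, hj⟩ := Function.ne_iff.mp hi
    intro h
    have := LinearMap.congr_fun h (Pi.single j 1)
    simp [ℓ] at this
    exact hj this
  have hle : LinearMap.range M₀.mulVecLin ≤ LinearMap.ker ℓ := by
    rintro _ ⟨x, rfl⟩
    simp [ℓ, adjugate_mul, hdet₀]
  have hkerM : LinearMap.ker M₀.mulVecLin = Submodule.span F {k} := by
    ext x
    rw [LinearMap.mem_ker, mulVecLin_apply, Submodule.mem_span_singleton]
    constructor
    · intro h
      obtain ⟨c, rfl⟩ := hker x h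
      exact ⟨c, rfl⟩
    · rintro ⟨c, rfl⟩
      rw [mulVec_smul, hMk, smul_zero]
  have hr1 := LinearMap.finrank_range_add_finrank_ker M₀.mulVecLin
  rw [hkerM, finrank_span_singleton hk] at hr1
  have hr2 := LinearMap.finrank_range_add_finrank_ker ℓ
  rw [LinearMap.range_eq_top.mpr (LinearMap.surjective hℓ), finrank_top,
    Module.finrank_self] at hr2
  have heq := Submodule.eq_of_le_of_finrank_eq hle (by omega)
  have hmem : -(M₁.mulVec k) ∈ LinearMap.range M₀.mulVecLin := by
    rw [heq, LinearMap.mem_ker, map_neg]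
    simpa [ℓ] using congrFun hz i
  obtain ⟨k', hk'⟩ := hmem
  refine ⟨k', ?_⟩
  rw [mulVecLin_apply] at hk'
  rw [hk', neg_add_cancel]

end Matrix

/-! ### Scaling and Euler's formula for homogeneous polynomials -/

namespace MvPolynomial

variable {F : Type*} [Field F] {σ : Type*} [Fintype σ]

theorem IsHomogeneous.aeval_mul {A : Type*} [CommRing A] [Algebra F A] {g : MvPolynomial σ F}
    {m : ℕ} (hg : g.IsHomogeneous m) (u : A) (γ : σ → A) :
    MvPolynomial.aeval (fun i => u * γ i) g = u ^ m * MvPolynomial.aeval γ g := by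
  rw [aeval_def, aeval_def, eval₂_eq', eval₂_eq', Finset.mul_sum]
  refine Finset.sum_congr rfl fun s hs => ?_
  have hdeg : ∑ i, s i = m := by
    rw [hg.degree_eq_sum_deg_support hs]
    exact (Finset.sum_subset (Finset.subset_univ _) fun i _ hi => by simpa using hi).symm
  simp only [mul_pow, Finset.prod_mul_distrib, Finset.prod_pow_eq_pow_sum, hdeg]
  ring

theorem IsHomogeneous.eval_smul {g : MvPolynomial σ F}
    {m : ℕ} (hg : g.IsHomogeneous m) (c : F) (v : σ → F) :
    eval (c • v) g = c ^ m * eval v g := by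
  have := hg.aeval_mul c v
  rw [aeval_eq_eval, aeval_eq_eval] at this
  exact this

theorem IsHomogeneous.dirDeriv_self {g : MvPolynomial σ F} {m : ℕ} (hg : g.IsHomogeneous m)
    (v : σ → F) : dirDeriv v v g = m * eval v g := by
  have := congrArg (eval v) hg.sum_X_mul_pderiv
  simpa [dirDeriv] using this

theorem IsHomogeneous.dirDeriv_smul {g : MvPolynomial σ F} {m : ℕ} (hg : g.IsHomogeneous m)
    (c : F) (v k : σ → F) : dirDeriv (c • v) k g = c ^ (m - 1) * dirDeriv v k g := by
  simp only [dirDeriv, Finset.mul_sum]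
  refine Finset.sum_congr rfl fun j _ => ?_
  rw [(hg.pderiv (i := j)).eval_smul]
  ring

end MvPolynomial

/-! ### Local rings at a point and lower bounds for their dimension -/

section LocalRing

variable {F : Type*} [Field F] {n : ℕ}

theorem exists_sub_algebraMap_mem_maximalIdeal (v : Fin (n + 1) → F)
    (z : Localization.AtPrime (vanishingIdeal F {v})) :
    ∃ c : F, z - algebraMap F _ c ∈
      IsLocalRing.maximalIdeal (Localization.AtPrime (vanishingIdeal F {v})) := by
  obtain ⟨r, hr⟩ := (IsLocalization.AtPrime.equivQuotMaximalIdeal (vanishingIdeal F {v})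
    (Localization.AtPrime (vanishingIdeal F {v}))).surjective (Ideal.Quotient.mk _ z)
  obtain ⟨g, rfl⟩ := Ideal.Quotient.mk_surjective r
  rw [IsLocalization.AtPrime.equivQuotMaximalIdeal_apply_mk] at hr
  refine ⟨eval v g, ?_⟩
  have h1 := (Ideal.Quotient.eq.mp hr.symm)
  have h2 : algebraMap _ (Localization.AtPrime (vanishingIdeal F {v})) (g - C (eval v g)) ∈
      IsLocalRing.maximalIdeal (Localization.AtPrime (vanishingIdeal F {v})) := by
    rw [IsLocalization.AtPrime.to_map_mem_maximal_iff _ (vanishingIdeal F {v})]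
    simp
  rw [map_sub] at h2
  have := add_mem h1 h2
  rw [IsScalarTower.algebraMap_apply F (MvPolynomial (Fin (n + 1)) F), algebraMap_eq]
  convert this using 1
  ring

/-- Independent functionals that vanish on the ideal map the quotient onto `F ^ r`. Since `finrank`
is 0 in infinite dimension, `hfin` is what makes the quotient finite-dimensional. -/
theorem le_finrank_projLocalRing {I : Ideal (MvPolynomial (Fin (n + 1)) F)}
    {x : ProjSpace F n} {r : ℕ}
    (c : Fin r → Localization.AtPrime (vanishingIdeal F {x.rep}) →ₗ[F] F)
    (hc : ∀ a : Fin r → F, (∀ z, ∑ i, a i * c i z = 0) → a = 0)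
    (hI : ∀ z ∈ Ideal.map (algebraMap (MvPolynomial (Fin (n + 1)) F)
      (Localization.AtPrime (vanishingIdeal F {x.rep})))
      (I ⊔ Ideal.span {X (chartIndex x) - C (x.rep (chartIndex x))}), ∀ i, c i z = 0)
    (hfin : Module.finrank F (ProjLocalRing I x) ≠ 0) :
    r ≤ Module.finrank F (ProjLocalRing I x) := by
  have hsurj : LinearMap.range (LinearMap.pi c) = ⊤ := by
    by_contra hne
    obtain ⟨ψ, hψ, hle⟩ := Submodule.exists_le_ker_of_lt_top _ (lt_top_iff_ne_top.mpr hne)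
    apply hψ
    have h0 := hc (fun i => ψ (Pi.single i 1)) fun z => by
      have h := hle ⟨z, rfl⟩
      rw [LinearMap.mem_ker, LinearMap.pi_apply_eq_sum_univ] at h
      rw [← h]
      refine Finset.sum_congr rfl fun i _ => ?_
      rw [smul_eq_mul, mul_comm, LinearMap.pi_apply]
      congr 2
      ext l
      simp [Pi.single_apply, eq_comm]
    refine LinearMap.pi_ext' fun j => ?_
    ext
    simpa using congrFun h0 j
  have : Module.Finite F (ProjLocalRing I x) :=
    Module.finite_of_finrank_pos (Nat.pos_of_ne_zero hfin)
  let K := Ideal.map (algebraMap (MvPolynomial (Fin (n + 1)) F)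
      (Localization.AtPrime (vanishingIdeal F {x.rep})))
      (I ⊔ Ideal.span {X (chartIndex x) - C (x.rep (chartIndex x))})
  let Φ : ProjLocalRing I x →ₗ[F] (Fin r → F) :=
    (K.restrictScalars F).liftQ (LinearMap.pi c) (fun z hz => funext fun i => hI z hz i)
  have hΦ : Function.Surjective Φ := by
    intro y
    obtain ⟨z, rfl⟩ := LinearMap.range_eq_top.mp hsurj y
    exact ⟨Ideal.Quotient.mk _ z, (K.restrictScalars F).liftQ_apply (LinearMap.pi c) z⟩
  simpa using LinearMap.finrank_le_finrank_of_surjective hΦ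

end LocalRing

/-! ### Arcs, fibre multiplicities and simple folds -/

namespace ProjMorphism

variable {F : Type*} [Field F] {n d : ℕ} (f : ProjMorphism F n d)

theorem toFun_eq_iff {x q : ProjSpace F n} :
    f.toFun x = q ↔ ∃ c : F, c ≠ 0 ∧ ∀ i, eval x.rep (f.coords i) = c * q.rep i := by
  constructor
  · intro h
    rw [toFun] at h
    conv_rhs at h => rw [← q.mk_rep]
    rw [Projectivization.mk_eq_mk_iff] at h
    obtain ⟨a, ha⟩ := h
    exact ⟨a, a.ne_zero, fun i => (congrFun ha i).symm⟩
  · rintro ⟨c, hc, h⟩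
    rw [toFun]
    conv_rhs => rw [← q.mk_rep]
    rw [Projectivization.mk_eq_mk_iff]
    exact ⟨Units.mk0 c hc, funext fun i => (h i).symm⟩

theorem eval_jacobianDet (v : Fin (n + 1) → F) :
    eval v f.jacobianDet = (Matrix.of fun i j => eval v (pderiv j (f.coords i))).det := by
  rw [jacobianDet, RingHom.map_det]
  rfl

theorem mulVec_eq_dirDeriv (v k : Fin (n + 1) → F) (i : Fin (n + 1)) :
    (Matrix.of fun i j => eval v (pderiv j (f.coords i))).mulVec k i =
      dirDeriv v k (f.coords i) := by
  simp only [Matrix.mulVec, dotProduct, Matrix.of_apply, dirDeriv]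
  exact Finset.sum_congr rfl fun j _ => mul_comm _ _

theorem eval_jacobianDet_eq_zero_iff (v : Fin (n + 1) → F) :
    eval v f.jacobianDet = 0 ↔ ∃ k, k ≠ 0 ∧ ∀ i, dirDeriv v k (f.coords i) = 0 := by
  rw [eval_jacobianDet, ← Matrix.exists_mulVec_eq_zero_iff]
  simp only [funext_iff, mulVec_eq_dirDeriv, Pi.zero_apply]

/-- An arc through `x` on which `f` is constant to order `m` induces a homomorphism from the local
ring of `ℙⁿ` at `x`, in which the ideal of the fibre becomes divisible by `X ^ m`. -/
theorem exists_arc {x q : ProjSpace F n} (hx : f.toFun x = q) (m : ℕ)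
    (γ : Fin (n + 1) → PowerSeries F) (hγ : ∀ i, PowerSeries.constantCoeff (γ i) = x.rep i)
    (hf : ∀ i, PowerSeries.X ^ m ∣
      aeval γ (f.coords i) - algebraMap F _ (eval x.rep (f.coords i))) :
    ∃ (Θ : Localization.AtPrime (vanishingIdeal F {x.rep}) →ₐ[F] PowerSeries F)
      (u : PowerSeries F), PowerSeries.constantCoeff u = 1 ∧
      (∀ i, Θ (algebraMap (MvPolynomial (Fin (n + 1)) F) _ (X i)) = u * γ i) ∧
      ∀ z ∈ Ideal.map (algebraMap (MvPolynomial (Fin (n + 1)) F)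
        (Localization.AtPrime (vanishingIdeal F {x.rep})))
        (f.fibreIdeal q ⊔ Ideal.span {X (chartIndex x) - C (x.rep (chartIndex x))}),
        PowerSeries.X ^ m ∣ Θ z := by
  set κ := chartIndex x
  have hκ : x.rep κ ≠ 0 := rep_chartIndex_ne_zero x
  -- Rescaling by `u` makes the coordinate `κ` constant, so that the arc stays in the chart; by
  -- homogeneity the fibre equations only acquire the factor `u ^ d`.
  let u : PowerSeries F := PowerSeries.C (x.rep κ) * (γ κ)⁻¹
  have hu : PowerSeries.constantCoeff u = 1 := by
    simp [u, hγ, hκ]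
  have huκ : u * γ κ = PowerSeries.C (x.rep κ) := by
    rw [mul_assoc, PowerSeries.inv_mul_cancel _ (by rwa [hγ]), mul_one]
  let θ : MvPolynomial (Fin (n + 1)) F →ₐ[F] PowerSeries F := aeval fun i => u * γ i
  have hunit : ∀ y : (vanishingIdeal F {x.rep}).primeCompl, IsUnit (θ y) := by
    rintro ⟨y, hy⟩
    have hy' : eval x.rep y ≠ 0 := fun h => hy (mem_vanishingIdeal_singleton.mpr h)
    rw [PowerSeries.isUnit_iff_constantCoeff, isUnit_iff_ne_zero]
    simp only [θ]
    rw [constantCoeff_aeval_powerSeries]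
    simpa [hu, hγ] using hy'
  let Θ : Localization.AtPrime (vanishingIdeal F {x.rep}) →ₐ[F] PowerSeries F :=
    IsLocalization.liftAlgHom (M := (vanishingIdeal F {x.rep}).primeCompl) (f := θ) hunit
  have hΘ : ∀ g, Θ (algebraMap (MvPolynomial (Fin (n + 1)) F) _ g) = θ g := fun g =>
    IsLocalization.lift_eq _ _
  refine ⟨Θ, u, hu, fun i => by rw [hΘ]; simp [θ], ?_⟩
  obtain ⟨c, hc, hcq⟩ := f.toFun_eq_iff.mp hx
  have hle : Ideal.map (algebraMap (MvPolynomial (Fin (n + 1)) F)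
      (Localization.AtPrime (vanishingIdeal F {x.rep})))
      (f.fibreIdeal q ⊔ Ideal.span {X κ - C (x.rep κ)}) ≤
        (Ideal.span {PowerSeries.X ^ m}).comap Θ.toRingHom := by
    rw [Ideal.map_le_iff_le_comap, sup_le_iff, fibreIdeal, Ideal.span_le, Ideal.span_le]
    constructor
    · rintro _ ⟨i, j, rfl⟩
      change Θ (algebraMap _ _ _) ∈ Ideal.span _
      rw [hΘ, Ideal.mem_span_singleton, map_sub, map_mul, map_mul]
      simp only [θ]
      rw [(f.isHomogeneous i).aeval_mul, (f.isHomogeneous j).aeval_mul]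
      have h1 := (hf j).mul_left (algebraMap F _ (q.rep i))
      have h2 := (hf i).mul_left (algebraMap F _ (q.rep j))
      have h3 := (dvd_sub h1 h2).mul_left (u ^ d)
      rw [hcq, hcq] at h3
      convert h3 using 1
      simp only [← algebraMap_eq, AlgHom.commutes, map_mul]
      ring
    · rintro _ rfl
      change Θ (algebraMap _ _ _) ∈ Ideal.span _
      rw [hΘ]
      simp [θ, huκ]
  intro z hz
  exact Ideal.mem_span_singleton.mp (hle hz)

end ProjMorphism

namespace ProjMorphism

variable {F : Type*} [Field F] {n d : ℕ} (f : ProjMorphism F n d)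

/-- `f` has a simple fold at `v`: its differential is singular, and the derivative of the
Jacobian determinant along each nonzero vector of the kernel is nonzero. -/
def IsFoldAt (v : Fin (n + 1) → F) : Prop :=
  eval v f.jacobianDet = 0 ∧ ∀ k, (∀ i, dirDeriv v k (f.coords i) = 0) →
    dirDeriv v k f.jacobianDet = 0 → k = 0

/-- The arc `v + X k + X² l`. -/
noncomputable def quadArc (v k l : Fin (n + 1) → F) (i : Fin (n + 1)) : PowerSeries F :=
  PowerSeries.C (v i) + PowerSeries.X * PowerSeries.C (k i) +
    PowerSeries.X ^ 2 * PowerSeries.C (l i)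

@[simp]
theorem constantCoeff_quadArc (v k l : Fin (n + 1) → F) (i : Fin (n + 1)) :
    PowerSeries.constantCoeff (quadArc v k l i) = v i := by
  simp [quadArc]

@[simp]
theorem coeff_one_quadArc (v k l : Fin (n + 1) → F) (i : Fin (n + 1)) :
    PowerSeries.coeff 1 (quadArc v k l i) = k i := by
  rw [quadArc, map_add, map_add, show (1 : ℕ) = 0 + 1 from rfl, PowerSeries.coeff_succ_X_mul,
    pow_two, mul_assoc, PowerSeries.coeff_succ_X_mul]
  simp [PowerSeries.coeff_C]

@[simp]
theorem coeff_two_quadArc (v k l : Fin (n + 1) → F) (i : Fin (n + 1)) :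
    PowerSeries.coeff 2 (quadArc v k l i) = l i := by
  rw [quadArc, map_add, map_add, show (2 : ℕ) = 0 + 1 + 1 from rfl, PowerSeries.coeff_succ_X_mul,
    show 0 + 1 + 1 = 2 from rfl, pow_two, mul_assoc, show (2 : ℕ) = 0 + 1 + 1 from rfl,
    PowerSeries.coeff_succ_X_mul, PowerSeries.coeff_succ_X_mul]
  simp [PowerSeries.coeff_C]

theorem exists_coords_ne_zero (x : ProjSpace F n) : ∃ i, eval x.rep (f.coords i) ≠ 0 :=
  Function.ne_iff.mp (f.eval_rep_ne_zero x)

theorem dirDeriv_coords_self (v : Fin (n + 1) → F) (i : Fin (n + 1)) :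
    dirDeriv v v (f.coords i) = d * eval v (f.coords i) :=
  (f.isHomogeneous i).dirDeriv_self v

theorem X_sq_dvd_aeval_quadArc {v k l : Fin (n + 1) → F} {g : MvPolynomial (Fin (n + 1)) F}
    (h : dirDeriv v k g = 0) :
    PowerSeries.X ^ 2 ∣ aeval (quadArc v k l) g - algebraMap F _ (eval v g) := by
  rw [PowerSeries.X_pow_dvd_iff]
  intro m hm
  interval_cases m
  · simp
  · simp [coeff_one_aeval_powerSeries, h]

theorem coeff_one_mul_quadArc {u : PowerSeries F} (hu : PowerSeries.constantCoeff u = 1)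
    (v k l : Fin (n + 1) → F) (i : Fin (n + 1)) :
    PowerSeries.coeff 1 (u * quadArc v k l i) = k i + PowerSeries.coeff 1 u * v i := by
  simp [PowerSeries.coeff_mul, Finset.Nat.antidiagonal_succ, hu]

theorem finrank_projLocalRing_eq_one {I : Ideal (MvPolynomial (Fin (n + 1)) F)} {x : ProjSpace F n}
    (h : Ideal.map (algebraMap (MvPolynomial (Fin (n + 1)) F)
      (Localization.AtPrime (vanishingIdeal F {x.rep})))
      (I ⊔ Ideal.span {X (chartIndex x) - C (x.rep (chartIndex x))}) =
        IsLocalRing.maximalIdeal (Localization.AtPrime (vanishingIdeal F {x.rep}))) :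
    Module.finrank F (ProjLocalRing I x) = 1 := by
  have hnt : Nontrivial (ProjLocalRing I x) := Ideal.Quotient.nontrivial_iff.mpr (by
    rw [h]; exact Ideal.IsPrime.ne_top')
  refine finrank_eq_one 1 one_ne_zero fun w => ?_
  obtain ⟨z, rfl⟩ := Ideal.Quotient.mk_surjective w
  obtain ⟨c, hc⟩ := exists_sub_algebraMap_mem_maximalIdeal x.rep z
  refine ⟨c, ?_⟩
  rw [← h, ← Ideal.Quotient.eq] at hc
  rw [hc, ← Algebra.algebraMap_eq_smul_one]
  rfl

/-- The multiplier `e` of `exists_mul_mem_of_tangent_eq_bot` becomes a unit in the localization. -/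
theorem map_sup_span_eq_maximalIdeal (I : Ideal (MvPolynomial (Fin (n + 1)) F))
    {v : Fin (n + 1) → F} (hI : I ≤ vanishingIdeal F {v})
    (ht : ∀ k, (∀ g ∈ I, dirDeriv v k g = 0) → k = 0) :
    Ideal.map (algebraMap (MvPolynomial (Fin (n + 1)) F)
      (Localization.AtPrime (vanishingIdeal F {v}))) I =
        IsLocalRing.maximalIdeal (Localization.AtPrime (vanishingIdeal F {v})) := by
  obtain ⟨e, he, heI⟩ := exists_mul_mem_of_tangent_eq_bot ht hI
  rw [← Localization.AtPrime.map_eq_maximalIdeal]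
  refine le_antisymm (Ideal.map_mono hI) (Ideal.map_le_iff_le_comap.mpr fun g hg => ?_)
  have hu : IsUnit (algebraMap _ (Localization.AtPrime (vanishingIdeal F {v})) e) :=
    IsLocalization.map_units (M := (vanishingIdeal F {v}).primeCompl) _
      ⟨e, fun h => he (mem_vanishingIdeal_singleton.mp h)⟩
  rw [Ideal.mem_comap, ← Ideal.unit_mul_mem_iff_mem _ hu, ← map_mul]
  exact Ideal.mem_map_of_mem _ (heI g hg)

variable [CharZero F]

theorem eq_zero_of_dirDeriv_smul_rep (hd : d ≠ 0) (x : ProjSpace F n) {c : F}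
    (h : ∀ i, dirDeriv x.rep (c • x.rep) (f.coords i) = 0) : c = 0 := by
  obtain ⟨i, hi⟩ := f.exists_coords_ne_zero x
  have := h i
  rw [dirDeriv_smul_dir, dirDeriv_coords_self] at this
  have hd' : (d : F) ≠ 0 := Nat.cast_ne_zero.mpr hd
  simpa [hd', hi] using this

/-- An arc with velocity `k`, once rescaled into the chart, has velocity `k + c x`. This vanishes
only for radial `k`, and by Euler's formula a radial vector in the kernel of `Df` is zero. -/
theorem eq_zero_of_add_smul_rep_eq_zero (hd : d ≠ 0) (x : ProjSpace F n) {c : F}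
    {k : Fin (n + 1) → F} (h : ∀ i, k i + c * x.rep i = 0)
    (hf : ∀ i, dirDeriv x.rep k (f.coords i) = 0) : k = 0 := by
  have hk : k = (-c) • x.rep := by
    ext i
    simp only [Pi.smul_apply, smul_eq_mul]
    linear_combination h i
  have hc := f.eq_zero_of_dirDeriv_smul_rep hd x (c := -c) fun i => by rw [← hk]; exact hf i
  rw [hk, hc, zero_smul]

/-- A point of multiplicity one of a fibre is not critical. -/
theorem eval_jacobianDet_ne_zero (hd : d ≠ 0) {x q : ProjSpace F n} (hx : f.toFun x = q)
    (h : f.fibreMult q x = 1) : eval x.rep f.jacobianDet ≠ 0 := by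
  intro hJ
  obtain ⟨k, hk, hfk⟩ := (f.eval_jacobianDet_eq_zero_iff _).mp hJ
  obtain ⟨Θ, u, hu, hΘ, hI⟩ := f.exists_arc hx 2 (quadArc x.rep k 0) (by simp)
    fun i => X_sq_dvd_aeval_quadArc (hfk i)
  -- Value and velocity along the arc are independent functionals on the local ring of the fibre.
  have hle : 2 ≤ f.fibreMult q x := by
    refine le_finrank_projLocalRing
      (fun j : Fin 2 => PowerSeries.coeff (j : ℕ) ∘ₗ Θ.toLinearMap)
      ?_ ?_ (by rw [← fibreMult, h]; exact one_ne_zero)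
    · intro a ha
      simp only [Fin.sum_univ_two, LinearMap.comp_apply, AlgHom.toLinearMap_apply] at ha
      have h0 : a 0 = 0 := by simpa [PowerSeries.coeff_one] using ha 1
      have h1 : a 1 = 0 := by
        by_contra h1
        refine hk (f.eq_zero_of_add_smul_rep_eq_zero hd x (c := PowerSeries.coeff 1 u)
          (fun i => ?_) hfk)
        have := ha (algebraMap (MvPolynomial (Fin (n + 1)) F) _ (X i))
        simp only [hΘ, h0, zero_mul, zero_add, Fin.val_one, coeff_one_mul_quadArc hu] at this
        exact (mul_eq_zero.mp this).resolve_left h1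
      ext j
      fin_cases j
      exacts [h0, h1]
    · intro z hz j
      exact PowerSeries.X_pow_dvd_iff.mp (hI z hz) j j.2
  omega

/-- A point of a fibre that is not critical has multiplicity one. -/
theorem fibreMult_eq_one (hd : d ≠ 0) {x q : ProjSpace F n} (hx : f.toFun x = q)
    (hJ : eval x.rep f.jacobianDet ≠ 0) : f.fibreMult q x = 1 := by
  obtain ⟨c, hc, hcq⟩ := f.toFun_eq_iff.mp hx
  have hκ := rep_chartIndex_ne_zero x
  apply finrank_projLocalRing_eq_one
  apply map_sup_span_eq_maximalIdeal
  · rw [sup_le_iff, fibreIdeal, Ideal.span_le, Ideal.span_le]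
    constructor
    · rintro _ ⟨i, j, rfl⟩
      rw [SetLike.mem_coe, mem_vanishingIdeal_singleton]
      simp only [map_sub, map_mul, eval_C, hcq]
      ring
    · rintro _ rfl
      rw [SetLike.mem_coe, mem_vanishingIdeal_singleton]
      simp
  · intro k hk
    have h1 : ∀ i j, q.rep i * dirDeriv x.rep k (f.coords j) =
        q.rep j * dirDeriv x.rep k (f.coords i) := fun i j => by
      have := hk _ (Ideal.mem_sup_left (Ideal.subset_span ⟨i, j, rfl⟩))
      rw [dirDeriv_sub, dirDeriv_C_mul, dirDeriv_C_mul] at this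
      exact sub_eq_zero.mp this
    have h2 : k (chartIndex x) = 0 := by
      have := hk _ (Ideal.mem_sup_right (Ideal.subset_span rfl))
      simpa [dirDeriv_sub] using this
    obtain ⟨i, hi⟩ := Function.ne_iff.mp q.rep_nonzero
    have hi : q.rep i ≠ 0 := hi
    have hd' : (d : F) ≠ 0 := Nat.cast_ne_zero.mpr hd
    -- The minors make `Df(k)` a multiple of `f(x)`, and by Euler's formula `Df(x) = d f(x)`; so `b`
    -- is chosen to put `k + b x` in the kernel of `Df`, which is zero. The chart equation then
    -- forces `b = 0`.
    set b : F := -(dirDeriv x.rep k (f.coords i) / (d * c * q.rep i)) with hb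
    have h3 : k + b • x.rep = 0 := by
      by_contra hne
      refine hJ ((f.eval_jacobianDet_eq_zero_iff _).mpr ⟨_, hne, fun j => ?_⟩)
      rw [dirDeriv_add_dir, dirDeriv_smul_dir, dirDeriv_coords_self, hcq, hb]
      field_simp
      linear_combination h1 i j
    have hb0 : b = 0 := by
      have := congrFun h3 (chartIndex x)
      simpa [h2, hκ] using this
    simpa [hb0] using h3

/-- A point of multiplicity two of a fibre is a simple fold. -/
theorem isFoldAt_of_fibreMult_eq_two (hd : d ≠ 0) {x q : ProjSpace F n} (hx : f.toFun x = q)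
    (h : f.fibreMult q x = 2) : f.IsFoldAt x.rep := by
  have hJ : eval x.rep f.jacobianDet = 0 := by
    by_contra hJ
    have := f.fibreMult_eq_one hd hx hJ
    omega
  refine ⟨hJ, fun k hfk hJk => ?_⟩
  by_contra hk
  -- When the kernel is the line of `k`, `J` vanishes to second order along `x + X k`, so the second
  -- derivative of `f` along `k` lies in the range of `Df`. The vector `l` cancels it, and `f` is
  -- constant to third order along `x + X k + X² l`.
  by_cases hker : ∀ l, (∀ i, dirDeriv x.rep l (f.coords i) = 0) → ∃ c : F, l = c • k
  · obtain ⟨l, hl⟩ : ∃ l, ∀ i, 2 * dirDeriv x.rep l (f.coords i) +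
        ∑ j, k j * dirDeriv x.rep k (pderiv j (f.coords i)) = 0 := by
      let M : Matrix (Fin (n + 1)) (Fin (n + 1)) (PowerSeries F) :=
        Matrix.of fun i j => aeval (quadArc x.rep k 0) (pderiv j (f.coords i))
      have hM0 : M.map PowerSeries.constantCoeff =
          Matrix.of fun i j => eval x.rep (pderiv j (f.coords i)) := by
        ext i j
        simp [M]
      have hMdet : M.det = aeval (quadArc x.rep k 0) f.jacobianDet := by
        rw [jacobianDet, AlgHom.map_det]
        rfl
      obtain ⟨l, hl⟩ := Matrix.exists_mulVec_add_eq_zero (M := M) (k := k) hk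
        (by rw [hM0]; ext i; rw [mulVec_eq_dirDeriv, hfk]; rfl)
        (by
          intro l hl
          rw [hM0] at hl
          exact hker l fun i => by rw [← mulVec_eq_dirDeriv, hl]; rfl)
        (by rw [hMdet, coeff_one_aeval_powerSeries]; simpa using hJk)
      refine ⟨(2 : F)⁻¹ • l, fun i => ?_⟩
      have := congrFun hl i
      rw [hM0, Pi.add_apply, mulVec_eq_dirDeriv] at this
      rw [dirDeriv_smul_dir, mul_inv_cancel_left₀ two_ne_zero]
      refine Eq.trans ?_ this
      congr 1
      simp only [Matrix.mulVec, dotProduct, Matrix.map_apply, M, Matrix.of_apply,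
        coeff_one_aeval_powerSeries]
      exact Finset.sum_congr rfl fun j _ => by simp [mul_comm]
    obtain ⟨Θ, u, hu, hΘ, hI⟩ := f.exists_arc hx 3 (quadArc x.rep k l) (by simp) fun i => by
      rw [PowerSeries.X_pow_dvd_iff]
      intro m hm
      interval_cases m
      · simp
      · simp [coeff_one_aeval_powerSeries, hfk]
      · have h2 := two_mul_coeff_two_aeval_powerSeries (quadArc x.rep k l) (f.coords i)
        simp only [constantCoeff_quadArc, coeff_one_quadArc, coeff_two_quadArc, hl] at h2
        have h3 := (mul_eq_zero.mp h2).resolve_left two_ne_zero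
        simp [h3]
    have hle : 3 ≤ f.fibreMult q x := by
      refine le_finrank_projLocalRing
        (fun j : Fin 3 => PowerSeries.coeff (j : ℕ) ∘ₗ Θ.toLinearMap)
        ?_ ?_ (by rw [← fibreMult, h]; exact two_ne_zero)
      · intro a ha
        simp only [Fin.sum_univ_three, LinearMap.comp_apply, AlgHom.toLinearMap_apply] at ha
        have h0 : a 0 = 0 := by simpa [PowerSeries.coeff_one] using ha 1
        have hex : ∃ i, k i + PowerSeries.coeff 1 u * x.rep i ≠ 0 := by
          by_contra! hall
          exact hk (f.eq_zero_of_add_smul_rep_eq_zero hd x hall hfk)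
        obtain ⟨i, hi⟩ := hex
        -- Along the arc `y` vanishes to order exactly one, so `1`, `y`, `y²` separate the first
        -- three coefficients.
        let y : Localization.AtPrime (vanishingIdeal F {x.rep}) :=
          algebraMap (MvPolynomial (Fin (n + 1)) F) _ (X i) - algebraMap F _ (x.rep i)
        have hy0 : PowerSeries.constantCoeff (Θ y) = 0 := by
          simp [y, hΘ, hu]
        have hy1 : PowerSeries.coeff 1 (Θ y) ≠ 0 := by
          rw [map_sub, hΘ, AlgHom.commutes, map_sub, coeff_one_mul_quadArc hu]
          simpa [PowerSeries.algebraMap_apply, PowerSeries.coeff_C] using hi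
        have hyy : PowerSeries.coeff 1 (Θ (y * y)) = 0 := by
          simp [PowerSeries.coeff_mul, Finset.Nat.antidiagonal_succ, hy0]
        have hyy2 : PowerSeries.coeff 2 (Θ (y * y)) = PowerSeries.coeff 1 (Θ y) ^ 2 := by
          simp [PowerSeries.coeff_mul, Finset.Nat.antidiagonal_succ, hy0, pow_two]
        have h2 : a 2 = 0 := by
          have := ha (y * y)
          rw [Fin.val_zero, Fin.val_one, Fin.val_two, h0, hyy, hyy2] at this
          simpa [hy1] using this
        have h1 : a 1 = 0 := by
          have := ha y
          simpa [h0, h2, hy1] using this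
        ext j
        fin_cases j
        exacts [h0, h1, h2]
      · intro z hz j
        exact PowerSeries.X_pow_dvd_iff.mp (hI z hz) j j.2
    omega
  -- With two independent kernel vectors, the value and the velocities along two arcs give three
  -- independent functionals.
  · push Not at hker
    obtain ⟨l, hfl, hl⟩ := hker
    obtain ⟨Θ, u, hu, hΘ, hI⟩ := f.exists_arc hx 2 (quadArc x.rep k 0) (by simp)
      fun i => X_sq_dvd_aeval_quadArc (hfk i)
    obtain ⟨Θ', u', hu', hΘ', hI'⟩ := f.exists_arc hx 2 (quadArc x.rep l 0) (by simp)
      fun i => X_sq_dvd_aeval_quadArc (hfl i)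
    have hle : 3 ≤ f.fibreMult q x := by
      refine le_finrank_projLocalRing
        ![PowerSeries.coeff 0 ∘ₗ Θ.toLinearMap, PowerSeries.coeff 1 ∘ₗ Θ.toLinearMap,
          PowerSeries.coeff 1 ∘ₗ Θ'.toLinearMap]
        ?_ ?_ (by rw [← fibreMult, h]; exact two_ne_zero)
      · intro a ha
        simp only [Fin.sum_univ_three, Matrix.cons_val_zero, Matrix.cons_val_one,
          Matrix.cons_val, LinearMap.comp_apply, AlgHom.toLinearMap_apply] at ha
        have h0 : a 0 = 0 := by simpa [PowerSeries.coeff_one] using ha 1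
        have hlin := f.eq_zero_of_add_smul_rep_eq_zero hd x (k := a 1 • k + a 2 • l)
          (c := a 1 * PowerSeries.coeff 1 u + a 2 * PowerSeries.coeff 1 u')
          (fun i => by
            have := ha (algebraMap (MvPolynomial (Fin (n + 1)) F) _ (X i))
            rw [hΘ, hΘ', h0, coeff_one_mul_quadArc hu, coeff_one_mul_quadArc hu'] at this
            simp only [Pi.add_apply, Pi.smul_apply, smul_eq_mul]
            linear_combination this)
          (fun i => by
            rw [dirDeriv_add_dir, dirDeriv_smul_dir, dirDeriv_smul_dir, hfk, hfl]
            ring)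
        have h2 : a 2 = 0 := by
          by_contra h2
          apply hl (-(a 2)⁻¹ * a 1)
          ext i
          have := congrFun hlin i
          simp only [Pi.add_apply, Pi.smul_apply, smul_eq_mul, Pi.zero_apply] at this ⊢
          field_simp
          linear_combination this
        have h1 : a 1 = 0 := by
          rw [h2, zero_smul, add_zero] at hlin
          exact (smul_eq_zero.mp hlin).resolve_right hk
        ext j
        fin_cases j
        exacts [h0, h1, h2]
      · intro z hz j
        have e := PowerSeries.X_pow_dvd_iff.mp (hI z hz)
        have e' := PowerSeries.X_pow_dvd_iff.mp (hI' z hz)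
        fin_cases j
        exacts [e 0 (by norm_num), e 1 (by norm_num), e' 1 (by norm_num)]
    omega

end ProjMorphism

/-! ### Finiteness of `f` on the cone, lying over, and contraction of principal ideals -/

namespace MvPolynomial

variable {F : Type*} [Field F] {σ τ : Type*}

theorem homogeneousComponent_mul_isHomogeneous {g : MvPolynomial σ F} {d : ℕ}
    (hg : g.IsHomogeneous d) (r : MvPolynomial σ F) {m : ℕ} (hm : d ≤ m) :
    homogeneousComponent m (r * g) = homogeneousComponent (m - d) r * g := by
  let := gradedAlgebra (σ := σ) (R := F)
  have := DirectSum.coe_decompose_mul_of_right_mem_of_le (homogeneousSubmodule σ F) (a := r)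
    (show g ∈ homogeneousSubmodule σ F d from hg) hm
  rw [← decomposition.decompose'_apply, ← decomposition.decompose'_apply]
  exact this

/-- Homogeneous polynomials of equal positive degree without a nontrivial common zero make the
polynomial ring finite over the subring that they generate. -/
theorem finite_bind₁ [IsAlgClosed F] [Finite σ] (f : τ → MvPolynomial σ F) {d : ℕ} (hd : d ≠ 0)
    (hf : ∀ i, (f i).IsHomogeneous d) (h0 : ∀ v : σ → F, (∀ i, eval v (f i) = 0) → v = 0)
    [Finite τ] :
    (bind₁ f).toRingHom.Finite := by
  classical
  let := Fintype.ofFinite τ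
  have hrad : idealOfVars σ F ≤ (Ideal.span (Set.range f)).radical := by
    rw [← vanishingIdeal_zeroLocus_eq_radical (K := F), idealOfVars, Ideal.span_le]
    rintro _ ⟨i, rfl⟩ v hv
    rw [zeroLocus_span] at hv
    rw [h0 v fun i => by simpa [aeval_eq_eval] using hv _ ⟨i, rfl⟩]
    simp
  obtain ⟨M, hM⟩ := Ideal.exists_pow_le_of_le_radical_of_fg hrad (idealOfVars_fg σ F)
  let := (bind₁ f).toRingHom.toAlgebra
  have hsmul : ∀ (a : MvPolynomial τ F) (b : MvPolynomial σ F), a • b = bind₁ f a * b :=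
    fun a b => rfl
  -- Forms of degree at least `M` lie in the ideal of the `f i`; the extra `d` guarantees that the
  -- coefficients can be taken in degree `m - d`, to which induction applies.
  let T : Set (MvPolynomial σ F) := (fun s => monomial s 1) '' {s : σ →₀ ℕ | s.degree < M + d}
  have hT : T.Finite := (Finsupp.finite_of_degree_le (M + d) |>.subset
    fun s (hs : s.degree < M + d) => hs.le).image _
  have key : ∀ m, ∀ g : MvPolynomial σ F, g.IsHomogeneous m →
      g ∈ Submodule.span (MvPolynomial τ F) T := by
    intro m
    induction m using Nat.strong_induction_on with
    | _ m ih =>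
      intro g hg
      by_cases hm : m < M + d
      · rw [g.as_sum]
        refine sum_mem fun s hs => ?_
        have : monomial s (coeff s g) = (C (coeff s g) : MvPolynomial τ F) • monomial s (1 : F) := by
          rw [hsmul, bind₁_C_right, C_mul_monomial, mul_one]
        rw [this]
        refine Submodule.smul_mem _ _ (Submodule.subset_span ⟨s, ?_, rfl⟩)
        have : s.degree = m := by
          by_contra hne
          exact (mem_support_iff.mp hs) (hg.coeff_eq_zero hne)
        simpa [this] using hm
      · have hgM : g ∈ Ideal.span (Set.range f) := by
          apply hM
          rw [mem_pow_idealOfVars_iff]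
          intro s hs
          have : s.degree = m := by
            by_contra hne
            exact (mem_support_iff.mp hs) (hg.coeff_eq_zero hne)
          omega
        obtain ⟨r, hr⟩ := Ideal.mem_span_range_iff_exists_fun.mp hgM
        have : g = ∑ i, (X i : MvPolynomial τ F) • homogeneousComponent (m - d) (r i) := by
          rw [← homogeneousComponent_eq_self hg, ← hr, map_sum]
          refine Finset.sum_congr rfl fun i _ => ?_
          rw [homogeneousComponent_mul_isHomogeneous (hf i) _ (by omega), hsmul, bind₁_X_right,
            mul_comm]
        rw [this]
        exact sum_mem fun i _ => Submodule.smul_mem _ _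
          (ih (m - d) (by omega) _ (homogeneousComponent_isHomogeneous _ _))
  refine ⟨⟨hT.toFinset, ?_⟩⟩
  rw [hT.coe_toFinset, eq_top_iff]
  intro g _
  rw [← sum_homogeneousComponent g]
  exact sum_mem fun i _ => key i _ (homogeneousComponent_isHomogeneous _ _)

/-- The polynomial ring is algebraic over the subalgebra generated by the `f i`; being no more
numerous than its transcendence degree, they are algebraically independent. -/
theorem bind₁_injective_of_finite [Finite σ] (f : σ → MvPolynomial σ F)
    (hf : (bind₁ f).toRingHom.Finite) : Function.Injective (bind₁ f) := by
  have hint : ∀ r : MvPolynomial σ F, IsIntegral (Algebra.adjoin F (Set.range f)) r := by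
    intro r
    obtain ⟨p, hp, hpr⟩ := hf.to_isIntegral r
    have hmem : ∀ a, bind₁ f a ∈ Algebra.adjoin F (Set.range f) := fun a => by
      rw [Algebra.adjoin_range_eq_range_aeval]
      exact ⟨a, rfl⟩
    let ψ : MvPolynomial σ F →+* Algebra.adjoin F (Set.range f) :=
      (bind₁ f).toRingHom.codRestrict _ hmem
    refine ⟨p.map ψ, hp.map _, ?_⟩
    rw [Polynomial.eval₂_map]
    exact hpr
  have : Algebra.IsAlgebraic (Algebra.adjoin F (Set.range f)) (MvPolynomial σ F) :=
    ⟨fun r => (hint r).isAlgebraic⟩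
  have h := Algebra.IsAlgebraic.isTranscendenceBasis_of_lift_le_trdeg_of_finite (R := F) f (by
    rw [MvPolynomial.trdeg_of_isDomain]; simp)
  exact h.1

/-- Lying over for points. -/
theorem exists_eval_eq_of_finite [IsAlgClosed F] [Finite σ] (f : τ → MvPolynomial σ F)
    (hf : (bind₁ f).toRingHom.Finite) (I : Ideal (MvPolynomial σ F)) (y : τ → F)
    (hy : ∀ g, bind₁ f g ∈ I → eval y g = 0) :
    ∃ x : σ → F, (∀ i, eval x (f i) = y i) ∧ ∀ g ∈ I, eval x g = 0 := by
  let := (bind₁ f).toRingHom.toAlgebra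
  have : Algebra.IsIntegral (MvPolynomial τ F) (MvPolynomial σ F) := ⟨hf.to_isIntegral⟩
  have hle : I.comap (algebraMap (MvPolynomial τ F) (MvPolynomial σ F)) ≤
      vanishingIdeal F {y} := fun g hg => by
    rw [mem_vanishingIdeal_singleton_iff, aeval_eq_eval]
    exact hy g hg
  obtain ⟨Q, hQI, hQ, hQy⟩ := Ideal.exists_ideal_over_prime_of_isIntegral _ I hle
  have hQmax : Q.IsMaximal := Ideal.isMaximal_of_isIntegral_of_isMaximal_comap
    (R := MvPolynomial τ F) Q (by rw [hQy]; infer_instance)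
  obtain ⟨x, rfl⟩ := isMaximal_iff_eq_vanishingIdeal_singleton.mp hQmax
  refine ⟨x, fun i => ?_, fun g hg => ?_⟩
  · have : (X i - C (y i) : MvPolynomial τ F) ∈ vanishingIdeal F {y} := by
      rw [mem_vanishingIdeal_singleton_iff]; simp
    rw [← hQy, Ideal.mem_comap, mem_vanishingIdeal_singleton_iff] at this
    change aeval x (bind₁ f _) = 0 at this
    simpa [aeval_eq_eval, sub_eq_zero] using this
  · have := hQI hg
    rwa [mem_vanishingIdeal_singleton_iff, aeval_eq_eval] at this

end MvPolynomial

/-- For an integral extension of a factorial ring `A` by a domain, the ideal of all elements of `A`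
that become nilpotent modulo a given nonzero element is principal. -/
theorem exists_forall_dvd_pow_iff {A R : Type*} [CommRing A] [IsDomain A]
    [UniqueFactorizationMonoid A] [CommRing R] [IsDomain R] (φ : A →+* R)
    (hφ : Function.Injective φ) (hint : φ.IsIntegral) {s : R} (hs : s ≠ 0) :
    ∃ T : A, T ≠ 0 ∧ ∀ g, (∃ k, s ∣ φ g ^ k) ↔ T ∣ g := by
  classical
  let := φ.toAlgebra
  have hφa : ∀ a, algebraMap A R a = φ a := fun a => rfl
  have : FaithfulSMul A R := (faithfulSMul_iff_algebraMap_injective A R).mpr hφ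
  have hsi : IsIntegral A s := hint s
  -- The constant coefficient `a` plays the role of the norm of `s`: `s` divides it, and the
  -- generator sought is its radical.
  set a := (minpoly A s).coeff 0 with ha
  have ha0 : a ≠ 0 := by
    intro h0
    have hdiv := Polynomial.divX_mul_X_add (minpoly A s)
    rw [← ha, h0, map_zero, add_zero] at hdiv
    have h := minpoly.aeval A s
    rw [← hdiv, map_mul, Polynomial.aeval_X] at h
    have hdvd := minpoly.isIntegrallyClosed_dvd hsi ((mul_eq_zero.mp h).resolve_right hs)
    have hne : (minpoly A s).divX ≠ 0 := fun h => minpoly.ne_zero hsi (by rw [← hdiv, h, zero_mul])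
    have h1 := Polynomial.natDegree_le_of_dvd hdvd hne
    rw [Polynomial.natDegree_divX_eq_natDegree_tsub_one] at h1
    have := minpoly.natDegree_pos hsi
    omega
  have hsa : s ∣ φ a := by
    have h := minpoly.aeval A s
    rw [← Polynomial.divX_mul_X_add (minpoly A s)] at h
    simp only [map_add, map_mul, Polynomial.aeval_X, Polynomial.aeval_C] at h
    refine ⟨-(Polynomial.aeval s (minpoly A s).divX), ?_⟩
    rw [← hφa]
    linear_combination h
  let := UniqueFactorizationMonoid.strongNormalizationMonoid (α := A)
  refine ⟨UniqueFactorizationMonoid.radical a, UniqueFactorizationMonoid.radical_ne_zero, fun g => ?_⟩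
  rw [← UniqueFactorizationMonoid.exists_dvd_pow_iff_radical_dvd ha0]
  constructor
  · rintro ⟨k, h, hk⟩
    obtain ⟨p, hp, hph⟩ := hint h
    -- Multiplying `p(h) = 0` by `s ^ deg p` and replacing `s h` by `g ^ k` gives an equation `Q(s)
    -- = 0` with constant coefficient a power of `g`. The minimal polynomial of `s` divides `Q`, so
    -- `a` divides that power.
    let Q : Polynomial A := ∑ i ∈ Finset.range (p.natDegree + 1),
      Polynomial.C (p.coeff i * g ^ (k * i)) * Polynomial.X ^ (p.natDegree - i)
    have hQ : Polynomial.aeval s Q = 0 := by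
      rw [Polynomial.eval₂_eq_sum_range] at hph
      simp only [Q, map_sum, map_mul, map_pow, Polynomial.aeval_X, Polynomial.aeval_C, hφa]
      rw [← mul_zero (s ^ p.natDegree), ← hph, Finset.mul_sum]
      refine Finset.sum_congr rfl fun i hi => ?_
      have hi' : p.natDegree = i + (p.natDegree - i) := by
        have := Finset.mem_range.mp hi; omega
      rw [pow_mul, hk]
      conv_rhs => rw [hi', pow_add]
      ring
    have hQ0 : Q.coeff 0 = g ^ (k * p.natDegree) := by
      simp only [Q, Polynomial.finsetSum_coeff, Polynomial.coeff_C_mul, Polynomial.coeff_X_pow]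
      rw [Finset.sum_eq_single p.natDegree]
      · simp [hp.coeff_natDegree]
      · intro i hi hne
        have := Finset.mem_range.mp hi
        rw [if_neg (by omega), mul_zero]
      · simp
    obtain ⟨c, hc⟩ := minpoly.isIntegrallyClosed_dvd hsi hQ
    refine ⟨k * p.natDegree, c.coeff 0, ?_⟩
    rw [← hQ0, hc, Polynomial.mul_coeff_zero]
  · rintro ⟨k, hk⟩
    exact ⟨k, hsa.trans (by rw [← map_pow]; exact map_dvd φ hk)⟩

/-! ### Factors of homogeneous polynomials -/

namespace MvPolynomial

variable {F : Type*} [Field F] {σ : Type*}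

/-- A nonzero component has degree at most that of `s`, so its quotient by `s` is a constant. -/
theorem exists_isHomogeneous_of_dvd_homogeneousComponent {s : MvPolynomial σ F} (hs : s ≠ 0)
    (h : ∀ m, s ∣ homogeneousComponent m s) : ∃ m, s.IsHomogeneous m := by
  have hne : ∃ m, homogeneousComponent m s ≠ 0 := by
    by_contra! hall
    exact hs (by rw [← sum_homogeneousComponent s]; simp [hall])
  obtain ⟨m, hm⟩ := hne
  obtain ⟨c, hc⟩ := h m
  have hc0 : c ≠ 0 := by rintro rfl; exact hm (by rw [hc, mul_zero])
  have hdeg : m = s.totalDegree + c.totalDegree := by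
    rw [← totalDegree_mul_of_isDomain hs hc0, ← hc]
    exact ((homogeneousComponent_isHomogeneous m s).totalDegree hm).symm
  have hle : m ≤ s.totalDegree := by
    by_contra hlt
    exact hm (homogeneousComponent_eq_zero _ _ (not_le.mp hlt))
  have hcC := totalDegree_eq_zero_iff_eq_C.mp (show c.totalDegree = 0 by omega)
  set a := coeff 0 c
  have ha : a ≠ 0 := by
    intro ha
    exact hc0 (by rw [hcC, ha, map_zero])
  refine ⟨m, ?_⟩
  have : s = C a⁻¹ * homogeneousComponent m s := by
    rw [hc, hcC, mul_left_comm, ← C_mul, inv_mul_cancel₀ ha, C_1, mul_one]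
  rw [this]
  exact (homogeneousComponent_isHomogeneous m s).C_mul _

theorem exists_irreducible_dvd_mem {R : Type*} [CommRing R] [IsDomain R]
    [UniqueFactorizationMonoid R] {P : Ideal R} (hP : P.IsPrime) {g : R} (hg : g ≠ 0) (hgP : g ∈ P) :
    ∃ s, Irreducible s ∧ s ∣ g ∧ s ∈ P := by
  have h : (UniqueFactorizationMonoid.factors g).prod ∈ P := by
    obtain ⟨u, hu⟩ := UniqueFactorizationMonoid.factors_prod hg
    rw [← hu] at hgP
    exact (hP.mem_or_mem hgP).resolve_right fun h => hP.ne_top (Ideal.eq_top_of_isUnit_mem _ h u.isUnit)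
  obtain ⟨s, hs, hsP⟩ := (hP.multiset_prod_mem_iff_exists_mem _).mp h
  exact ⟨s, UniqueFactorizationMonoid.irreducible_of_factor s hs,
    UniqueFactorizationMonoid.dvd_of_mem_factors hs, hsP⟩

/-- An irreducible factor of a homogeneous polynomial is homogeneous. -/
theorem exists_isHomogeneous_of_irreducible_dvd {s g : MvPolynomial σ F} (hs : Irreducible s)
    (hg : g ≠ 0) {m : ℕ} (hgm : g.IsHomogeneous m) (hsg : s ∣ g) : ∃ k, s.IsHomogeneous k := by
  let := gradedAlgebra (σ := σ) (R := F)
  have hP : (Ideal.span {s}).IsPrime := (Ideal.span_singleton_prime hs.ne_zero).mpr hs.prime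
  -- The homogeneous core of `(s)` is prime and contains `g`, hence an irreducible factor of `g`.
  -- This factor is a multiple of `s`, so an associate, and `s` itself lies in the core.
  have hcore := Ideal.IsPrime.homogeneousCore (𝒜 := homogeneousSubmodule σ F) hP
  have hgc : g ∈ ((Ideal.span {s}).homogeneousCore (homogeneousSubmodule σ F)).toIdeal :=
    Ideal.mem_homogeneousCore_of_homogeneous_of_mem ⟨m, hgm⟩ (Ideal.mem_span_singleton.mpr hsg)
  obtain ⟨s', hs', -, hs'c⟩ := exists_irreducible_dvd_mem hcore hg hgc
  have hdvd : s ∣ s' := Ideal.mem_span_singleton.mp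
    (Ideal.toIdeal_homogeneousCore_le (homogeneousSubmodule σ F) _ hs'c)
  have hsc : s ∈ ((Ideal.span {s}).homogeneousCore (homogeneousSubmodule σ F)).toIdeal :=
    Ideal.mem_of_dvd _ (hs.associated_of_dvd hs' hdvd).symm.dvd hs'c
  refine exists_isHomogeneous_of_dvd_homogeneousComponent hs.ne_zero fun k => ?_
  have := homogeneousComponent_mem_of_mem
    ((Ideal.span {s}).homogeneousCore (homogeneousSubmodule σ F)).isHomogeneous hsc k
  exact Ideal.mem_span_singleton.mp
    (Ideal.toIdeal_homogeneousCore_le (homogeneousSubmodule σ F) _ this)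

end MvPolynomial

/-! ### Hypersurfaces in projective space: ideals and components -/

section ProjectiveGeometry

variable {F : Type*} [Field F] {n : ℕ}

theorem eval_rep_mk {g : MvPolynomial (Fin (n + 1)) F} {m : ℕ} (hg : g.IsHomogeneous m)
    (v : Fin (n + 1) → F) (hv : v ≠ 0) :
    eval (Projectivization.mk F v hv).rep g = 0 ↔ eval v g = 0 := by
  obtain ⟨a, ha⟩ := Projectivization.exists_smul_eq_mk_rep F v hv
  rw [← ha, show a • v = (a : F) • v from rfl, hg.eval_smul]
  simp

theorem mem_projIdeal {Z : Set (ProjSpace F n)} {g : MvPolynomial (Fin (n + 1)) F} :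
    g ∈ projIdeal Z ↔ ∀ v (hv : v ≠ 0), Projectivization.mk F v hv ∈ Z → eval v g = 0 := by
  constructor
  · intro h v hv hZ
    simpa [aeval_eq_eval] using h v ⟨hv, hZ⟩
  · rintro h v ⟨hv, hZ⟩
    simpa [aeval_eq_eval] using h v hv hZ

theorem mem_projIdeal_of_isHomogeneous {Z : Set (ProjSpace F n)}
    {g : MvPolynomial (Fin (n + 1)) F} {m : ℕ} (hg : g.IsHomogeneous m) :
    g ∈ projIdeal Z ↔ ∀ x ∈ Z, eval x.rep g = 0 := by
  rw [mem_projIdeal]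
  constructor
  · intro h x hx
    exact h x.rep x.rep_nonzero (by rwa [x.mk_rep])
  · intro h v hv hZ
    exact (eval_rep_mk hg v hv).mp (h _ hZ)

/-- On the line through `v`, `g` is a polynomial in the scaling parameter whose coefficients are the
values of its components at `v`. It has infinitely many roots. -/
theorem homogeneousComponent_mem_projIdeal [Infinite F] {Z : Set (ProjSpace F n)}
    {g : MvPolynomial (Fin (n + 1)) F} (hg : g ∈ projIdeal Z) (m : ℕ) :
    homogeneousComponent m g ∈ projIdeal Z := by
  rw [mem_projIdeal] at hg ⊢
  intro v hv hZ
  let p : Polynomial F := ∑ i ∈ Finset.range (g.totalDegree + 1),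
    Polynomial.C (eval v (homogeneousComponent i g)) * Polynomial.X ^ i
  have hp : ∀ c, p.eval c = eval (c • v) g := by
    intro c
    conv_rhs => rw [← sum_homogeneousComponent g, map_sum]
    simp only [p, Polynomial.eval_finsetSum]
    refine Finset.sum_congr rfl fun i _ => ?_
    rw [(homogeneousComponent_isHomogeneous i g).eval_smul, Polynomial.eval_mul,
      Polynomial.eval_C, Polynomial.eval_pow, Polynomial.eval_X, mul_comm]
  have hp0 : p = 0 := by
    apply Polynomial.eq_zero_of_infinite_isRoot
    refine ((Set.finite_singleton (0 : F)).infinite_compl).mono fun c hc => ?_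
    rw [Set.mem_ofPred_eq, Polynomial.IsRoot, hp]
    have hcv : c • v ≠ 0 := smul_ne_zero hc hv
    refine hg _ hcv ?_
    convert hZ using 1
    rw [Projectivization.mk_eq_mk_iff']
    exact ⟨c, rfl⟩
  by_cases hm : m < g.totalDegree + 1
  · have hc : p.coeff m = 0 := by rw [hp0, Polynomial.coeff_zero]
    rw [Polynomial.finsetSum_coeff, Finset.sum_eq_single_of_mem m (Finset.mem_range.mpr hm)
      (fun i _ hi => by rw [Polynomial.coeff_C_mul, Polynomial.coeff_X_pow, if_neg (Ne.symm hi),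
        mul_zero]), Polynomial.coeff_C_mul, Polynomial.coeff_X_pow, if_pos rfl, mul_one] at hc
    exact hc
  · rw [homogeneousComponent_eq_zero _ _ (by omega), map_zero]

theorem eval_zero_of_mem_projIdeal [Infinite F] {Z : Set (ProjSpace F n)} (hZ : Z.Nonempty)
    {g : MvPolynomial (Fin (n + 1)) F} (hg : g ∈ projIdeal Z) : eval 0 g = 0 := by
  have h0 := homogeneousComponent_mem_projIdeal hg 0
  obtain ⟨x, hx⟩ := hZ
  rw [homogeneousComponent_zero, mem_projIdeal_of_isHomogeneous (isHomogeneous_C _ _)] at h0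
  have := h0 x hx
  rw [eval_C] at this
  rw [← constantCoeff_eq] at this
  rwa [eval_zero]

theorem isClosed_iff_isAlgebraicSet {Z : Set (ProjSpace F n)} : IsClosed Z ↔ IsAlgebraicSet Z := by
  rw [← isOpen_compl_iff]
  change IsAlgebraicSet Zᶜᶜ ↔ _
  rw [compl_compl]

theorem isClosed_projZeroLocus {S : Set (MvPolynomial (Fin (n + 1)) F)}
    (hS : ∀ g ∈ S, ∃ m : ℕ, g.IsHomogeneous m) : IsClosed (projZeroLocus (n := n) S) :=
  isClosed_iff_isAlgebraicSet.mpr ⟨S, hS, rfl⟩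

@[simp]
theorem mem_projZeroLocus_singleton {g : MvPolynomial (Fin (n + 1)) F} {x : ProjSpace F n} :
    x ∈ projZeroLocus {g} ↔ eval x.rep g = 0 := by
  simp [projZeroLocus]

theorem isClosed_projZeroLocus_singleton {g : MvPolynomial (Fin (n + 1)) F} {m : ℕ}
    (hg : g.IsHomogeneous m) : IsClosed (projZeroLocus (n := n) {g}) :=
  isClosed_projZeroLocus (by rintro _ rfl; exact ⟨m, hg⟩)

theorem projZeroLocus_anti_of_dvd {s g : MvPolynomial (Fin (n + 1)) F} (h : s ∣ g) :
    projZeroLocus (n := n) {s} ⊆ projZeroLocus {g} := by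
  obtain ⟨c, rfl⟩ := h
  intro x hx
  rw [mem_projZeroLocus_singleton] at hx ⊢
  rw [map_mul, hx, zero_mul]

/-- Primality of a homogeneous ideal can be tested on homogeneous elements, whose zero loci are
closed. -/
theorem projIdeal_isPrime [Infinite F] {Z : Set (ProjSpace F n)} (hZ : IsIrreducible Z) :
    (projIdeal Z).IsPrime := by
  let := gradedAlgebra (σ := Fin (n + 1)) (R := F)
  have hhom : (projIdeal Z).IsHomogeneous (homogeneousSubmodule (Fin (n + 1)) F) := by
    intro i g hg
    have := homogeneousComponent_mem_projIdeal hg i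
    rw [← decomposition.decompose'_apply] at this
    exact this
  apply hhom.isPrime_of_homogeneous_mem_or_mem
  · rw [Ideal.ne_top_iff_one]
    obtain ⟨x, hx⟩ := hZ.1
    intro h
    simpa using (mem_projIdeal_of_isHomogeneous (isHomogeneous_one _ _)).mp h x hx
  · rintro g h ⟨a, ha⟩ ⟨b, hb⟩ hgh
    have ha : g.IsHomogeneous a := ha
    have hb : h.IsHomogeneous b := hb
    rw [mem_projIdeal_of_isHomogeneous (ha.mul hb)] at hgh
    have hsub : Z ⊆ projZeroLocus {g} ∪ projZeroLocus {h} := fun x hx => by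
      have := hgh x hx
      rw [map_mul, mul_eq_zero] at this
      simpa using this
    rcases isPreirreducible_iff_isClosed_union_isClosed.mp hZ.2 _ _
      (isClosed_projZeroLocus_singleton ha) (isClosed_projZeroLocus_singleton hb) hsub with h1 | h1
    · exact Or.inl ((mem_projIdeal_of_isHomogeneous ha).mpr fun x hx => by simpa using h1 hx)
    · exact Or.inr ((mem_projIdeal_of_isHomogeneous hb).mpr fun x hx => by simpa using h1 hx)

theorem exists_irreducible_of_isIrreducible [Infinite F] {Z : Set (ProjSpace F n)}
    (hZ : IsIrreducible Z) {g : MvPolynomial (Fin (n + 1)) F} (hg0 : g ≠ 0) {m : ℕ}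
    (hg : g.IsHomogeneous m) (hZg : Z ⊆ projZeroLocus {g}) :
    ∃ s, Irreducible s ∧ s ∣ g ∧ (∃ k, s.IsHomogeneous k) ∧ Z ⊆ projZeroLocus {s} := by
  obtain ⟨s, hs, hsg, hsZ⟩ := exists_irreducible_dvd_mem (projIdeal_isPrime hZ) hg0
    ((mem_projIdeal_of_isHomogeneous hg).mpr fun x hx => by simpa using hZg hx)
  obtain ⟨k, hk⟩ := exists_isHomogeneous_of_irreducible_dvd hs hg0 hg hsg
  refine ⟨s, hs, hsg, ⟨k, hk⟩, fun x hx => ?_⟩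
  simpa using (mem_projIdeal_of_isHomogeneous hk).mp hsZ x hx

variable [IsAlgClosed F]

/-- The Nullstellensatz on the cone. Nonemptiness takes care of the origin: an empty locus has the
unit ideal, while a nonconstant form `g` may still have the origin as its only zero, as for `n = 0`.
-/
theorem mem_projIdeal_projZeroLocus_iff {g : MvPolynomial (Fin (n + 1)) F} {m : ℕ}
    (hg : g.IsHomogeneous m) (hne : (projZeroLocus (n := n) {g}).Nonempty)
    {h : MvPolynomial (Fin (n + 1)) F} :
    h ∈ projIdeal (projZeroLocus (n := n) {g}) ↔ ∃ k, g ∣ h ^ k := by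
  have : Infinite F := IsAlgClosed.instInfinite
  have hrad : (∃ k, g ∣ h ^ k) ↔ h ∈ (Ideal.span {g}).radical := by
    simp only [Ideal.mem_radical_iff, Ideal.mem_span_singleton]
  rw [hrad, ← vanishingIdeal_zeroLocus_eq_radical (K := F)]
  constructor
  · intro hh v hv
    rw [zeroLocus_span] at hv
    have hv : eval v g = 0 := by simpa [aeval_eq_eval] using hv g rfl
    rw [aeval_eq_eval]
    by_cases hv0 : v = 0
    · rw [hv0]
      exact eval_zero_of_mem_projIdeal hne hh
    · refine mem_projIdeal.mp hh v hv0 ?_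
      rwa [mem_projZeroLocus_singleton, eval_rep_mk hg]
  · intro hh
    rw [mem_projIdeal]
    intro v hv hvg
    rw [mem_projZeroLocus_singleton, eval_rep_mk hg] at hvg
    have := hh v (by rw [zeroLocus_span]; rintro _ rfl; simpa [aeval_eq_eval] using hvg)
    simpa [aeval_eq_eval] using this

theorem projIdeal_projZeroLocus_eq_span {s : MvPolynomial (Fin (n + 1)) F} {m : ℕ}
    (hs : s.IsHomogeneous m) (hirr : Irreducible s)
    (hne : (projZeroLocus (n := n) {s}).Nonempty) :
    projIdeal (projZeroLocus (n := n) {s}) = Ideal.span {s} := by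
  ext h
  rw [mem_projIdeal_projZeroLocus_iff hs hne, Ideal.mem_span_singleton]
  exact ⟨fun ⟨k, hk⟩ => hirr.prime.dvd_of_dvd_pow hk, fun h => ⟨1, by rwa [pow_one]⟩⟩

theorem isIrreducible_projZeroLocus {s : MvPolynomial (Fin (n + 1)) F} {m : ℕ}
    (hs : s.IsHomogeneous m) (hirr : Irreducible s)
    (hne : (projZeroLocus (n := n) {s}).Nonempty) :
    IsIrreducible (projZeroLocus (n := n) {s}) := by
  refine ⟨hne, isPreirreducible_iff_isClosed_union_isClosed.mpr fun Z₁ Z₂ h₁ h₂ hsub => ?_⟩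
  obtain ⟨S, hS, rfl⟩ := isClosed_iff_isAlgebraicSet.mp h₁
  obtain ⟨T, hT, rfl⟩ := isClosed_iff_isAlgebraicSet.mp h₂
  by_contra! hcon
  obtain ⟨⟨x, hx, hxS⟩, y, hy, hyT⟩ := And.imp Set.not_subset.mp Set.not_subset.mp hcon
  simp only [projZeroLocus, Set.mem_ofPred_eq, not_forall] at hxS hyT
  obtain ⟨g, hg, hgx⟩ := hxS
  obtain ⟨h, hh, hhy⟩ := hyT
  obtain ⟨a, ha⟩ := hS g hg
  obtain ⟨b, hb⟩ := hT h hh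
  have hprod : g * h ∈ projIdeal (projZeroLocus (n := n) {s}) := by
    rw [mem_projIdeal_of_isHomogeneous (ha.mul hb)]
    intro z hz
    rw [map_mul]
    rcases hsub hz with h1 | h1
    · rw [h1 g hg, zero_mul]
    · rw [h1 h hh, mul_zero]
  rw [projIdeal_projZeroLocus_eq_span hs hirr hne, Ideal.mem_span_singleton] at hprod
  rcases hirr.prime.dvd_or_dvd hprod with hd | hd
  · exact hgx (by simpa using projZeroLocus_anti_of_dvd hd hx)
  · exact hhy (by simpa using projZeroLocus_anti_of_dvd hd hy)

/-- The irreducible factors of `g` define irreducible components of its zero locus. -/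
theorem projZeroLocus_mem_componentsOf {g s : MvPolynomial (Fin (n + 1)) F} {m : ℕ}
    (hg0 : g ≠ 0) (hg : g.IsHomogeneous m) (hirr : Irreducible s) (hsg : s ∣ g)
    (hne : (projZeroLocus (n := n) {s}).Nonempty) :
    projZeroLocus (n := n) {s} ∈ componentsOf (projZeroLocus (n := n) {g}) := by
  have : Infinite F := IsAlgClosed.instInfinite
  obtain ⟨k, hk⟩ := exists_isHomogeneous_of_irreducible_dvd hirr hg0 hg hsg
  refine ⟨⟨isIrreducible_projZeroLocus hk hirr hne, projZeroLocus_anti_of_dvd hsg⟩, ?_⟩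
  rintro Y ⟨hY, hYg⟩ hle
  obtain ⟨s', hs', -, ⟨k', hk'⟩, hYs'⟩ := exists_irreducible_of_isIrreducible hY hg0 hg hYg
  have hmem : s' ∈ projIdeal (projZeroLocus (n := n) {s}) :=
    (mem_projIdeal_of_isHomogeneous hk').mpr fun x hx => by simpa using hYs' (hle hx)
  rw [projIdeal_projZeroLocus_eq_span hk hirr hne, Ideal.mem_span_singleton] at hmem
  exact hYs'.trans (projZeroLocus_anti_of_dvd (hirr.associated_of_dvd hs' hmem).symm.dvd)

theorem exists_eq_of_mem_componentsOf {g : MvPolynomial (Fin (n + 1)) F} {m : ℕ}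
    (hg0 : g ≠ 0) (hg : g.IsHomogeneous m) {Z : Set (ProjSpace F n)}
    (hZ : Z ∈ componentsOf (projZeroLocus (n := n) {g})) :
    ∃ s, Irreducible s ∧ s ∣ g ∧ (∃ k, s.IsHomogeneous k) ∧ Z = projZeroLocus {s} := by
  have : Infinite F := IsAlgClosed.instInfinite
  obtain ⟨s, hs, hsg, ⟨k, hk⟩, hZs⟩ := exists_irreducible_of_isIrreducible hZ.1.1 hg0 hg hZ.1.2
  exact ⟨s, hs, hsg, ⟨k, hk⟩, hZs.antisymm (hZ.2
    ⟨isIrreducible_projZeroLocus hk hs (hZ.1.1.1.mono hZs), projZeroLocus_anti_of_dvd hsg⟩ hZs)⟩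

end ProjectiveGeometry

/-! ### Images of hypersurfaces -/

namespace ProjMorphism

variable {F : Type*} [Field F] {n d : ℕ} (f : ProjMorphism F n d)

theorem eval_coords_ne_zero {v : Fin (n + 1) → F} (hv : v ≠ 0) :
    (fun i => eval v (f.coords i)) ≠ 0 :=
  fun h => hv (f.eq_zero_of_common_zero _ fun i => congrFun h i)

theorem eval_coords_smul (c : F) (v : Fin (n + 1) → F) :
    (fun i => eval (c • v) (f.coords i)) = c ^ d • fun i => eval v (f.coords i) :=
  funext fun i => (f.isHomogeneous i).eval_smul c v

theorem eval_coords_zero (hd : d ≠ 0) (i : Fin (n + 1)) : eval 0 (f.coords i) = 0 := by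
  have := (f.isHomogeneous i).eval_smul 0 0
  rwa [zero_smul, zero_pow hd, zero_mul] at this

theorem toFun_mk {v : Fin (n + 1) → F} (hv : v ≠ 0) :
    f.toFun (Projectivization.mk F v hv) =
      Projectivization.mk F (fun i => eval v (f.coords i)) (f.eval_coords_ne_zero hv) := by
  obtain ⟨a, ha⟩ := Projectivization.exists_smul_eq_mk_rep F v hv
  rw [toFun, Projectivization.mk_eq_mk_iff']
  refine ⟨(a : F) ^ d, ?_⟩
  rw [← eval_coords_smul, ← ha]
  rfl

/-- A representative of `f x` is the value of `f` at some representative of `x`. -/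
theorem exists_lift [IsAlgClosed F] (hd : d ≠ 0) {x : ProjSpace F n} {y : Fin (n + 1) → F}
    (hy : y ≠ 0) (h : f.toFun x = Projectivization.mk F y hy) :
    ∃ v, ∃ hv : v ≠ 0, Projectivization.mk F v hv = x ∧ (fun i => eval v (f.coords i)) = y := by
  rw [toFun, Projectivization.mk_eq_mk_iff'] at h
  obtain ⟨c, hc⟩ := h
  have hc0 : c ≠ 0 := by
    rintro rfl
    exact f.eval_rep_ne_zero x (by rw [← hc, zero_smul])
  obtain ⟨b, hb⟩ := IsAlgClosed.exists_pow_nat_eq c⁻¹ (Nat.pos_of_ne_zero hd)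
  have hb0 : b ≠ 0 := by
    rintro rfl
    rw [zero_pow hd] at hb
    exact inv_ne_zero hc0 hb.symm
  refine ⟨b • x.rep, smul_ne_zero hb0 x.rep_nonzero, ?_, ?_⟩
  · conv_rhs => rw [← x.mk_rep]
    rw [Projectivization.mk_eq_mk_iff']
    exact ⟨b, rfl⟩
  · rw [eval_coords_smul, hb, ← hc, smul_smul, inv_mul_cancel₀ hc0, one_smul]

theorem exists_isHomogeneous_jacobianDet : ∃ N, f.jacobianDet.IsHomogeneous N := by
  refine ⟨∑ _i : Fin (n + 1), (d - 1), ?_⟩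
  rw [jacobianDet, Matrix.det_apply]
  refine IsHomogeneous.sum _ _ _ fun σ _ => ?_
  have h : (∏ i, (Matrix.of fun i j => pderiv j (f.coords i)) (σ i) i).IsHomogeneous
      (∑ _i : Fin (n + 1), (d - 1)) :=
    IsHomogeneous.prod _ _ _ fun i _ => (f.isHomogeneous (σ i)).pderiv
  rcases Int.units_eq_one_or (Equiv.Perm.sign σ) with hs | hs
  · rwa [hs, one_smul]
  · rw [hs, Units.neg_smul, one_smul]
    exact h.neg

section Image

variable [IsAlgClosed F]

theorem finite_bind₁ (hd : d ≠ 0) : (bind₁ f.coords).toRingHom.Finite :=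
  MvPolynomial.finite_bind₁ f.coords hd f.isHomogeneous f.eq_zero_of_common_zero

theorem bind₁_injective (hd : d ≠ 0) : Function.Injective (bind₁ f.coords) :=
  bind₁_injective_of_finite f.coords (f.finite_bind₁ hd)

/-- Since scalars have `d`-th roots, the cone over the image is the image of the cone. -/
theorem mem_projIdeal_image_iff (hd : d ≠ 0) {Z : Set (ProjSpace F n)}
    {g : MvPolynomial (Fin (n + 1)) F} :
    g ∈ projIdeal (f.toFun '' Z) ↔ bind₁ f.coords g ∈ projIdeal Z := by
  rw [mem_projIdeal, mem_projIdeal]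
  constructor
  · intro h v hv hZ
    rw [eval_bind₁]
    exact h _ (f.eval_coords_ne_zero hv) ⟨_, hZ, f.toFun_mk hv⟩
  · rintro h y hy ⟨x, hx, hxy⟩
    obtain ⟨v, hv, rfl, rfl⟩ := f.exists_lift hd hy hxy
    rw [← eval_bind₁]
    exact h v hv hx

/-- The image of a hypersurface is a hypersurface. -/
theorem exists_image_eq_projZeroLocus (hd : d ≠ 0) {s : MvPolynomial (Fin (n + 1)) F} {m : ℕ}
    (hs0 : s ≠ 0) (hs : s.IsHomogeneous m) (hne : (projZeroLocus (n := n) {s}).Nonempty) :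
    ∃ T : MvPolynomial (Fin (n + 1)) F, T ≠ 0 ∧ (∃ k, T.IsHomogeneous k) ∧
      f.toFun '' projZeroLocus {s} = projZeroLocus {T} ∧
      projIdeal (f.toFun '' projZeroLocus {s}) = Ideal.span {T} := by
  have : Infinite F := IsAlgClosed.instInfinite
  obtain ⟨T, hT0, hT⟩ := exists_forall_dvd_pow_iff (bind₁ f.coords).toRingHom
    (f.bind₁_injective hd) (f.finite_bind₁ hd).to_isIntegral hs0
  have hI : projIdeal (f.toFun '' projZeroLocus {s}) = Ideal.span {T} := by
    ext g
    rw [f.mem_projIdeal_image_iff hd, mem_projIdeal_projZeroLocus_iff hs hne,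
      Ideal.mem_span_singleton, ← hT]
    rfl
  have hThom : ∃ k, T.IsHomogeneous k := by
    refine exists_isHomogeneous_of_dvd_homogeneousComponent hT0 fun k => ?_
    rw [← Ideal.mem_span_singleton, ← hI]
    exact homogeneousComponent_mem_projIdeal (hI ▸ Ideal.mem_span_singleton_self T) k
  refine ⟨T, hT0, hThom, ?_, hI⟩
  obtain ⟨k, hk⟩ := hThom
  apply Set.Subset.antisymm
  · intro x hx
    rw [mem_projZeroLocus_singleton]
    exact (mem_projIdeal_of_isHomogeneous hk).mp (hI ▸ Ideal.mem_span_singleton_self T) x hx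
  · intro x hx
    rw [mem_projZeroLocus_singleton] at hx
    -- Closedness of the image: lying over lifts each zero of `T` to a zero of `s`.
    obtain ⟨v, hv, hvs⟩ := exists_eval_eq_of_finite f.coords (f.finite_bind₁ hd)
      (Ideal.span {s}) x.rep (fun g hg => by
        have hTg : T ∣ g := (hT g).mp ⟨1, by
          rw [pow_one]; exact Ideal.mem_span_singleton.mp hg⟩
        obtain ⟨c, rfl⟩ := hTg
        rw [map_mul, hx, zero_mul])
    have hv0 : v ≠ 0 := by
      rintro rfl
      exact x.rep_nonzero (funext fun i => by rw [← hv, f.eval_coords_zero hd]; rfl)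
    refine ⟨Projectivization.mk F v hv0, ?_, ?_⟩
    · rw [mem_projZeroLocus_singleton, eval_rep_mk hs]
      exact hvs s (Ideal.mem_span_singleton_self s)
    · rw [f.toFun_mk hv0]
      conv_rhs => rw [← x.mk_rep]
      congr 1
      exact funext hv

end Image

end ProjMorphism

/-! ### Averaging over roots of unity, and the image of the critical locus at a fold -/

/-- A version of Nakayama's lemma for the image of an averaging operator `π`: if, modulo `𝔧` and
`𝔪`, this image consists of constants, then the same holds modulo `𝔧` after multiplication by
some `e ≡ 1` modulo `𝔪`. -/
theorem exists_mul_sub_mem_of_average {A R : Type*} [CommRing A] [IsNoetherianRing A] [CommRing R]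
    (φ : A →+* R) (hφ : φ.Finite) (π : R →+ R) (hπ : ∀ a r, π (φ a * r) = φ a * π r)
    (𝔪 : Ideal A) (𝔧 : Ideal R) (u : A) (hu : IsUnit u) (hππ : ∀ r, π (π r) = φ u * π r)
    (hπ1 : π 1 = φ u) (h𝔧 : ∀ r ∈ 𝔧, π r ∈ 𝔧)
    (hconst : ∀ r, ∃ a, π r - φ a ∈ 𝔧 ⊔ 𝔪.map φ) :
    ∃ e, e - 1 ∈ 𝔪 ∧ (∀ r, ∃ a, φ e * π r - φ a ∈ 𝔧) ∧
      ∀ r ∈ 𝔧 ⊔ (𝔪 ^ 2).map φ, ∃ a ∈ 𝔪 ^ 2, φ e * π r - φ a ∈ 𝔧 := by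
  let := φ.toAlgebra
  have hsmul : ∀ (a : A) (r : R), a • r = φ a * r := fun a r => rfl
  have : Module.Finite A R := hφ
  let πL : R →ₗ[A] R := { π with map_smul' := fun a r => hπ a r }
  have hπL : ∀ r, πL r = π r := fun r => rfl
  let M := LinearMap.range πL
  let N : Submodule A R := Submodule.span A {1} ⊔ 𝔧.restrictScalars A
  have hmap : ∀ 𝔫 : Ideal A, ∀ t ∈ 𝔫.map φ, ∀ r, π (r * t) ∈ 𝔫 • M := by
    intro 𝔫 t ht
    refine Submodule.span_induction (p := fun t _ => ∀ r, π (r * t) ∈ 𝔫 • M) ?_ ?_ ?_ ?_ ht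
    · rintro _ ⟨a, ha, rfl⟩ r
      rw [mul_comm, hπ]
      exact Submodule.smul_mem_smul ha ⟨r, rfl⟩
    · intro r
      simp
    · intro x y _ _ hx hy r
      rw [mul_add, map_add]
      exact add_mem (hx r) (hy r)
    · intro a x _ hx r
      rw [smul_eq_mul, ← mul_assoc]
      exact hx _
  have hle : M ≤ N ⊔ 𝔪 • M := by
    rintro _ ⟨r, rfl⟩
    rw [hπL]
    obtain ⟨a, ha⟩ := hconst r
    obtain ⟨j, hj, t, ht, hjt⟩ := Submodule.mem_sup.mp ha
    -- `π` is applied once more to `π r = φ a + j + t`, in order to bring the term from `𝔪 R` into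
    -- `𝔪 M`, where `M` is the image of `π`; Nakayama's lemma needs this.
    have h1 : u • π r = a • u • (1 : R) + π j + π (1 * t) := by
      have := congrArg π hjt
      rw [map_add, map_sub, hππ, ← mul_one (φ a), hπ, hπ1] at this
      rw [hsmul, hsmul, hsmul, one_mul, mul_one]
      linear_combination -this
    have h2 : u • π r ∈ N ⊔ 𝔪 • M := by
      rw [h1]
      refine add_mem (Submodule.mem_sup_left (add_mem ?_ ?_))
        (Submodule.mem_sup_right (hmap 𝔪 t ht 1))
      · exact Submodule.mem_sup_left (Submodule.smul_mem _ _ (Submodule.smul_mem _ _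
          (Submodule.mem_span_singleton_self _)))
      · exact Submodule.mem_sup_right (h𝔧 j hj)
    exact (Submodule.smul_mem_iff_of_isUnit _ hu).mp h2
  obtain ⟨e, he, heM⟩ := Submodule.exists_sub_one_mem_and_smul_le_of_fg_of_le_sup
    (IsNoetherian.noetherian M) le_rfl hle
  have hN : ∀ y ∈ M, ∃ a, φ e * y - φ a ∈ 𝔧 := by
    intro y hy
    have h1 : e • y ∈ N := heM (Submodule.smul_mem_pointwise_smul _ _ _ hy)
    obtain ⟨b, hb, j, hj, hbj⟩ := Submodule.mem_sup.mp h1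
    obtain ⟨a, rfl⟩ := Submodule.mem_span_singleton.mp hb
    refine ⟨a, ?_⟩
    rw [hsmul, hsmul, mul_one] at hbj
    rw [← hbj, add_sub_cancel_left]
    exact hj
  refine ⟨e, he, fun r => hN _ ⟨r, rfl⟩, fun r hr => ?_⟩
  obtain ⟨j, hj, t, ht, rfl⟩ := Submodule.mem_sup.mp hr
  -- As `e` carries `M` into constants plus `𝔧`, coefficients from `𝔪 ^ 2` survive in the constant.
  have key : ∀ y ∈ 𝔪 ^ 2 • M, ∃ a ∈ 𝔪 ^ 2, φ e * y - φ a ∈ 𝔧 := by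
    intro y hy
    refine Submodule.smul_induction_on hy (fun a ha m hm => ?_) fun x y hx hy => ?_
    · obtain ⟨b, hb⟩ := hN m hm
      refine ⟨a * b, Ideal.mul_mem_right _ _ ha, ?_⟩
      rw [hsmul, map_mul]
      convert 𝔧.mul_mem_left (φ a) hb using 1
      ring
    · obtain ⟨a, ha, h1⟩ := hx
      obtain ⟨b, hb, h2⟩ := hy
      refine ⟨a + b, add_mem ha hb, ?_⟩
      rw [map_add]
      convert add_mem h1 h2 using 1
      ring
  obtain ⟨a, ha, h1⟩ := key _ (hmap _ t ht 1)
  refine ⟨a, ha, ?_⟩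
  rw [one_mul] at h1
  rw [map_add]
  convert add_mem (𝔧.mul_mem_left (φ e) (h𝔧 j hj)) h1 using 1
  ring

theorem Ideal.sup_sq_le {R : Type*} [CommRing R] (I J : Ideal R) : (I ⊔ J) ^ 2 ≤ I ⊔ J ^ 2 := by
  rw [pow_two, Ideal.mul_le]
  intro x hx y hy
  obtain ⟨i, hi, j, hj, rfl⟩ := Submodule.mem_sup.mp hx
  obtain ⟨k, hk, l, hl, rfl⟩ := Submodule.mem_sup.mp hy
  have h : (i + j) * (k + l) = (i * (k + l) + j * k) + j * l := by ring
  rw [h, pow_two]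
  exact Submodule.add_mem_sup (I.add_mem (I.mul_mem_right _ hi) (I.mul_mem_left _ hk))
    (Ideal.mul_mem_mul hj hl)

namespace ProjMorphism

variable {F : Type*} [Field F] {n d : ℕ} (f : ProjMorphism F n d)

theorem IsFoldAt.smul {v : Fin (n + 1) → F} (h : f.IsFoldAt v) {c : F} (hc : c ≠ 0) :
    f.IsFoldAt (c • v) := by
  obtain ⟨N, hN⟩ := f.exists_isHomogeneous_jacobianDet
  refine ⟨by rw [hN.eval_smul, h.1, mul_zero], fun k hk hJ => h.2 k (fun i => ?_) ?_⟩
  · have := hk i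
    rw [(f.isHomogeneous i).dirDeriv_smul] at this
    exact (mul_eq_zero.mp this).resolve_left (pow_ne_zero _ hc)
  · rw [hN.dirDeriv_smul] at hJ
    exact (mul_eq_zero.mp hJ).resolve_left (pow_ne_zero _ hc)

/-- The linear substitution `X i ↦ ζ X i`. -/
noncomputable def rescale (ζ : F) :
    MvPolynomial (Fin (n + 1)) F →ₐ[F] MvPolynomial (Fin (n + 1)) F :=
  aeval fun i => C ζ * X i

theorem rescale_of_isHomogeneous (ζ : F) {g : MvPolynomial (Fin (n + 1)) F} {m : ℕ}
    (hg : g.IsHomogeneous m) : rescale ζ g = C (ζ ^ m) * g := by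
  rw [rescale, hg.aeval_mul (C ζ) X, aeval_X_left, AlgHom.id_apply, C_pow]

theorem rescale_rescale (ζ ξ : F) (g : MvPolynomial (Fin (n + 1)) F) :
    rescale ζ (rescale ξ g) = rescale (ζ * ξ) g := by
  rw [← AlgHom.comp_apply]
  congr 1
  ext1 i
  simp [rescale]
  ring

theorem eval_rescale (ζ : F) (g : MvPolynomial (Fin (n + 1)) F) (v : Fin (n + 1) → F) :
    eval v (rescale ζ g) = eval (ζ • v) g := by
  rw [rescale]
  change eval v (bind₁ _ g) = _
  rw [eval_bind₁]
  congr 2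
  ext i
  simp

theorem rescale_bind₁ {ζ : F} (hζ : ζ ^ d = 1) (g : MvPolynomial (Fin (n + 1)) F) :
    rescale ζ (bind₁ f.coords g) = bind₁ f.coords g := by
  rw [← AlgHom.comp_apply]
  congr 1
  ext1 i
  rw [AlgHom.comp_apply, bind₁_X_right, rescale_of_isHomogeneous ζ (f.isHomogeneous i), hζ, C_1,
    one_mul]

theorem rootsOfUnity_pow (ζ : rootsOfUnity d F) : ((ζ : Fˣ) : F) ^ d = 1 := by
  rw [← Units.val_pow_eq_pow_val, (mem_rootsOfUnity d _).mp ζ.2, Units.val_one]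

variable [NeZero d]

noncomputable instance fintypeRootsOfUnity : Fintype (rootsOfUnity d F) := Fintype.ofFinite _

/-- The sum over the group of `d`-th roots of unity, acting by rescaling. -/
noncomputable def average (d : ℕ) [NeZero d] :
    MvPolynomial (Fin (n + 1)) F →+ MvPolynomial (Fin (n + 1)) F :=
  ∑ ζ : rootsOfUnity d F, (rescale ((ζ : Fˣ) : F) :
    MvPolynomial (Fin (n + 1)) F →ₐ[F] MvPolynomial (Fin (n + 1)) F).toRingHom.toAddMonoidHom

theorem average_apply (g : MvPolynomial (Fin (n + 1)) F) :
    average d g = ∑ ζ : rootsOfUnity d F, rescale ((ζ : Fˣ) : F) g := by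
  simp only [average, AddMonoidHom.finsetSum_apply]
  rfl

theorem average_bind₁_mul (g r : MvPolynomial (Fin (n + 1)) F) :
    average d (bind₁ f.coords g * r) = bind₁ f.coords g * average d r := by
  simp only [average_apply, map_mul, Finset.mul_sum]
  exact Finset.sum_congr rfl fun ζ _ => by rw [f.rescale_bind₁ (rootsOfUnity_pow ζ)]

theorem rescale_average {ξ : F} (hξ : ξ ^ d = 1) (g : MvPolynomial (Fin (n + 1)) F) :
    rescale ξ (average d g) = average d g := by
  have hξ0 : ξ ≠ 0 := by
    rintro rfl
    rw [zero_pow (NeZero.ne d)] at hξ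
    exact zero_ne_one hξ
  let ξ' : rootsOfUnity d F := ⟨Units.mk0 ξ hξ0, by
    rw [mem_rootsOfUnity]; ext; simpa using hξ⟩
  rw [average_apply, map_sum]
  simp only [rescale_rescale]
  exact Fintype.sum_equiv (Equiv.mulLeft ξ') _ _ fun ζ => by simp [ξ']

theorem average_of_rescale_eq {g : MvPolynomial (Fin (n + 1)) F}
    (h : ∀ ζ : F, ζ ^ d = 1 → rescale ζ g = g) :
    average d g = C (Fintype.card (rootsOfUnity d F) : F) * g := by
  rw [average_apply, Finset.sum_congr rfl fun ζ _ => h _ (rootsOfUnity_pow ζ)]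
  simp

variable [IsAlgClosed F] [CharZero F]

set_option maxHeartbeats 400000 in
/-- Let the critical points over `w = f v` be the multiples of `v`, and let them be simple folds.
Then `f` induces an isomorphism from the critical locus at `v` to its image at `w`, and this image
lies on a hypersurface that is smooth at `w`. -/
theorem exists_smooth_hypersurface {v : Fin (n + 1) → F} (hfold : f.IsFoldAt v)
    (hcrit : ∀ x, (∀ i, eval x (f.coords i) = eval v (f.coords i)) → eval x f.jacobianDet = 0 →
      ∃ c : F, c ^ d = 1 ∧ x = c • v) :
    ∃ t e : MvPolynomial (Fin (n + 1)) F,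
      eval (fun i => eval v (f.coords i)) e ≠ 0 ∧
      f.jacobianDet ∣ bind₁ f.coords t ∧
      (∃ k, dirDeriv (fun i => eval v (f.coords i)) k t ≠ 0) ∧
      ∀ g : MvPolynomial (Fin (n + 1)) F, g.IsHomogeneous d →
        ∃ a, f.jacobianDet ∣ bind₁ f.coords e * g - bind₁ f.coords a := by
  have hd : d ≠ 0 := NeZero.ne d
  set w : Fin (n + 1) → F := fun i => eval v (f.coords i) with hw
  set φ := (bind₁ f.coords).toRingHom with hφ
  have hφa : ∀ a, φ a = bind₁ f.coords a := fun a => rfl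
  set I : Ideal (MvPolynomial (Fin (n + 1)) F) :=
    Ideal.span {f.jacobianDet} ⊔ (vanishingIdeal F {w}).map φ with hI
  have hJI : f.jacobianDet ∈ I := Ideal.mem_sup_left (Ideal.mem_span_singleton_self _)
  have hfI : ∀ i, f.coords i - C (w i) ∈ I := fun i => by
    refine Ideal.mem_sup_right ?_
    have : φ (X i - C (w i)) ∈ (vanishingIdeal F {w}).map φ :=
      Ideal.mem_map_of_mem _ (by simp)
    simpa [hφa] using this
  have hzero : ∀ x, (∀ p ∈ I, eval x p = 0) → ∃ c : F, c ^ d = 1 ∧ x = c • v := fun x hx =>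
    hcrit x (fun i => by simpa [sub_eq_zero] using hx _ (hfI i)) (hx _ hJI)
  have hc0 : ∀ c : F, c ^ d = 1 → c ≠ 0 := by
    rintro c hc rfl
    rw [zero_pow hd] at hc
    exact zero_ne_one hc
  -- The zeros of `I` are multiples of `v`, all folds by homogeneity, and the fold condition says
  -- exactly that the tangent space of `I` there is zero.
  have hunr : ∀ x, (∀ p ∈ I, eval x p = 0) → ∀ k, (∀ g ∈ I, dirDeriv x k g = 0) → k = 0 := by
    intro x hx k hk
    obtain ⟨c, hc, rfl⟩ := hzero x hx
    refine (IsFoldAt.smul f hfold (hc0 c hc)).2 k (fun i => ?_) (hk _ hJI)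
    simpa [dirDeriv_sub] using hk _ (hfI i)
  set N : F := (Fintype.card (rootsOfUnity d F) : F) with hN
  have hN0 : N ≠ 0 := Nat.cast_ne_zero.mpr Fintype.card_ne_zero
  obtain ⟨e, he, hge, hte⟩ := exists_mul_sub_mem_of_average φ (f.finite_bind₁ hd) (average d)
    (fun a r => f.average_bind₁_mul a r) (vanishingIdeal F {w}) (Ideal.span {f.jacobianDet})
    (C N) ((isUnit_iff_ne_zero.mpr hN0).map C)
    (fun r => by
      rw [average_of_rescale_eq fun ζ hζ => rescale_average hζ r, hφa, bind₁_C_right])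
    (by rw [average_of_rescale_eq fun ζ _ => map_one _, hφa, bind₁_C_right, mul_one])
    (fun r hr => by
      obtain ⟨m, hm⟩ := f.exists_isHomogeneous_jacobianDet
      rw [average_apply]
      refine sum_mem fun ζ _ => ?_
      rw [Ideal.mem_span_singleton] at hr ⊢
      obtain ⟨c, rfl⟩ := hr
      rw [map_mul, rescale_of_isHomogeneous _ hm]
      exact (Dvd.intro_left _ rfl).mul_right _)
    (fun r => by
      -- An average takes the same value at all the zeros `c • v`, and `I` is radical.
      refine ⟨C (eval v (average d r)), ?_⟩
      refine mem_of_unramified hunr fun x hx => ?_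
      obtain ⟨c, hc, rfl⟩ := hzero x hx
      rw [hφa, bind₁_C_right, map_sub, eval_C, ← eval_rescale, rescale_average hc, sub_self])
  -- A linear form `ℓ` on the target that kills the image of `Df(v)`. Its pull-back vanishes to
  -- second order at every zero of `I`, hence lies in `I ^ 2`, and so in `(J)` plus the pull-back of
  -- the squared maximal ideal of `w`.
  obtain ⟨ℓ, hℓ0, hℓ⟩ : ∃ ℓ : Fin (n + 1) → F, ℓ ≠ 0 ∧
      ∀ k, ∑ i, ℓ i * dirDeriv v k (f.coords i) = 0 := by
    have hdet := hfold.1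
    rw [eval_jacobianDet] at hdet
    obtain ⟨ℓ, hℓ0, hℓ⟩ := Matrix.exists_vecMul_eq_zero_iff.mpr hdet
    refine ⟨ℓ, hℓ0, fun k => ?_⟩
    have : ℓ ⬝ᵥ (Matrix.of fun i j => eval v (pderiv j (f.coords i))).mulVec k = 0 := by
      rw [Matrix.dotProduct_mulVec, hℓ, zero_dotProduct]
    simpa [dotProduct, mulVec_eq_dirDeriv] using this
  set L : MvPolynomial (Fin (n + 1)) F := ∑ i, C (ℓ i) * X i with hL
  have hLφ : bind₁ f.coords L = ∑ i, C (ℓ i) * f.coords i := by simp [hL]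
  have hLw : eval w L = 0 := by
    have := hℓ v
    simp only [dirDeriv_coords_self] at this
    have h2 : (d : F) * ∑ i, ℓ i * w i = 0 := by
      rw [← this, Finset.mul_sum]
      exact Finset.sum_congr rfl fun i _ => by ring
    simpa [hL, hd] using h2
  have hLk : ∀ k, dirDeriv w k L = ∑ i, ℓ i * k i := fun k => by
    rw [hL, dirDeriv_sum]
    simp only [dirDeriv_C_mul, dirDeriv_X]
  have hLI : bind₁ f.coords L ∈ I ^ 2 := by
    refine mem_sq_of_unramified hunr fun x hx => ?_
    obtain ⟨c, hc, rfl⟩ := hzero x hx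
    apply mem_sq_of_dirDeriv_eq_zero
    · rw [eval_bind₁, f.eval_coords_smul, hc, one_smul]
      exact hLw
    · intro k
      rw [hLφ, dirDeriv_sum]
      simp only [dirDeriv_C_mul, (f.isHomogeneous _).dirDeriv_smul]
      rw [← mul_zero (c ^ (d - 1)), ← hℓ k, Finset.mul_sum]
      exact Finset.sum_congr rfl fun i _ => by ring
  have hI2 : I ^ 2 ≤ Ideal.span {f.jacobianDet} ⊔ (vanishingIdeal F {w} ^ 2).map φ := by
    rw [Ideal.map_pow]
    exact Ideal.sup_sq_le _ _
  obtain ⟨a, ha, haJ⟩ := hte _ (hI2 hLI)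
  rw [average_of_rescale_eq fun ζ hζ => f.rescale_bind₁ hζ L, Ideal.mem_span_singleton] at haJ
  have hew : eval w e = 1 := by
    rw [mem_vanishingIdeal_singleton, map_sub, map_one, sub_eq_zero] at he
    exact he
  -- The linear term of this equation at `w` is `N * L`, because `e` is 1 there, `L` vanishes and
  -- `a` is of second order.
  refine ⟨e * (C N * L) - a, e, by rw [hew]; exact one_ne_zero, ?_, ?_, ?_⟩
  · convert haJ using 1
    rw [map_sub, map_mul, map_mul, bind₁_C_right, hφa, hφa]
  · obtain ⟨i, hi⟩ := Function.ne_iff.mp hℓ0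
    refine ⟨Pi.single i 1, ?_⟩
    have ha0 : dirDeriv w (Pi.single i 1) a = 0 := by
      rw [pow_two] at ha
      refine Submodule.mul_induction_on ha (fun p hp q hq => ?_) fun p q hp hq => ?_
      · rw [mem_vanishingIdeal_singleton] at hp hq
        rw [dirDeriv_mul, hp, hq]
        ring
      · rw [dirDeriv_add, hp, hq, add_zero]
    rw [dirDeriv_sub, ha0, dirDeriv_mul, dirDeriv_C_mul, map_mul, hLw, hLk, hew]
    simpa [Pi.single_apply, hN0] using hi
  -- Forms of degree `d` are invariant under rescaling by roots of unity, so averaging only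
  -- multiplies them by `N`.
  · intro g hg
    obtain ⟨a, ha⟩ := hge g
    refine ⟨C N⁻¹ * a, ?_⟩
    rw [Ideal.mem_span_singleton, average_of_rescale_eq fun ζ hζ => by
      rw [rescale_of_isHomogeneous ζ hg, hζ, C_1, one_mul]] at ha
    convert ha.mul_left (C N⁻¹) using 1
    rw [map_mul, bind₁_C_right, hφa, hφa, mul_sub]
    congr 1
    rw [mul_left_comm (C N⁻¹), ← mul_assoc (C N⁻¹), ← C_mul, inv_mul_cancel₀ hN0, C_1, one_mul]

end ProjMorphism

/-! ### Regular quotients and the Jacobian criterion -/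

theorem IsRegularLocalRing.quotient_of_sup_span_eq {R : Type*} [CommRing R] [IsLocalRing R]
    [IsNoetherianRing R] {I : Ideal R} {s : Set R} (hs : s.Finite)
    (h : I ⊔ Ideal.span s = IsLocalRing.maximalIdeal R) {r : ℕ} (hI : I.spanFinrank ≤ r)
    (hdim : ((s.ncard + r : ℕ) : WithBot ℕ∞) ≤ ringKrullDim R) :
    IsRegularLocalRing (R ⧸ I) := by
  have hIm : I ≤ IsLocalRing.maximalIdeal R := h ▸ le_sup_left
  have : Nontrivial (R ⧸ I) := Ideal.Quotient.nontrivial_iff.mpr fun h' =>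
    Ideal.IsPrime.ne_top' (top_le_iff.mp (h' ▸ hIm))
  have : IsLocalRing (R ⧸ I) :=
    IsLocalRing.of_surjective' (Ideal.Quotient.mk I) Ideal.Quotient.mk_surjective
  have hmax : IsLocalRing.maximalIdeal (R ⧸ I) = Ideal.span (Ideal.Quotient.mk I '' s) := by
    rw [← Ideal.map_span, ← IsLocalRing.map_maximalIdeal_of_surjective (Ideal.Quotient.mk I)
      Ideal.Quotient.mk_surjective, ← h, Ideal.map_sup, Ideal.map_quotient_self, bot_sup_eq]
  -- The image of `s` generates the maximal ideal of the quotient, and dividing by `I`, which needs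
  -- at most `r` generators, lowers the dimension by at most `r`.
  apply IsRegularLocalRing.of_spanFinrank_maximalIdeal_le
  have h1 : (IsLocalRing.maximalIdeal (R ⧸ I)).spanFinrank ≤ s.ncard := by
    rw [hmax]
    exact (Submodule.spanFinrank_span_le_ncard_of_finite (hs.image _)).trans
      (Set.ncard_image_le hs)
  have h2 := ringKrullDim_le_ringKrullDim_quotient_add_spanFinrank I
    (by rwa [IsLocalRing.ringJacobson_eq_maximalIdeal])
  have h3 : ((s.ncard + r : ℕ) : WithBot ℕ∞) ≤ ringKrullDim (R ⧸ I) + (r : WithBot ℕ∞) :=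
    (hdim.trans h2).trans (by gcongr)
  have h4 : (s.ncard : WithBot ℕ∞) ≤ ringKrullDim (R ⧸ I) := by
    induction hD : ringKrullDim (R ⧸ I) with
    | bot => exact absurd hD ringKrullDim_ne_bot
    | coe D =>
      rw [hD] at h3
      have h5 : ((s.ncard + r : ℕ) : ℕ∞) ≤ D + (r : ℕ∞) := by exact_mod_cast h3
      rw [Nat.cast_add] at h5
      have h6 := (ENat.add_le_add_iff_right (ENat.natCast_ne_top r)).mp h5
      exact_mod_cast h6
  exact le_trans (by exact_mod_cast h1) h4

section

variable {F : Type*} [Field F] {n : ℕ}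

namespace MvPolynomial

variable {σ : Type*}

/-- The translation `X i ↦ X i + a i`. -/
noncomputable def translate (a : σ → F) : MvPolynomial σ F ≃ₐ[F] MvPolynomial σ F :=
  AlgEquiv.ofAlgHom (aeval fun i => X i + C (a i)) (aeval fun i => X i - C (a i))
    (by ext1 i; simp) (by ext1 i; simp)

theorem eval_translate [Fintype σ] (a v : σ → F) (g : MvPolynomial σ F) :
    eval v (translate a g) = eval (v + a) g := by
  change eval v (bind₁ (fun i => X i + C (a i)) g) = _
  rw [eval_bind₁]
  congr 2
  ext i
  simp

/-- Translations permute the points transitively, so all maximal ideals have the same height, which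
is the dimension of the ring. -/
theorem height_vanishingIdeal_singleton [Fintype σ] [IsAlgClosed F] (v : σ → F) :
    ((Nat.card σ : ℕ) : WithBot ℕ∞) ≤ (vanishingIdeal F {v}).height := by
  have h : ringKrullDim (MvPolynomial σ F) ≤ (vanishingIdeal F {v}).height := by
    rw [ringKrullDim_le_iff_isMaximal_height_le]
    intro m hm
    obtain ⟨x, rfl⟩ := isMaximal_iff_eq_vanishingIdeal_singleton.mp hm
    have hcomap : Ideal.comap (translate (v - x)).toRingEquiv (vanishingIdeal F {x}) =
        vanishingIdeal F {v} := by
      ext g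
      rw [Ideal.mem_comap, mem_vanishingIdeal_singleton, mem_vanishingIdeal_singleton]
      change eval x (translate (v - x) g) = 0 ↔ _
      rw [eval_translate, add_sub_cancel]
    rw [← hcomap, RingEquiv.height_comap]
  rwa [ringKrullDim_of_isNoetherianRing, ringKrullDim_eq_zero_of_field, zero_add] at h

end MvPolynomial

/-- The Jacobian criterion for a hypersurface. -/
theorem isSmoothPointOf_of_dirDeriv_ne_zero [IsAlgClosed F] {Z : Set (ProjSpace F n)}
    {T : MvPolynomial (Fin (n + 1)) F} {m : ℕ} (hT : T.IsHomogeneous m)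
    (hZT : projIdeal Z = Ideal.span {T}) {q : ProjSpace F n} (hq : q ∈ Z)
    {k : Fin (n + 1) → F} (hk : dirDeriv q.rep k T ≠ 0) : IsSmoothPointOf Z q := by
  refine ⟨hq, ?_⟩
  set v := q.rep with hv
  set κ := chartIndex q with hκ
  have hvκ : v κ ≠ 0 := rep_chartIndex_ne_zero q
  have hTv : eval v T = 0 := (mem_projIdeal_of_isHomogeneous hT).mp
    (hZT ▸ Ideal.mem_span_singleton_self T) q hq
  -- Since `T` vanishes at `v`, Euler's formula makes its gradient orthogonal to `v`; as `v κ ≠ 0`,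
  -- the gradient cannot be concentrated in the coordinate `κ`.
  obtain ⟨j, hjκ, hj⟩ : ∃ j, j ≠ κ ∧ eval v (pderiv j T) ≠ 0 := by
    by_contra! hcon
    have heuler := hT.dirDeriv_self v
    rw [hTv, mul_zero, dirDeriv, Finset.sum_eq_single κ (fun j _ hj => by rw [hcon j hj, mul_zero])
      (by simp)] at heuler
    have h0 := (mul_eq_zero.mp heuler).resolve_left hvκ
    refine hk (Finset.sum_eq_zero fun i _ => ?_)
    by_cases hi : i = κ
    · rw [hi, h0, mul_zero]
    · rw [hcon i hi, mul_zero]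
  let S : Set (MvPolynomial (Fin (n + 1)) F) := (fun i => X i - C (v i)) '' {κ, j}ᶜ
  have hmax := ProjMorphism.map_sup_span_eq_maximalIdeal
    ((projIdeal Z ⊔ Ideal.span {X κ - C (v κ)}) ⊔ Ideal.span S) (v := v) (by
      rw [hZT, sup_le_iff, sup_le_iff, Ideal.span_le, Ideal.span_le, Ideal.span_le]
      refine ⟨⟨?_, ?_⟩, ?_⟩
      · rintro _ rfl
        exact mem_vanishingIdeal_singleton.mpr hTv
      · rintro _ rfl
        exact mem_vanishingIdeal_singleton.mpr (by simp)
      · rintro _ ⟨i, -, rfl⟩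
        exact mem_vanishingIdeal_singleton.mpr (by simp)) (by
      intro l hl
      have hlκ : l κ = 0 := by
        simpa [dirDeriv_sub] using hl _ (Ideal.mem_sup_left (Ideal.mem_sup_right
          (Ideal.mem_span_singleton_self _)))
      have hli : ∀ i, i ≠ j → l i = 0 := by
        intro i hi
        by_cases hiκ : i = κ
        · rw [hiκ, hlκ]
        · simpa [dirDeriv_sub] using hl (X i - C (v i)) (Ideal.mem_sup_right
            (Ideal.subset_span ⟨i, by simp [hi, hiκ], rfl⟩))
      have hlT := hl T (Ideal.mem_sup_left (Ideal.mem_sup_left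
        (hZT ▸ Ideal.mem_span_singleton_self T)))
      rw [dirDeriv, Finset.sum_eq_single j (fun i _ hi => by rw [hli i hi, zero_mul])
        (by simp)] at hlT
      ext i
      by_cases hi : i = j
      · rw [hi]
        exact (mul_eq_zero.mp hlT).resolve_right hj
      · exact hli i hi)
  rw [Ideal.map_sup, Ideal.map_span _ S] at hmax
  have hSfin : S.Finite := (Set.toFinite _).image _
  -- Two equations are divided out: `T` and that of the chart.
  refine IsRegularLocalRing.quotient_of_sup_span_eq (hSfin.image _) hmax (r := 2) ?_ ?_
  · rw [hZT, ← Ideal.span_union, Ideal.map_span]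
    refine (Submodule.spanFinrank_span_le_ncard_of_finite
      ((Set.toFinite _).image _)).trans ((Set.ncard_image_le (Set.toFinite _)).trans ?_)
    exact (Set.ncard_union_le _ _).trans (by simp)
  · rw [IsLocalization.AtPrime.ringKrullDim_eq_height (vanishingIdeal F {v})]
    refine le_trans ?_ (height_vanishingIdeal_singleton v)
    have h1 := (Set.ncard_image_le (f := algebraMap (MvPolynomial (Fin (n + 1)) F)
      (Localization.AtPrime (vanishingIdeal F {v}))) hSfin).trans
        (Set.ncard_image_le (f := fun i => (X i - C (v i) : MvPolynomial (Fin (n + 1)) F))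
          (Set.toFinite ({κ, j}ᶜ)))
    have h2 := Set.ncard_add_ncard_compl ({κ, j} : Set (Fin (n + 1)))
    rw [Set.ncard_pair hjκ.symm] at h2
    exact_mod_cast (by omega)

end

/-! ### Isolated folds: components, injectivity and multiplicity two -/

namespace MvPolynomial

variable {F : Type*} [Field F] {σ : Type*} [Fintype σ]

theorem eval_ne_zero_of_dirDeriv_mul_ne_zero {v k : σ → F} {s c : MvPolynomial σ F}
    (hs : eval v s = 0) (h : dirDeriv v k (s * c) ≠ 0) : eval v c ≠ 0 ∧ dirDeriv v k s ≠ 0 := by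
  rw [dirDeriv_mul, hs, zero_mul, zero_add] at h
  exact ⟨left_ne_zero_of_mul h, right_ne_zero_of_mul h⟩

/-- Were two non-associated factors of `g` both zero at `v`, the product rule would kill all
derivatives of `g` there. This yields the uniqueness of components through a point. -/
theorem associated_of_dvd_of_dirDeriv_ne_zero {v k : σ → F} {g s s' : MvPolynomial σ F}
    (h : dirDeriv v k g ≠ 0) (hs : Irreducible s) (hsg : s ∣ g) (hsv : eval v s = 0)
    (hs' : Irreducible s') (hsg' : s' ∣ g) (hsv' : eval v s' = 0) : Associated s s' := by
  obtain ⟨c, rfl⟩ := hsg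
  rcases hs'.prime.dvd_or_dvd hsg' with h' | ⟨b, rfl⟩
  · exact (hs'.associated_of_dvd hs h').symm
  · refine absurd ?_ (eval_ne_zero_of_dirDeriv_mul_ne_zero hsv h).1
    rw [map_mul, hsv', zero_mul]

end MvPolynomial

section

variable {F : Type*} [Field F] {n : ℕ}

theorem projZeroLocus_eq_of_associated {s s' : MvPolynomial (Fin (n + 1)) F}
    (h : Associated s s') : projZeroLocus (n := n) {s} = projZeroLocus {s'} :=
  (projZeroLocus_anti_of_dvd h.dvd).antisymm (projZeroLocus_anti_of_dvd h.symm.dvd)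

end

namespace ProjMorphism

variable {F : Type*} [Field F] {n d : ℕ} (f : ProjMorphism F n d)

/-- `p` is a simple fold, and the only critical point in its fibre. -/
def IsIsolatedFold (p : ProjSpace F n) : Prop :=
  f.IsFoldAt p.rep ∧ ∀ x, f.toFun x = f.toFun p → eval x.rep f.jacobianDet = 0 → x = p

theorem IsMinimallyBranchedAt.toFun_eq {f : ProjMorphism F n d} {q p : ProjSpace F n}
    {ps : Fin (d ^ n - 2) → ProjSpace F n} (h : f.IsMinimallyBranchedAt q p ps) :
    f.toFun p = q := by
  have : p ∈ {x | f.toFun x = q} := by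
    rw [h.2.2.1]
    exact Set.mem_insert _ _
  exact this

theorem IsMinimallyBranchedAt.isIsolatedFold [CharZero F] {f : ProjMorphism F n d} (hd : d ≠ 0)
    {q p : ProjSpace F n} {ps : Fin (d ^ n - 2) → ProjSpace F n}
    (h : f.IsMinimallyBranchedAt q p ps) : f.IsIsolatedFold p := by
  have hp := h.toFun_eq
  refine ⟨f.isFoldAt_of_fibreMult_eq_two hd hp h.2.2.2.1, fun x hx hJ => ?_⟩
  have hxq : x ∈ {x | f.toFun x = q} := hx.trans hp
  rw [h.2.2.1] at hxq
  rcases hxq with rfl | ⟨i, rfl⟩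
  · rfl
  · exact absurd hJ (f.eval_jacobianDet_ne_zero hd (hx.trans hp) (h.2.2.2.2 i))

variable {f} in
theorem IsIsolatedFold.eq_smul (hd : d ≠ 0) {p : ProjSpace F n} (h : f.IsIsolatedFold p)
    (x : Fin (n + 1) → F) (hx : ∀ i, eval x (f.coords i) = eval p.rep (f.coords i))
    (hJ : eval x f.jacobianDet = 0) : ∃ c : F, c ^ d = 1 ∧ x = c • p.rep := by
  obtain ⟨i, hi⟩ := f.exists_coords_ne_zero p
  have hx0 : x ≠ 0 := by
    rintro rfl
    exact hi (by rw [← hx, f.eval_coords_zero hd])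
  obtain ⟨N, hN⟩ := f.exists_isHomogeneous_jacobianDet
  have hp : Projectivization.mk F x hx0 = p := by
    refine h.2 _ ?_ ((eval_rep_mk hN x hx0).mpr hJ)
    rw [toFun_mk, toFun]
    congr 1
    exact funext hx
  conv_rhs at hp => rw [← p.mk_rep]
  obtain ⟨c, hc⟩ := (Projectivization.mk_eq_mk_iff' F _ _ _ _).mp hp
  refine ⟨c, ?_, hc.symm⟩
  have := hx i
  rw [← hc, (f.isHomogeneous i).eval_smul] at this
  exact mul_right_cancel₀ hi (this.trans (one_mul _).symm)

variable {f} in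
theorem IsFoldAt.exists_dirDeriv_jacobianDet_ne_zero {v : Fin (n + 1) → F} (h : f.IsFoldAt v) :
    ∃ k, (∀ i, dirDeriv v k (f.coords i) = 0) ∧ dirDeriv v k f.jacobianDet ≠ 0 := by
  obtain ⟨k, hk, hfk⟩ := (f.eval_jacobianDet_eq_zero_iff v).mp h.1
  exact ⟨k, hfk, fun hJ => hk (h.2 k hfk hJ)⟩

variable {f} in
-- As `dJ` is injective on the kernel of `Df`, this kernel is a line and the adjugate is nonzero.
-- Its columns lie in the kernel, and `dJ` does not kill a nonzero one.
theorem IsFoldAt.exists_adjugate_ne_zero {v : Fin (n + 1) → F} (h : f.IsFoldAt v) :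
    ∃ i, dirDeriv v (fun j => (Matrix.of fun i j => eval v (pderiv j (f.coords i))).adjugate j i)
      f.jacobianDet ≠ 0 := by
  obtain ⟨k, hfk, hJk⟩ := h.exists_dirDeriv_jacobianDet_ne_zero
  set M := Matrix.of fun i j => eval v (pderiv j (f.coords i)) with hM
  have hMk : ∀ x, M.mulVec x = 0 ↔ ∀ i, dirDeriv v x (f.coords i) = 0 := fun x => by
    rw [funext_iff]
    simp only [hM, mulVec_eq_dirDeriv, Pi.zero_apply]
  have hk0 : k ≠ 0 := by
    rintro rfl
    simp [dirDeriv] at hJk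
  have hadj : M.adjugate ≠ 0 := by
    refine Matrix.adjugate_ne_zero_of_ker_le_span hk0 ((hMk k).mpr hfk) fun x hx => ?_
    refine ⟨dirDeriv v x f.jacobianDet / dirDeriv v k f.jacobianDet, ?_⟩
    rw [hMk] at hx
    rw [← sub_eq_zero]
    have hlin : ∀ (a : F) g, dirDeriv v (x - a • k) g = dirDeriv v x g - a * dirDeriv v k g := by
      intro a g
      rw [sub_eq_add_neg, ← neg_smul, dirDeriv_add_dir, dirDeriv_smul_dir]
      ring
    refine h.2 _ (fun i => ?_) ?_
    · rw [hlin, hx, hfk, mul_zero, sub_zero]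
    · rw [hlin, div_mul_cancel₀ _ hJk, sub_self]
  obtain ⟨j, i, hji⟩ : ∃ j i, M.adjugate j i ≠ 0 := by
    by_contra! hcon
    exact hadj (Matrix.ext hcon)
  refine ⟨i, fun hJ => hji ?_⟩
  have h0 := h.2 _ ((hMk (fun j => M.adjugate j i)).mp ?_) hJ
  · exact congrFun h0 j
  · have hdet : M.det = 0 := by rw [← f.eval_jacobianDet v, h.1]
    have := M.mul_adjugate
    rw [hdet, zero_smul] at this
    ext l
    exact congrFun (congrFun this l) i

/-- The chain rule for `t ∘ f`, multiplied by the adjugate of the Jacobian matrix. -/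
theorem jacobianDet_mul_bind₁_pderiv (t : MvPolynomial (Fin (n + 1)) F) (i : Fin (n + 1)) :
    f.jacobianDet * bind₁ f.coords (pderiv i t) = ∑ j, pderiv j (bind₁ f.coords t) *
      (Matrix.of fun i j => pderiv j (f.coords i)).adjugate j i := by
  set M := Matrix.of fun i j => pderiv j (f.coords i) with hM
  have h1 : Matrix.vecMul (fun i => bind₁ f.coords (pderiv i t)) M =
      fun j => pderiv j (bind₁ f.coords t) := by
    ext1 j
    rw [pderiv_bind₁]
    rfl
  have h2 := congrArg (fun a => Matrix.vecMul a M.adjugate i) h1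
  simp only [Matrix.vecMul_vecMul, M.mul_adjugate, Matrix.vecMul_smul, Matrix.vecMul_one] at h2
  exact h2

/-- At a simple fold the ramification index of the critical divisor is two. -/
theorem exists_bind₁_eq_mul_sq {v : Fin (n + 1) → F} (hfold : f.IsFoldAt v)
    {s c t : MvPolynomial (Fin (n + 1)) F} (hs : Prime s) (hJ : f.jacobianDet = s * c)
    (hsv : eval v s = 0) (hst : s ∣ bind₁ f.coords t) {k : Fin (n + 1) → F}
    (ht : dirDeriv (fun i => eval v (f.coords i)) k t ≠ 0) :
    ∃ u, bind₁ f.coords t = u * s ^ 2 ∧ ¬ s ∣ u := by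
  have hsc : ¬ s ∣ c := by
    rintro ⟨b, rfl⟩
    obtain ⟨k, -, hk⟩ := hfold.exists_dirDeriv_jacobianDet_ne_zero
    rw [hJ] at hk
    refine (eval_ne_zero_of_dirDeriv_mul_ne_zero hsv hk).1 ?_
    rw [map_mul, hsv, zero_mul]
  set M := Matrix.of fun i j => pderiv j (f.coords i) with hM
  have hb : ∃ i, ¬ s ∣ ∑ j, pderiv j s * M.adjugate j i := by
    obtain ⟨i, hi⟩ := hfold.exists_adjugate_ne_zero
    refine ⟨i, fun ⟨b, hb⟩ => ?_⟩
    rw [hJ] at hi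
    refine (eval_ne_zero_of_dirDeriv_mul_ne_zero hsv hi).2 ?_
    have hb' := congrArg (eval v) hb
    rw [map_mul, hsv, zero_mul, map_sum] at hb'
    rw [← hb', dirDeriv]
    refine Finset.sum_congr rfl fun j _ => ?_
    rw [map_mul, mul_comm]
    congr 1
    have := congrFun (congrFun ((eval v).map_adjugate M) j) i
    exact this.symm
  obtain ⟨u₀, hu₀⟩ := hst
  -- With `t ∘ f = s u₀`, the identity reads modulo `s`: `u₀` times the derivative of `s` along a
  -- column of the adjugate is 0. That derivative is not divisible by the prime `s`.
  have hu : s ∣ u₀ := by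
    obtain ⟨i, hi⟩ := hb
    refine (hs.dvd_or_dvd ?_).resolve_right hi
    have h := f.jacobianDet_mul_bind₁_pderiv t i
    simp only [hu₀, Derivation.leibniz, smul_eq_mul, add_mul, Finset.sum_add_distrib] at h
    rw [hJ] at h
    rw [Finset.mul_sum]
    refine (Dvd.intro (c * bind₁ f.coords (pderiv i t) - ∑ j, pderiv j u₀ * M.adjugate j i) ?_)
    rw [mul_sub, ← mul_assoc, h, Finset.mul_sum]
    simp only [mul_assoc]
    ring
  obtain ⟨u, rfl⟩ := hu
  refine ⟨u, by rw [hu₀]; ring, ?_⟩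
  rintro ⟨u, rfl⟩
  -- If `s ^ 3` divided `t ∘ f`, then `s ^ 2` would divide its partial derivatives. As `s` divides
  -- `J` only once, the pulled-back gradient of `t` would be divisible by `s` and vanish at `v`.
  have hall : ∀ i, s ∣ bind₁ f.coords (pderiv i t) := by
    intro i
    refine (hs.dvd_or_dvd ?_).resolve_left hsc
    have h := f.jacobianDet_mul_bind₁_pderiv t i
    have hs2 : s * s ∣ s * (c * bind₁ f.coords (pderiv i t)) := by
      rw [← mul_assoc, ← hJ, h]
      refine Finset.dvd_sum fun j _ => Dvd.dvd.mul_right ?_ _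
      rw [hu₀]
      refine ⟨3 * pderiv j s * u + s * pderiv j u, ?_⟩
      simp only [Derivation.leibniz, smul_eq_mul]
      ring
    exact (mul_dvd_mul_iff_left hs.ne_zero).mp hs2
  refine ht (Finset.sum_eq_zero fun i _ => ?_)
  obtain ⟨b, hb⟩ := hall i
  have := congrArg (eval v) hb
  rw [eval_bind₁, map_mul, hsv, zero_mul] at this
  rw [this, mul_zero]

/-- All forms of degree `d` take the same values at `x` and `x'`, and the forms `X i ^ (d - 1) * X
l` determine the point. -/
theorem mk_eq_mk_of_forall_exists {e : MvPolynomial (Fin (n + 1)) F}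
    (he : ∀ g : MvPolynomial (Fin (n + 1)) F, g.IsHomogeneous d →
      ∃ a, f.jacobianDet ∣ bind₁ f.coords e * g - bind₁ f.coords a)
    {x x' : Fin (n + 1) → F} (hx : x ≠ 0) (hx' : x' ≠ 0) (hd : d ≠ 0)
    (hJ : eval x f.jacobianDet = 0) (hJ' : eval x' f.jacobianDet = 0)
    (hxx : (fun i => eval x (f.coords i)) = fun i => eval x' (f.coords i))
    (hex : eval (fun i => eval x (f.coords i)) e ≠ 0) :
    Projectivization.mk F x hx = Projectivization.mk F x' hx' := by
  have hg : ∀ g : MvPolynomial (Fin (n + 1)) F, g.IsHomogeneous d → eval x g = eval x' g := by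
    intro g hg
    obtain ⟨a, b, hab⟩ := he g hg
    have h1 := congrArg (eval x) hab
    have h2 := congrArg (eval x') hab
    simp only [map_sub, map_mul, eval_bind₁, hJ, hJ', zero_mul] at h1 h2
    rw [← hxx, ← h1] at h2
    exact mul_left_cancel₀ hex (sub_left_injective h2).symm
  obtain ⟨i, hi⟩ := Function.ne_iff.mp hx
  obtain ⟨m, rfl⟩ := Nat.exists_eq_succ_of_ne_zero hd
  have hm : ∀ l, x i ^ m * x l = x' i ^ m * x' l := fun l => by
    have h := ((isHomogeneous_X F i).pow m).mul (isHomogeneous_X F l)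
    rw [one_mul] at h
    simpa using hg _ h
  have hi' : x i ^ m ≠ 0 := pow_ne_zero _ hi
  rw [Projectivization.mk_eq_mk_iff']
  refine ⟨x' i ^ m / x i ^ m, ?_⟩
  ext l
  rw [Pi.smul_apply, smul_eq_mul, div_mul_eq_mul_div, ← hm, mul_div_cancel_left₀ _ hi']

theorem isGenericallyOneToOne_of_forall_exists [IsAlgClosed F] (hd : d ≠ 0)
    {e : MvPolynomial (Fin (n + 1)) F}
    (he : ∀ g : MvPolynomial (Fin (n + 1)) F, g.IsHomogeneous d →
      ∃ a, f.jacobianDet ∣ bind₁ f.coords e * g - bind₁ f.coords a)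
    {C : Set (ProjSpace F n)} (hC : C ⊆ f.critLocus) {p : ProjSpace F n} (hp : p ∈ C)
    (hep : eval (fun i => eval p.rep (f.coords i)) e ≠ 0) :
    f.IsGenericallyOneToOne C (f.toFun '' C) := by
  have : Infinite F := IsAlgClosed.instInfinite
  obtain ⟨N, hN⟩ := f.exists_isHomogeneous_jacobianDet
  -- `e` need not be homogeneous. Some component of `e` is nonzero at a point exactly when `e` is
  -- nonzero at some representative of it.
  refine ⟨(projZeroLocus (Set.range fun m => homogeneousComponent m e))ᶜ, ?_, ?_, ?_⟩
  · rw [isOpen_compl_iff]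
    refine isClosed_projZeroLocus ?_
    rintro _ ⟨m, rfl⟩
    exact ⟨m, homogeneousComponent_isHomogeneous m e⟩
  · refine ⟨f.toFun p, fun hmem => hep ?_, p, hp, rfl⟩
    rw [← sum_homogeneousComponent e, map_sum]
    refine Finset.sum_eq_zero fun m _ => ?_
    exact (eval_rep_mk (homogeneousComponent_isHomogeneous m e) _ (f.eval_rep_ne_zero p)).mp
      (hmem _ ⟨m, rfl⟩)
  · rintro y ⟨hy, x, hx, hxy⟩
    obtain ⟨r, hr, hry, hre⟩ : ∃ (r : Fin (n + 1) → F) (hr : r ≠ 0),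
        Projectivization.mk F r hr = y ∧ eval r e ≠ 0 := by
      by_contra! hcon
      refine hy ?_
      rintro _ ⟨m, rfl⟩
      have he' : e ∈ projIdeal ({y} : Set (ProjSpace F n)) := mem_projIdeal.mpr hcon
      exact (mem_projIdeal_of_isHomogeneous (homogeneousComponent_isHomogeneous m e)).mp
        (homogeneousComponent_mem_projIdeal he' m) y rfl
    refine ⟨x, ⟨hx, hxy⟩, ?_⟩
    rintro x' ⟨hx', hxy'⟩
    subst hry
    obtain ⟨v, hv, rfl, hvr⟩ := f.exists_lift hd hr hxy
    obtain ⟨v', hv', rfl, hvr'⟩ := f.exists_lift hd hr hxy'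
    have hcrit : ∀ v (hv : v ≠ 0), Projectivization.mk F v hv ∈ C → eval v f.jacobianDet = 0 :=
      fun v hv h => (eval_rep_mk hN v hv).mp (mem_projZeroLocus_singleton.mp (hC h))
    exact f.mk_eq_mk_of_forall_exists he hv' hv hd (hcrit _ _ hx') (hcrit _ _ hx)
      (hvr'.trans hvr.symm) (by rwa [hvr'])

/-- The behaviour of `f` along its critical and branch loci at an isolated fold. -/
theorem IsIsolatedFold.components [IsAlgClosed F] [CharZero F] {f : ProjMorphism F n d}
    (hd : d ≠ 0) {p : ProjSpace F n} (hp : f.IsIsolatedFold p) :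
    IsSmoothPointOf f.branchLocus (f.toFun p) ∧
      ∃ B ∈ componentsOf f.branchLocus, f.toFun p ∈ B ∧
        (∀ B' ∈ componentsOf f.branchLocus, f.toFun p ∈ B' → B' = B) ∧
        ∃ C ∈ componentsOf f.critLocus, f.toFun '' C = B ∧
          (∀ C' ∈ componentsOf f.critLocus, f.toFun '' C' = B → C' = C) ∧
          f.IsGenericallyOneToOne C B ∧ f.HasMultiplicityAlong C B 2 := by
  have : NeZero d := ⟨hd⟩
  have : Infinite F := IsAlgClosed.instInfinite
  have hfold := hp.1
  obtain ⟨N, hJ⟩ := f.exists_isHomogeneous_jacobianDet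
  obtain ⟨k, -, hJk⟩ := hfold.exists_dirDeriv_jacobianDet_ne_zero
  have hJ0 : f.jacobianDet ≠ 0 := by
    intro h
    rw [h] at hJk
    simp [dirDeriv] at hJk
  have hpJ : p ∈ projZeroLocus {f.jacobianDet} := mem_projZeroLocus_singleton.mpr hfold.1
  obtain ⟨t, e, hew, hJt, ⟨l, hlt⟩, he⟩ :=
    f.exists_smooth_hypersurface hfold (hp.eq_smul hd)
  set w : Fin (n + 1) → F := fun i => eval p.rep (f.coords i) with hw
  have hw0 : w ≠ 0 := f.eval_rep_ne_zero p
  have hqw : f.toFun p = Projectivization.mk F w hw0 := rfl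
  obtain ⟨T, hT0, ⟨b, hT⟩, hTV, hTI⟩ := f.exists_image_eq_projZeroLocus hd hJ0 hJ ⟨p, hpJ⟩
  have hTw : eval w T = 0 := by
    have h : f.toFun p ∈ projZeroLocus {T} := hTV ▸ Set.mem_image_of_mem _ hpJ
    exact (eval_rep_mk hT w hw0).mp (mem_projZeroLocus_singleton.mp h)
  have hTt : T ∣ t := by
    rw [← Ideal.mem_span_singleton, ← hTI, f.mem_projIdeal_image_iff hd,
      mem_projIdeal_projZeroLocus_iff hJ ⟨p, hpJ⟩]
    exact ⟨1, by rwa [pow_one]⟩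
  -- `T` vanishes at `w` and divides `t`, so it inherits the nonzero differential; its factor `S`,
  -- the equation of `B`, does so in turn.
  have hlT : dirDeriv w l T ≠ 0 := by
    obtain ⟨c, rfl⟩ := hTt
    exact (eval_ne_zero_of_dirDeriv_mul_ne_zero hTw hlt).2
  have hlTq : dirDeriv (f.toFun p).rep l T ≠ 0 := by
    obtain ⟨a, ha⟩ := Projectivization.exists_smul_eq_mk_rep F w hw0
    rw [hqw, ← ha, show a • w = (a : F) • w from rfl, hT.dirDeriv_smul]
    exact mul_ne_zero (pow_ne_zero _ a.ne_zero) hlT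
  obtain ⟨s, hs, hsJ, hsp⟩ := exists_irreducible_dvd_mem
    (P := vanishingIdeal F {p.rep}) inferInstance hJ0 (mem_vanishingIdeal_singleton.mpr hfold.1)
  rw [mem_vanishingIdeal_singleton] at hsp
  have hpC : p ∈ projZeroLocus {s} := mem_projZeroLocus_singleton.mpr hsp
  obtain ⟨m, hsm⟩ := exists_isHomogeneous_of_irreducible_dvd hs hJ0 hJ hsJ
  have hCI := projIdeal_projZeroLocus_eq_span hsm hs ⟨p, hpC⟩
  obtain ⟨S, hS0, ⟨b', hS⟩, hSV, hSI⟩ := f.exists_image_eq_projZeroLocus hd hs.ne_zero hsm ⟨p, hpC⟩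
  have hSirr : Irreducible S := by
    have hprime : (Ideal.span {S}).IsPrime := by
      have : projIdeal (f.toFun '' projZeroLocus {s}) =
          (projIdeal (projZeroLocus {s})).comap (bind₁ f.coords) :=
        Ideal.ext fun g => f.mem_projIdeal_image_iff hd
      rw [← hSI, this]
      have := projIdeal_isPrime (isIrreducible_projZeroLocus hsm hs ⟨p, hpC⟩)
      exact Ideal.comap_isPrime _ _
    exact ((Ideal.span_singleton_prime hS0).mp hprime).irreducible
  have hqB : f.toFun p ∈ projZeroLocus {S} := hSV ▸ Set.mem_image_of_mem _ hpC
  have hSw : eval w S = 0 := (eval_rep_mk hS w hw0).mp (mem_projZeroLocus_singleton.mp hqB)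
  have hST : S ∣ T := by
    rw [← Ideal.mem_span_singleton, ← hSI, mem_projIdeal]
    intro v hv hvB
    have hT' : T ∈ projIdeal (f.toFun '' projZeroLocus {f.jacobianDet}) :=
      hTI ▸ Ideal.mem_span_singleton_self T
    exact mem_projIdeal.mp hT' v hv (Set.image_mono (projZeroLocus_anti_of_dvd hsJ) hvB)
  have hlS : dirDeriv w l S ≠ 0 := by
    obtain ⟨c, rfl⟩ := hST
    exact (eval_ne_zero_of_dirDeriv_mul_ne_zero hSw hlT).2
  have hbranch : f.branchLocus = projZeroLocus {T} := hTV
  refine ⟨isSmoothPointOf_of_dirDeriv_ne_zero hT hTI (Set.mem_image_of_mem _ hpJ) hlTq,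
    projZeroLocus {S}, ?_, hqB, ?_, projZeroLocus {s},
    projZeroLocus_mem_componentsOf hJ0 hJ hs hsJ ⟨p, hpC⟩, hSV, ?_, ?_, ?_⟩
  · rw [hbranch]
    exact projZeroLocus_mem_componentsOf hT0 hT hSirr hST ⟨_, hqB⟩
  · intro B' hB' hqB'
    rw [hbranch] at hB'
    obtain ⟨S', hS', hST', -, rfl⟩ := exists_eq_of_mem_componentsOf hT0 hT hB'
    exact projZeroLocus_eq_of_associated (associated_of_dvd_of_dirDeriv_ne_zero hlTq hS' hST'
      (mem_projZeroLocus_singleton.mp hqB') hSirr hST (mem_projZeroLocus_singleton.mp hqB))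
  · intro C' hC' hCB
    obtain ⟨s', hs', hsJ', -, rfl⟩ := exists_eq_of_mem_componentsOf hJ0 hJ hC'
    -- `C'` has a point over `f p`. That point is critical, hence `p`, and only one factor of `J`
    -- vanishes at `p`.
    rw [← hCB] at hqB
    obtain ⟨x, hx, hxp⟩ := hqB
    have hxJ := mem_projZeroLocus_singleton.mp (projZeroLocus_anti_of_dvd hsJ' hx)
    rw [hp.2 x hxp hxJ] at hx
    exact projZeroLocus_eq_of_associated (associated_of_dvd_of_dirDeriv_ne_zero hJk hs' hsJ'
      (mem_projZeroLocus_singleton.mp hx) hs hsJ hsp)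
  · rw [← hSV]
    exact f.isGenericallyOneToOne_of_forall_exists hd he (projZeroLocus_anti_of_dvd hsJ) hpC hew
  · have hsS : s ∣ bind₁ f.coords S := by
      rw [← Ideal.mem_span_singleton, ← hCI, ← f.mem_projIdeal_image_iff hd, hSI]
      exact Ideal.mem_span_singleton_self S
    obtain ⟨c, hc⟩ := hsJ
    obtain ⟨u, hu, hsu⟩ := f.exists_bind₁_eq_mul_sq hfold hs.prime hc hsp hsS hlS
    exact ⟨s, S, u, hCI, hSV ▸ hSI, hu, by rwa [hCI, Ideal.mem_span_singleton]⟩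

end ProjMorphism

/-! ### The example whose coordinates are products of linear forms -/

namespace MvPolynomial

variable {F : Type*} [Field F] {σ : Type*} [Fintype σ]

theorem dirDeriv_prod_of_eval_eq_zero {ι : Type*} [DecidableEq ι] {s : Finset ι}
    {g : ι → MvPolynomial σ F} {j : ι} (hj : j ∈ s) {v : σ → F} (hg : eval v (g j) = 0)
    (k : σ → F) :
    dirDeriv v k (∏ i ∈ s, g i) = (∏ i ∈ s.erase j, eval v (g i)) * dirDeriv v k (g j) := by
  rw [← Finset.mul_prod_erase s g hj, dirDeriv_mul, hg, zero_mul, zero_add, map_prod]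

theorem dirDeriv_X_pow [DecidableEq σ] (v k : σ → F) (i : σ) (m : ℕ) :
    dirDeriv v k (X i ^ m) = m * v i ^ (m - 1) * k i := by
  rw [dirDeriv, Finset.sum_eq_single i]
  · simp
    ring
  · intro j _ hj
    simp [pderiv_X_of_ne hj.symm]
  · simp

end MvPolynomial

section

variable {F : Type*} [Field F] {n : ℕ}

theorem mk_eq_mk_iff_of_apply_eq_one {v w : Fin (n + 1) → F} {hv : v ≠ 0} {hw : w ≠ 0}
    (hv0 : v 0 = 1) (hw0 : w 0 = 1) :
    Projectivization.mk F v hv = Projectivization.mk F w hw ↔ v = w := by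
  rw [Projectivization.mk_eq_mk_iff']
  constructor
  · rintro ⟨c, hc⟩
    have := congrFun hc 0
    rw [Pi.smul_apply, hv0, hw0, smul_eq_mul, mul_one] at this
    rw [← hc, this, one_smul]
  · rintro rfl
    exact ⟨1, one_smul _ _⟩

theorem algebraMap_mem_map_of_mul_mem {I : Ideal (MvPolynomial (Fin (n + 1)) F)}
    {v : Fin (n + 1) → F} {g h : MvPolynomial (Fin (n + 1)) F} (hgh : g * h ∈ I)
    (hh : eval v h ≠ 0) :
    algebraMap _ (Localization.AtPrime (vanishingIdeal F {v})) g ∈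
      I.map (algebraMap _ (Localization.AtPrime (vanishingIdeal F {v}))) := by
  have hu : IsUnit (algebraMap _ (Localization.AtPrime (vanishingIdeal F {v})) h) :=
    IsLocalization.map_units (M := (vanishingIdeal F {v}).primeCompl) _
      ⟨h, fun hm => hh (mem_vanishingIdeal_singleton.mp hm)⟩
  rw [← Ideal.mul_unit_mem_iff_mem _ hu, ← map_mul]
  exact Ideal.mem_map_of_mem _ hgh

end

namespace FoldExample

section

variable {F : Type*} [Field F] {n : ℕ}

/-- The vector `(1, 0, …, 0)`. -/
def base (F : Type*) [Field F] (n : ℕ) : Fin (n + 1) → F := Pi.single 0 1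

@[simp]
theorem base_zero : base F n 0 = 1 := by simp [base]

@[simp]
theorem base_succ (i : Fin n) : base F n i.succ = 0 := by simp [base]

theorem base_ne_zero : base F n ≠ 0 := fun h => one_ne_zero ((base_zero (F := F)).symm.trans
  (congrFun h 0))

end

variable (F : Type*) [Field F] {n : ℕ} [NeZero n]

/-- The `j`-th linear factor of the coordinate `i + 1`. -/
noncomputable def linForm (i : Fin n) (j : ℕ) : MvPolynomial (Fin (n + 1)) F :=
  -- A repeated factor `X (Fin.succ 0)` would produce double points all along that hyperplane.
  -- Adding the other variables separates the two factors except where those variables vanish.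
  if i = 0 ∧ j = 1 then X i.succ + ∑ l ∈ Finset.univ.erase (0 : Fin n), X l.succ
  else X i.succ - C (j : F) * X 0

variable {F}

theorem isHomogeneous_linForm (i : Fin n) (j : ℕ) : (linForm F i j).IsHomogeneous 1 := by
  rw [linForm]
  split_ifs
  · exact (isHomogeneous_X F _).add (IsHomogeneous.sum _ _ _ fun l _ => isHomogeneous_X F _)
  · refine (isHomogeneous_X F _).sub ?_
    simpa using (isHomogeneous_C _ (j : F)).mul (isHomogeneous_X F (0 : Fin (n + 1)))

theorem eval_linForm (v : Fin (n + 1) → F) (i : Fin n) (j : ℕ) :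
    eval v (linForm F i j) = if i = 0 ∧ j = 1 then
      v i.succ + ∑ l ∈ Finset.univ.erase (0 : Fin n), v l.succ else v i.succ - j * v 0 := by
  rw [linForm]
  split_ifs <;> simp

theorem dirDeriv_linForm (v k : Fin (n + 1) → F) (i : Fin n) (j : ℕ) :
    dirDeriv v k (linForm F i j) = if i = 0 ∧ j = 1 then
      k i.succ + ∑ l ∈ Finset.univ.erase (0 : Fin n), k l.succ else k i.succ - j * k 0 := by
  rw [linForm]
  split_ifs
  · rw [dirDeriv_add, dirDeriv_X, dirDeriv_sum]
    simp only [dirDeriv_X]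
  · rw [dirDeriv_sub, dirDeriv_C_mul, dirDeriv_X, dirDeriv_X]

/-- The linear factors of the coordinates. -/
noncomputable def factor (d : ℕ) (i : Fin (n + 1)) (j : Fin d) : MvPolynomial (Fin (n + 1)) F :=
  Fin.cases (X 0) (fun i => linForm F i j) i

theorem isHomogeneous_factor (d : ℕ) (i : Fin (n + 1)) (j : Fin d) :
    (factor (F := F) d i j).IsHomogeneous 1 := by
  cases i using Fin.cases with
  | zero => exact isHomogeneous_X F _
  | succ i => exact isHomogeneous_linForm i j

/-- A morphism with a single critical point, a simple fold, over `[1 : 0 : ⋯ : 0]`. -/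
noncomputable def morphism (F : Type*) [Field F] (n d : ℕ) [NeZero n] [NeZero d] :
    ProjMorphism F n d where
  coords i := ∏ j, factor d i j
  isHomogeneous i := by
    simpa using IsHomogeneous.prod Finset.univ _ (fun _ => 1) fun j _ =>
      isHomogeneous_factor (F := F) d i j
  eq_zero_of_common_zero v hv := by
    have h0 : v 0 = 0 := by
      have := hv 0
      rw [map_prod] at this
      obtain ⟨j, -, hj⟩ := Finset.prod_eq_zero_iff.mp this
      simpa [factor] using hj
    have h : ∀ i : Fin n, ∃ j : ℕ, eval v (linForm F i j) = 0 := fun i => by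
      have := hv i.succ
      rw [map_prod] at this
      obtain ⟨j, -, hj⟩ := Finset.prod_eq_zero_iff.mp this
      exact ⟨j, hj⟩
    have h1 : ∀ i : Fin n, i ≠ 0 → v i.succ = 0 := fun i hi => by
      obtain ⟨j, hj⟩ := h i
      simpa [eval_linForm, hi, h0] using hj
    ext i
    cases i using Fin.cases with
    | zero => exact h0
    | succ i =>
      by_cases hi : i = 0
      · subst hi
        obtain ⟨j, hj⟩ := h 0
        rw [eval_linForm, h0, Finset.sum_eq_zero fun l hl => h1 l (Finset.ne_of_mem_erase hl)] at hj
        simpa using hj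
      · exact h1 i hi

variable {d : ℕ}

/-- The points of the fibre over `[1 : 0 : ⋯ : 0]`. -/
def fibreVec (F : Type*) [Field F] {n d : ℕ} [NeZero n] (c : Fin n → Fin d) : Fin (n + 1) → F :=
  Fin.cons 1 fun i => if i = 0 ∧ (c 0 : ℕ) = 1 then
    -∑ l ∈ Finset.univ.erase (0 : Fin n), ((c l : ℕ) : F) else ((c i : ℕ) : F)

@[simp]
theorem fibreVec_zero (c : Fin n → Fin d) : fibreVec F c 0 = 1 := rfl

theorem fibreVec_succ (c : Fin n → Fin d) (i : Fin n) :
    fibreVec F c i.succ = if i = 0 ∧ (c 0 : ℕ) = 1 then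
      -∑ l ∈ Finset.univ.erase (0 : Fin n), ((c l : ℕ) : F) else ((c i : ℕ) : F) := rfl

theorem fibreVec_succ_of_ne (c : Fin n → Fin d) {i : Fin n} (hi : i ≠ 0) :
    fibreVec F c i.succ = ((c i : ℕ) : F) := by
  simp [fibreVec_succ, hi]

theorem fibreVec_ne_zero (c : Fin n → Fin d) : fibreVec F c ≠ 0 :=
  fun h => one_ne_zero (congrFun h 0)

theorem sum_fibreVec (c : Fin n → Fin d) :
    ∑ l ∈ Finset.univ.erase (0 : Fin n), fibreVec F c l.succ =
      ∑ l ∈ Finset.univ.erase (0 : Fin n), ((c l : ℕ) : F) :=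
  Finset.sum_congr rfl fun _ hl => fibreVec_succ_of_ne c (Finset.ne_of_mem_erase hl)

theorem eval_fibreVec_linForm (c : Fin n → Fin d) (i : Fin n) :
    eval (fibreVec F c) (linForm F i (c i)) = 0 := by
  rw [eval_linForm, sum_fibreVec, fibreVec_succ, fibreVec_zero]
  by_cases hi : i = 0
  · subst hi
    split_ifs with h1 <;> simp_all
  · simp [hi]

theorem eq_fibreVec {v : Fin (n + 1) → F} (h0 : v 0 = 1) {c : Fin n → Fin d}
    (h : ∀ i, eval v (linForm F i (c i)) = 0) : v = fibreVec F c := by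
  have h1 : ∀ i : Fin n, i ≠ 0 → v i.succ = ((c i : ℕ) : F) := fun i hi => by
    have := h i
    rw [eval_linForm, if_neg (by simp [hi]), h0, mul_one, sub_eq_zero] at this
    exact this
  ext i
  cases i using Fin.cases with
  | zero => rw [h0, fibreVec_zero]
  | succ i =>
    by_cases hi : i = 0
    · subst hi
      have h2 := h 0
      rw [eval_linForm, Finset.sum_congr rfl fun l hl => h1 l (Finset.ne_of_mem_erase hl), h0,
        mul_one] at h2
      rw [fibreVec_succ]
      split_ifs at h2 ⊢ <;> simp_all <;> linear_combination h2
    · rw [h1 i hi, fibreVec_succ_of_ne c hi]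

/-- An unexpected zero would be a vanishing sum of natural numbers. In characteristic 0 all of them
are then 0, and the point is `base`. -/
theorem eval_fibreVec_linForm_eq_zero_iff [CharZero F] {c : Fin n → Fin d}
    (hc : fibreVec F c ≠ base F n) {i : Fin n} {j : ℕ} :
    eval (fibreVec F c) (linForm F i j) = 0 ↔ j = c i := by
  refine ⟨fun h => ?_, fun h => h ▸ eval_fibreVec_linForm c i⟩
  rw [eval_linForm, sum_fibreVec, fibreVec_succ, fibreVec_zero, mul_one, ← Nat.cast_sum] at h
  by_cases hi : i = 0
  · subst hi
    have hsum : ∀ l, l ≠ 0 → ∑ l ∈ Finset.univ.erase (0 : Fin n), (c l : ℕ) = 0 →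
        (c l : ℕ) = 0 := fun l hl h =>
      Finset.sum_eq_zero_iff.mp h l (Finset.mem_erase.mpr ⟨hl, Finset.mem_univ l⟩)
    have hne : ∑ l ∈ Finset.univ.erase (0 : Fin n), (c l : ℕ) = 0 →
        fibreVec F c (Fin.succ 0) ≠ 0 := by
      intro hs h0
      refine hc (funext fun i => ?_)
      cases i using Fin.cases with
      | zero => simp
      | succ i =>
        by_cases hi : i = 0
        · rw [hi, h0, base_succ]
        · rw [fibreVec_succ_of_ne c hi, hsum i hi hs, base_succ, Nat.cast_zero]
    rw [fibreVec_succ, ← Nat.cast_sum] at hne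
    set s := ∑ l ∈ Finset.univ.erase (0 : Fin n), (c l : ℕ) with hs
    by_cases hj : j = 1 <;> by_cases hc1 : (c 0 : ℕ) = 1 <;> simp only [hj, hc1, and_self,
      and_false, if_true, if_false] at h hne ⊢
    · exfalso
      have h' : ((c 0 + s : ℕ) : F) = 0 := by push_cast; exact h
      have h2 := Nat.cast_eq_zero.mp h'
      exact hne (by omega) (by rw [show (c 0 : ℕ) = 0 by omega, Nat.cast_zero])
    · exfalso
      have h' : ((s + j : ℕ) : F) = 0 := by push_cast; linear_combination -h
      have h2 := Nat.cast_eq_zero.mp h'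
      exact hne (by omega) (by rw [show s = 0 by omega, Nat.cast_zero, neg_zero])
    · rw [sub_eq_zero] at h
      exact (Nat.cast_injective h).symm
  · simp only [hi, false_and, if_false, sub_eq_zero] at h
    exact (Nat.cast_injective h).symm

variable [NeZero d]

theorem coords_zero : (morphism F n d).coords 0 = X 0 ^ d := by
  simp [morphism, factor]

theorem coords_succ (i : Fin n) : (morphism F n d).coords i.succ = ∏ j : Fin d, linForm F i j :=
  rfl

theorem exists_fibreVec {v : Fin (n + 1) → F} (h0 : v 0 = 1)
    (h : ∀ i : Fin n, eval v ((morphism F n d).coords i.succ) = 0) :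
    ∃ c : Fin n → Fin d, v = fibreVec F c := by
  have h' : ∀ i : Fin n, ∃ j : Fin d, eval v (linForm F i j) = 0 := fun i => by
    have := h i
    rw [coords_succ, map_prod] at this
    obtain ⟨j, -, hj⟩ := Finset.prod_eq_zero_iff.mp this
    exact ⟨j, hj⟩
  choose c hc using h'
  exact ⟨c, eq_fibreVec h0 hc⟩

theorem eval_fibreVec_coords_succ (c : Fin n → Fin d) (i : Fin n) :
    eval (fibreVec F c) ((morphism F n d).coords i.succ) = 0 := by
  rw [coords_succ, map_prod]
  exact Finset.prod_eq_zero (Finset.mem_univ (c i)) (eval_fibreVec_linForm c i)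

/-- Exactly one linear factor of each coordinate after the first vanishes here, so a kernel vector
is killed by all these factors. With `k 0 = 0` this is a triangular linear system. -/
theorem eval_jacobianDet_fibreVec_ne_zero [CharZero F] {c : Fin n → Fin d}
    (hc : fibreVec F c ≠ base F n) : eval (fibreVec F c) (morphism F n d).jacobianDet ≠ 0 := by
  intro hJ
  obtain ⟨k, hk0, hk⟩ := ((morphism F n d).eval_jacobianDet_eq_zero_iff _).mp hJ
  have h0 : k 0 = 0 := by
    have := hk 0
    rw [coords_zero, dirDeriv_X_pow, fibreVec_zero, one_pow, mul_one] at this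
    exact (mul_eq_zero.mp this).resolve_left (Nat.cast_ne_zero.mpr (NeZero.ne d))
  have h : ∀ i, dirDeriv (fibreVec F c) k (linForm F i (c i)) = 0 := fun i => by
    have := hk i.succ
    rw [coords_succ, dirDeriv_prod_of_eval_eq_zero (Finset.mem_univ (c i))
      (eval_fibreVec_linForm c i)] at this
    refine (mul_eq_zero.mp this).resolve_left (Finset.prod_ne_zero_iff.mpr fun j hj hz => ?_)
    exact Finset.ne_of_mem_erase hj (Fin.ext ((eval_fibreVec_linForm_eq_zero_iff hc).mp hz))
  have h1 : ∀ i : Fin n, i ≠ 0 → k i.succ = 0 := fun i hi => by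
    simpa [dirDeriv_linForm, hi, h0] using h i
  refine hk0 (funext fun i => ?_)
  cases i using Fin.cases with
  | zero => exact h0
  | succ i =>
    by_cases hi : i = 0
    · subst hi
      have h2 := h 0
      rw [dirDeriv_linForm, h0,
        Finset.sum_eq_zero fun l hl => h1 l (Finset.ne_of_mem_erase hl)] at h2
      simpa using h2
    · exact h1 i hi

end FoldExample

/-- Expanding `z = c + y x` and then `y = c' + y' x` modulo `I` shows that `1` and `x` span the
quotient. -/
theorem finrank_quotient_le_two {F R : Type*} [Field F] [CommRing R] [IsLocalRing R] [Algebra F R]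
    (h : ∀ z : R, ∃ c : F, z - algebraMap F R c ∈ IsLocalRing.maximalIdeal R) {I : Ideal R}
    (hI : I ≠ ⊤) {x : R} (hx : x * x ∈ I) (hmax : IsLocalRing.maximalIdeal R ≤ I ⊔ Ideal.span {x}) :
    0 < Module.finrank F (R ⧸ I) ∧ Module.finrank F (R ⧸ I) ≤ 2 := by
  have hstep : ∀ z : R, ∃ (c : F) (y : R), z - algebraMap F R c - y * x ∈ I := fun z => by
    obtain ⟨c, hc⟩ := h z
    obtain ⟨b, hb, m, hm, hbm⟩ := Submodule.mem_sup.mp (hmax hc)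
    obtain ⟨y, rfl⟩ := Ideal.mem_span_singleton'.mp hm
    exact ⟨c, y, by rwa [← hbm, add_sub_cancel_right]⟩
  let g : Fin 2 → R ⧸ I := ![1, Ideal.Quotient.mk I x]
  have hspan : ⊤ ≤ Submodule.span F (Set.range g) := by
    intro w _
    obtain ⟨z, rfl⟩ := Ideal.Quotient.mk_surjective w
    obtain ⟨c, y, hc⟩ := hstep z
    obtain ⟨c', y', hc'⟩ := hstep y
    have hz : Ideal.Quotient.mk I z = c • g 0 + c' • g 1 := by
      have h1 : c • g 0 + c' • g 1 = Ideal.Quotient.mk I (algebraMap F R c + algebraMap F R c' * x) := by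
        rw [map_add, map_mul, Algebra.smul_def, Algebra.smul_def]
        simp only [g, Matrix.cons_val_zero, Matrix.cons_val_one, mul_one]
        rfl
      rw [h1, Ideal.Quotient.eq]
      have h2 : z - (algebraMap F R c + algebraMap F R c' * x) =
          (z - algebraMap F R c - y * x) + x * (y - algebraMap F R c' - y' * x) + y' * (x * x) := by
        ring
      rw [h2]
      exact I.add_mem (I.add_mem hc (I.mul_mem_left _ hc')) (I.mul_mem_left _ hx)
    rw [hz]
    exact Submodule.add_mem _ (Submodule.smul_mem _ _ (Submodule.subset_span ⟨0, rfl⟩))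
      (Submodule.smul_mem _ _ (Submodule.subset_span ⟨1, rfl⟩))
  have : Nontrivial (R ⧸ I) := Ideal.Quotient.nontrivial_iff.mpr hI
  have : Module.Finite F (R ⧸ I) :=
    .of_fg_top (top_le_iff.mp hspan ▸ Submodule.fg_span (Set.finite_range g))
  refine ⟨Module.finrank_pos, ?_⟩
  have := finrank_le_of_span_eq_top (top_le_iff.mp hspan)
  simpa using this

namespace FoldExample

variable {F : Type*} [Field F] {n d : ℕ}

theorem eval_base_linForm [NeZero n] (i : Fin n) (j : ℕ) (hj : ¬ (i = 0 ∧ j = 1)) (a : F) :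
    eval (a • base F n) (linForm F i j) = -(j * a) := by
  rw [eval_linForm, if_neg hj]
  simp

/-- The point `[1 : 0 : ⋯ : 0]`. -/
noncomputable def basePoint (F : Type*) [Field F] (n : ℕ) : ProjSpace F n :=
  Projectivization.mk F (base F n) base_ne_zero

theorem exists_rep_basePoint : ∃ a : F, a ≠ 0 ∧ (basePoint F n).rep = a • base F n := by
  obtain ⟨a, ha⟩ := Projectivization.exists_smul_eq_mk_rep F (base F n) base_ne_zero
  exact ⟨a, a.ne_zero, ha.symm⟩

theorem chartIndex_basePoint : chartIndex (basePoint F n) = 0 := by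
  obtain ⟨a, ha, hrep⟩ := exists_rep_basePoint (F := F) (n := n)
  have h := rep_chartIndex_ne_zero (basePoint F n)
  generalize chartIndex (basePoint F n) = i at h
  cases i using Fin.cases with
  | zero => rfl
  | succ i =>
    rw [hrep] at h
    simp at h

variable [NeZero n] [NeZero d]

theorem toFun_eq_basePoint_iff {v : Fin (n + 1) → F} (hv : v ≠ 0) :
    (morphism F n d).toFun (Projectivization.mk F v hv) = basePoint F n ↔
      ∀ i : Fin n, eval v ((morphism F n d).coords i.succ) = 0 := by
  rw [ProjMorphism.toFun_mk, basePoint, Projectivization.mk_eq_mk_iff']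
  constructor
  · rintro ⟨c, hc⟩ i
    have := congrFun hc i.succ
    rw [Pi.smul_apply, base_succ, smul_zero] at this
    exact this.symm
  · intro h
    refine ⟨eval v ((morphism F n d).coords 0), funext fun i => ?_⟩
    cases i using Fin.cases with
    | zero => simp
    | succ i => simp [h i]

theorem eval_base_linForm_zero (i : Fin n) (a : F) : eval (a • base F n) (linForm F i 0) = 0 := by
  rw [eval_base_linForm i 0 (by simp)]
  simp

theorem eval_base_coords_succ (i : Fin n) (a : F) :
    eval (a • base F n) ((morphism F n d).coords i.succ) = 0 := by
  rw [coords_succ, map_prod]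
  exact Finset.prod_eq_zero (Finset.mem_univ (0 : Fin d)) (eval_base_linForm_zero i a)

theorem toFun_basePoint : (morphism F n d).toFun (basePoint F n) = basePoint F n :=
  (toFun_eq_basePoint_iff _).mpr fun i => by simpa using eval_base_coords_succ (d := d) i (1 : F)

theorem linForm_zero (i : Fin n) : linForm F i 0 = X i.succ := by
  simp [linForm]

theorem coords_succ_eq (i : Fin n) : (morphism F n d).coords i.succ =
    X i.succ * ∏ j ∈ Finset.univ.erase (0 : Fin d), linForm F i j := by
  rw [coords_succ, ← Finset.mul_prod_erase _ _ (Finset.mem_univ (0 : Fin d)), 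
    show ((0 : Fin d) : ℕ) = 0 from rfl, linForm_zero]

theorem coords_one_eq (hd : 2 ≤ d) : (morphism F n d).coords (Fin.succ 0) =
    X (Fin.succ 0) * linForm F 0 1 *
      ∏ j ∈ (Finset.univ.erase (0 : Fin d)).erase ⟨1, hd⟩, linForm F 0 j := by
  rw [coords_succ_eq, ← Finset.mul_prod_erase (Finset.univ.erase (0 : Fin d)) _ (a := ⟨1, hd⟩)
    (Finset.mem_erase.mpr ⟨by simp [Fin.ext_iff], Finset.mem_univ _⟩), mul_assoc]

/-- Two factors of the coordinate `Fin.succ 0` vanish at the base point, so its differential is zero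
there; the other coordinates are stationary in the direction of that variable. -/
theorem eval_jacobianDet_basePoint (hd : 2 ≤ d) (a : F) :
    eval (a • base F n) (morphism F n d).jacobianDet = 0 := by
  rw [ProjMorphism.eval_jacobianDet_eq_zero_iff]
  refine ⟨Pi.single (Fin.succ 0) 1, fun h => one_ne_zero (α := F) ?_, fun i => ?_⟩
  · simpa using congrFun h (Fin.succ 0)
  cases i using Fin.cases with
  | zero =>
    rw [coords_zero, dirDeriv_X_pow]
    simp
  | succ i =>
    by_cases hi : i = 0
    · subst hi
      have h1 : eval (a • base F n) (linForm F 0 1) = 0 := by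
        simp only [eval_linForm, and_self, if_true, Pi.smul_apply, base_succ, smul_zero,
          Finset.sum_const_zero, add_zero]
      have h0 : eval (a • base F n) (X (Fin.succ 0)) = 0 := by
        rw [eval_X, Pi.smul_apply, base_succ, smul_zero]
      rw [coords_one_eq hd, dirDeriv_mul, dirDeriv_mul, map_mul, h0, h1]
      ring
    · rw [coords_succ_eq, dirDeriv_mul, dirDeriv_X,
        Pi.single_eq_of_ne (Fin.succ_injective n |>.ne hi)]
      simp

theorem fibreMult_basePoint [IsAlgClosed F] [CharZero F] (hd : 2 ≤ d) :
    (morphism F n d).fibreMult (basePoint F n) (basePoint F n) = 2 := by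
  set f := morphism F n d with hf
  obtain ⟨a, ha, hrep⟩ := exists_rep_basePoint (F := F) (n := n)
  have hne : f.fibreMult (basePoint F n) (basePoint F n) ≠ 1 := fun h =>
    f.eval_jacobianDet_ne_zero (NeZero.ne d) toFun_basePoint h
      (hrep ▸ eval_jacobianDet_basePoint hd a)
  set v := (basePoint F n).rep with hv
  have hv0 : v 0 = a := by simp [hrep]
  have hvs : ∀ i : Fin n, v i.succ = 0 := fun i => by simp [hrep]
  set J := f.fibreIdeal (basePoint F n) ⊔
    Ideal.span {X (chartIndex (basePoint F n)) - C (v (chartIndex (basePoint F n)))} with hJ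
  have hX0 : X 0 - C (v 0) ∈ J := by
    have : X (chartIndex (basePoint F n)) - C (v (chartIndex (basePoint F n))) ∈ J :=
      Ideal.mem_sup_right (Ideal.mem_span_singleton_self _)
    rwa [chartIndex_basePoint] at this
  have hJle : J ≤ vanishingIdeal F {v} := by
    rw [hJ, ProjMorphism.fibreIdeal, sup_le_iff, Ideal.span_le, Ideal.span_le]
    constructor
    · rintro _ ⟨i, j, rfl⟩
      rw [SetLike.mem_coe, mem_vanishingIdeal_singleton]
      change eval v (C (v i) * f.coords j - C (v j) * f.coords i) = 0
      cases i using Fin.cases <;> cases j using Fin.cases <;>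
        simp [hrep, hf, eval_base_coords_succ]
    · rintro _ rfl
      exact mem_vanishingIdeal_singleton.mpr (by simp)
  have hcoord : ∀ i : Fin n, f.coords i.succ ∈ J := fun i => by
    have h : C (v 0) * f.coords i.succ - C (v i.succ) * f.coords 0 ∈ J :=
      Ideal.mem_sup_left (Ideal.subset_span ⟨0, i.succ, rfl⟩)
    have h2 := J.mul_mem_left (C (v 0)⁻¹) h
    rwa [hvs, C_0, zero_mul, sub_zero, ← mul_assoc, ← C_mul, hv0, inv_mul_cancel₀ ha, C_1,
      one_mul] at h2
  set L := Localization.AtPrime (vanishingIdeal F {v}) with hL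
  set θ := algebraMap (MvPolynomial (Fin (n + 1)) F) L with hθ
  -- The other factors are units at the base point, so the fibre equations give `X i.succ = 0` for
  -- `i ≠ 0`. The remaining equation then becomes that of a double point.
  have hX : ∀ i : Fin n, i ≠ 0 → θ (X i.succ) ∈ J.map θ := fun i hi => by
    refine algebraMap_mem_map_of_mul_mem (coords_succ_eq (F := F) (d := d) i ▸ hcoord i) ?_
    rw [map_prod, Finset.prod_ne_zero_iff]
    intro j hj
    have : (j : ℕ) ≠ 0 := fun h => Finset.ne_of_mem_erase hj (Fin.ext (by simpa using h))
    rw [hrep, eval_base_linForm _ _ (by simp [hi])]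
    simpa [ha] using this
  have hX1 : θ (X (Fin.succ 0)) * θ (X (Fin.succ 0)) ∈ J.map θ := by
    have h : θ (X (Fin.succ 0) * linForm F 0 1) ∈ J.map θ := by
      refine algebraMap_mem_map_of_mul_mem (coords_one_eq (F := F) (n := n) hd ▸ hcoord 0) ?_
      rw [map_prod, Finset.prod_ne_zero_iff]
      intro j hj
      have hj1 : (j : ℕ) ≠ 1 := fun h => Finset.ne_of_mem_erase hj (Fin.ext h)
      have hj0 : (j : ℕ) ≠ 0 := fun h =>
        Finset.ne_of_mem_erase (Finset.mem_of_mem_erase hj) (Fin.ext (by simpa using h))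
      rw [hrep, eval_base_linForm _ _ (by simp [hj1])]
      simpa [ha] using hj0
    rw [linForm, if_pos ⟨rfl, rfl⟩, mul_add, map_add, map_mul] at h
    refine ((J.map θ).add_mem_iff_left ?_).mp h
    rw [map_mul, map_sum]
    exact Ideal.mul_mem_left _ _ (sum_mem fun l hl => hX l (Finset.ne_of_mem_erase hl))
  have hmax : IsLocalRing.maximalIdeal L ≤ J.map θ ⊔ Ideal.span {θ (X (Fin.succ 0))} := by
    rw [← ProjMorphism.map_sup_span_eq_maximalIdeal
      (Ideal.span (Set.range fun i => X i - C (v i))) (v := v), Ideal.map_span, Ideal.span_le]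
    · rintro _ ⟨_, ⟨i, rfl⟩, rfl⟩
      cases i using Fin.cases with
      | zero => exact Ideal.mem_sup_left (Ideal.mem_map_of_mem _ hX0)
      | succ i =>
        simp only [hvs, C_0, sub_zero]
        by_cases hi : i = 0
        · rw [hi]
          exact Ideal.mem_sup_right (Ideal.mem_span_singleton_self _)
        · exact Ideal.mem_sup_left (hX i hi)
    · rw [Ideal.span_le]
      rintro _ ⟨i, rfl⟩
      exact mem_vanishingIdeal_singleton.mpr (by simp)
    · intro k hk
      ext i
      simpa [dirDeriv_sub] using hk _ (Ideal.subset_span ⟨i, rfl⟩)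
  have htop : J.map θ ≠ ⊤ := by
    intro h
    have h1 := Ideal.map_mono (f := θ) hJle
    rw [h, Localization.AtPrime.map_eq_maximalIdeal] at h1
    exact Ideal.IsPrime.ne_top' (top_le_iff.mp h1)
  have := finrank_quotient_le_two (F := F) (exists_sub_algebraMap_mem_maximalIdeal v) htop hX1 hmax
  change 0 < f.fibreMult (basePoint F n) (basePoint F n) ∧
    f.fibreMult (basePoint F n) (basePoint F n) ≤ 2 at this
  omega

/-- The choices 0 and 1 for the modified coordinate give the same point when all other choices are
0. This is the only coincidence with the base point, whence `d ^ n - 2` further points. -/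
theorem fibreVec_eq_base_iff [CharZero F] (hd : 2 ≤ d) (c : Fin n → Fin d) :
    fibreVec F c = base F n ↔ c = 0 ∨ c = Pi.single 0 ⟨1, hd⟩ := by
  constructor
  · intro h
    have h1 : ∀ i, i ≠ 0 → c i = 0 := fun i hi => by
      have := congrFun h i.succ
      rw [fibreVec_succ_of_ne c hi, base_succ, Nat.cast_eq_zero] at this
      exact Fin.ext (by simpa using this)
    have h0 := congrFun h (Fin.succ 0)
    rw [fibreVec_succ, base_succ] at h0
    by_cases hc : (c 0 : ℕ) = 1
    · right
      ext i
      by_cases hi : i = 0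
      · subst hi
        simp [hc]
      · simp [h1 i hi, hi]
    · left
      rw [if_neg (by simp [hc]), Nat.cast_eq_zero] at h0
      ext i
      by_cases hi : i = 0
      · subst hi
        simp [h0]
      · simp [h1 i hi]
  · have hsum : ∀ c : Fin n → Fin d, (∀ i, i ≠ 0 → c i = 0) →
        ∑ l ∈ Finset.univ.erase (0 : Fin n), ((c l : ℕ) : F) = 0 := fun c hc =>
      Finset.sum_eq_zero fun l hl => by simp [hc l (Finset.ne_of_mem_erase hl)]
    rintro (rfl | rfl) <;> ext i <;> cases i using Fin.cases with
    | zero => simp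
    | succ i =>
      rw [fibreVec_succ, hsum _ (by intro i hi; simp [hi])]
      by_cases hi : i = 0 <;> simp [hi, -Fin.succ_zero_eq_one, -Fin.succ_zero_eq_one']

theorem card_fibreVec_ne_base [CharZero F] (hd : 2 ≤ d) :
    Nat.card {c : Fin n → Fin d // fibreVec F c ≠ base F n} = d ^ n - 2 := by
  classical
  rw [Nat.card_eq_fintype_card, Fintype.card_subtype_compl, Fintype.card_fun, Fintype.card_fin,
    Fintype.card_fin]
  congr 1
  rw [Fintype.card_subtype]
  have : (Finset.univ.filter fun c : Fin n → Fin d => fibreVec F c = base F n) =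
      {0, Pi.single 0 ⟨1, hd⟩} := by
    ext c
    simp [fibreVec_eq_base_iff hd]
  rw [this, Finset.card_pair]
  intro h
  have := congrArg Fin.val (congrFun h 0)
  simp at this

theorem exists_isMinimallyBranchedAt [IsAlgClosed F] [CharZero F] (hd : 2 ≤ d) :
    ∃ ps, (morphism F n d).IsMinimallyBranchedAt (basePoint F n) (basePoint F n) ps := by
  set f := morphism F n d with hf
  obtain ⟨N, hN⟩ := f.exists_isHomogeneous_jacobianDet
  let e : Fin (d ^ n - 2) ≃ {c : Fin n → Fin d // fibreVec F c ≠ base F n} :=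
    (Finite.equivFinOfCardEq (card_fibreVec_ne_base hd)).symm
  have htoFun : ∀ c : Fin n → Fin d,
      f.toFun (Projectivization.mk F (fibreVec F c) (fibreVec_ne_zero c)) = basePoint F n :=
    fun c => (toFun_eq_basePoint_iff _).mpr (eval_fibreVec_coords_succ c)
  refine ⟨fun i => Projectivization.mk F (fibreVec F (e i).1) (fibreVec_ne_zero _), ?_, ?_, ?_,
    fibreMult_basePoint hd, ?_⟩
  · intro i j hij
    have h := (mk_eq_mk_iff_of_apply_eq_one (fibreVec_zero _) (fibreVec_zero _)).mp hij
    -- Away from the base point the vanishing factors determine the choice `c`, so these points are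
    -- distinct.
    refine e.injective (Subtype.ext (funext fun l => Fin.ext ?_))
    refine ((eval_fibreVec_linForm_eq_zero_iff (e j).2).mp ?_)
    rw [← h]
    exact eval_fibreVec_linForm _ l
  · intro i h
    exact (e i).2 ((mk_eq_mk_iff_of_apply_eq_one (fibreVec_zero _) base_zero).mp h)
  · ext x
    constructor
    · intro hx
      have hx' : f.toFun x = basePoint F n := hx
      conv_lhs at hx' => rw [← x.mk_rep]
      rw [toFun_eq_basePoint_iff] at hx'
      have hx0 : x.rep 0 ≠ 0 := by
        intro h
        refine x.rep_nonzero (f.eq_zero_of_common_zero _ fun i => ?_)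
        cases i using Fin.cases with
        | zero => rw [hf, coords_zero, map_pow, eval_X, h, zero_pow (NeZero.ne d)]
        | succ i => exact hx' i
      obtain ⟨c, hc⟩ := exists_fibreVec (d := d) (v := (x.rep 0)⁻¹ • x.rep)
        (by simp [hx0]) fun i => by
          rw [((morphism F n d).isHomogeneous _).eval_smul, hx' i, mul_zero]
      have hxc : x = Projectivization.mk F (fibreVec F c) (fibreVec_ne_zero c) := by
        conv_lhs => rw [← x.mk_rep]
        rw [Projectivization.mk_eq_mk_iff']
        exact ⟨x.rep 0, by rw [← hc, smul_smul, mul_inv_cancel₀ hx0, one_smul]⟩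
      by_cases hcb : fibreVec F c = base F n
      · left
        rw [hxc, basePoint, mk_eq_mk_iff_of_apply_eq_one (fibreVec_zero _) base_zero, hcb]
      · right
        exact ⟨e.symm ⟨c, hcb⟩, by simp [hxc]⟩
    · rintro (rfl | ⟨i, rfl⟩)
      · exact toFun_basePoint
      · exact htoFun _
  · intro i
    refine f.fibreMult_eq_one (NeZero.ne d) (htoFun _) ?_
    rw [Ne, eval_rep_mk hN]
    exact eval_jacobianDet_fibreVec_ne_zero (e i).2

end FoldExample

theorem proposition22 {F : Type*} [Field F] [IsAlgClosed F] [CharZero F]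
    (n d : ℕ) (hn : 1 ≤ n) (hd : 2 ≤ d) :
    (∃ f : ProjMorphism F n d,
      (∃ L : Fin (n + 1) → Fin d → MvPolynomial (Fin (n + 1)) F,
        (∀ i j, (L i j).IsHomogeneous 1) ∧ ∀ i, f.coords i = ∏ j, L i j) ∧
      ∃ q ∈ f.branchLocus, ∃ (p : ProjSpace F n) (ps : Fin (d ^ n - 2) → ProjSpace F n),
        f.IsMinimallyBranchedAt q p ps) ∧
    (∀ (f : ProjMorphism F n d) (q p : ProjSpace F n) (ps : Fin (d ^ n - 2) → ProjSpace F n),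
      f.IsMinimallyBranchedAt q p ps →
      IsSmoothPointOf f.branchLocus q ∧
      ∃ B ∈ componentsOf f.branchLocus, q ∈ B ∧
        (∀ B' ∈ componentsOf f.branchLocus, q ∈ B' → B' = B) ∧
        ∃ C ∈ componentsOf f.critLocus, f.toFun '' C = B ∧
          (∀ C' ∈ componentsOf f.critLocus, f.toFun '' C' = B → C' = C) ∧
          f.IsGenericallyOneToOne C B ∧
          f.HasMultiplicityAlong C B 2) := by
  have : NeZero n := ⟨by omega⟩
  have hd0 : d ≠ 0 := by omega
  have : NeZero d := ⟨hd0⟩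
  constructor
  · obtain ⟨ps, hps⟩ := FoldExample.exists_isMinimallyBranchedAt (F := F) (n := n) hd
    refine ⟨FoldExample.morphism F n d, ⟨FoldExample.factor d, FoldExample.isHomogeneous_factor d,
      fun _ => rfl⟩, FoldExample.basePoint F n, ⟨FoldExample.basePoint F n, ?_,
      FoldExample.toFun_basePoint⟩, FoldExample.basePoint F n, ps, hps⟩
    exact mem_projZeroLocus_singleton.mpr (hps.isIsolatedFold hd0).1.1
  · intro f q p ps h
    rw [← h.toFun_eq]
    exact (h.isIsolatedFold hd0).components hd0
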